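/- Let $G$ be a finite group. Monoids and (semi-)rings are commutative and unital. Write $G\text{-}\mathrm{set}$ for the category of finite $G$-sets. An *additive contravariant functor* is a contravariant functor $F$ from $G\text{-}\mathrm{set}$ to commutative monoids sending finite direct sums to direct products (in particular $F(\emptyset)$ is trivial). A *semi-Mackey functor* $M=(M^*,M_*)$ is an additive contravariant functor $M^*$ together with a covariant functor $M_*$ with the same values $M(X)$, such that $M^*(f)M_*(g)=M_*(g')M^*(f')$ for every pull-back square with $g f'=f g'$; a *Mackey functor* is the same with values in abelian groups. A *Green functor* is a Mackey functor $A$ with a bilinear cross product $A(X)\times A(Y)\to A(X\times Y)$, natural for both the contravariant and the covariant part, associative and with a unit in $A(\mathrm{pt})$. A *semi-Tambara functor* $S=(S^*,S_+,S_\bullet)$ assigns to each $X$ a semiring $S(X)$ so that $(S^*,S_+)$ and $(S^*,S_\bullet)$ are semi-Mackey functors for the additive and multiplicative monoids respectively and, for every $\eta\colon X\to Y$ and $\xi\colon Z\to X$ with exponential diagram $X\xleftarrow{\xi}Z\xleftarrow{\zeta}X\times_Y\Pi_\eta(Z)\xrightarrow{\eta'}\Pi_\eta(Z)\xrightarrow{\upsilon}Y$,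 where $\Pi_\eta(Z)=\{(y,\sigma): \sigma\colon\eta^{-1}(y)\to Z,\ \xi\sigma=\mathrm{id}\}$, $\zeta(x,(y,\sigma))=\sigma(x)$ and $\eta',\upsilon$ are the projections, one has $S_+(\upsilon)S_\bullet(\eta')S^*(\zeta)=S_\bullet(\eta)S_+(\xi)$; it is a *Tambara functor* if every $S(X)$ is a ring. The underlying Green functor of a Tambara functor $T$ is $(T^*,T_+)$ with cross product $(x,y)\mapsto T^*(p_X)(x)\cdot T^*(p_Y)(y)$, where $p_X,p_Y$ are the projections of $X\times Y$, and with unit $1\in T(\mathrm{pt})$. For an additive contravariant functor $F$, let $(G,X,F)$ be the category of pairs $(A\xrightarrow{p}X,m)$ with $p$ a map of finite $G$-sets and $m\in F(A)$; a morphism to $(A'\xrightarrow{p'}X,m')$ is a $G$-map $f\colon A\to A'$ with $p'f=p$ and $F(f)(m')=m$. The *$F$-Burnside Green functor* $\mathcal A_F$ has as value $\mathcal A_F(X)$ the Grothendieck group of the isomorphism classes of $(G,X,F)$ under direct sum, with restriction by pull-back, transfer by composition, cross product induced by $\big((A\to X,m),(B\to Y,n)\big)\mapsto (A\times B\to X\times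 Y,\ F(p_A)(m)F(p_B)(n))$, and unit $(\mathrm{pt}\to\mathrm{pt},1)$. For a semi-Mackey functor $M$, let $\mathcal S_M$ be the semi-Tambara functor whose value at $X$ is the semiring of isomorphism classes of $(G,X,M^*)$ (sum: direct sum; product: $(A_1\times_XA_2\to X,\ M^*(\varpi_1)(m_1)M^*(\varpi_2)(m_2))$, with $\varpi_i$ the projections), with restriction by pull-back, additive transfer by composition, and multiplicative transfer $\eta_\bullet(A\xrightarrow{p}X,m)=(\Pi_\eta(A)\xrightarrow{\upsilon}Y,\ M_*(\rho)M^*(\lambda)(m))$, where $X\xleftarrow{p}A\xleftarrow{\lambda}X\times_Y\Pi_\eta(A)\xrightarrow{\rho}\Pi_\eta(A)\xrightarrow{\upsilon}Y$ is the exponential diagram. Let $\mathcal T_M$ be the Tambara functor obtained from $\mathcal S_M$ by ring completion of all values: $\mathcal T_M(X)=K_0(\mathcal S_M(X))$, with structure maps extending those of $\mathcal S_M$. **Theorem.** Let $F$ be an additive contravariant functor. If there is a semi-Mackey functor with contravariant part $F$, then $\mathcal A_F$ has a structure of a Tambara functor, i.e. $\mathcal A_F$ is isomorphic, as a Green functor,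 to the underlying Green functor of a Tambara functor. More precisely, for every semi-Mackey functor $M$ with $M^*=F$, the Tambara functor $\mathcal T_M$ exists, and its underlying Green functor is isomorphic to $\mathcal A_F$. -/

import Mathlib

universe u v w

set_option linter.checkUnivs false

namespace MackeyTambara

/-! ### Finite G-sets -/

/-- A finite `G`-set. Morphisms of finite `G`-sets are the equivariant maps `X →[G] Y`. -/
structure FinGSet (G : Type u) [Group G] where
  /-- the underlying set -/
  carrier : Type w
  [fin : Finite carrier]
  [act : MulAction G carrier]

namespace FinGSet

variable {G : Type u} [Group G]

instance : CoeSort (FinGSet.{u, w} G) (Type w) := ⟨FinGSet.carrier⟩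

instance (X : FinGSet.{u, w} G) : Finite X := X.fin

instance (X : FinGSet.{u, w} G) : MulAction G X := X.act

/-- The empty `G`-set. -/
def empty (G : Type u) [Group G] : FinGSet.{u, w} G where
  carrier := PEmpty.{w + 1}
  act :=
    { smul := fun _ a => a
      one_smul := fun a => a.elim
      mul_smul := fun _ _ a => a.elim }

instance : IsEmpty (empty.{u, w} G) := inferInstanceAs (IsEmpty PEmpty)

/-- The one-point `G`-set. -/
def pt (G : Type u) [Group G] : FinGSet.{u, w} G where
  carrier := PUnit.{w + 1}

/-- The direct sum of two finite `G`-sets. -/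
def sum (X Y : FinGSet.{u, w} G) : FinGSet.{u, w} G where
  carrier := X ⊕ Y

/-- The direct product of two finite `G`-sets, with the diagonal action. -/
def prod (X Y : FinGSet.{u, w} G) : FinGSet.{u, w} G where
  carrier := X × Y

/-- The fibre product of two maps of finite `G`-sets. -/
def pull {X Y Z : FinGSet.{u, w} G} (f : X →[G] Z) (g : Y →[G] Z) : FinGSet.{u, w} G where
  carrier := {q : X × Y // f q.1 = g q.2}
  act :=
    { smul := fun a q => ⟨a • q.1, by
        simp only [Prod.smul_fst, Prod.smul_snd, map_smul, q.2]⟩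
      one_smul := fun q => Subtype.ext (one_smul G q.1)
      mul_smul := fun a b q => Subtype.ext (mul_smul a b q.1) }

/-- The map out of the empty `G`-set. -/
def elim (X : FinGSet.{u, w} G) : empty.{u, w} G →[G] X where
  toFun := fun a => PEmpty.elim a
  map_smul' := fun _ a => PEmpty.elim a

/-- The map to the one-point `G`-set. -/
def toPt (X : FinGSet.{u, w} G) : X →[G] pt.{u, w} G where
  toFun := fun _ => PUnit.unit
  map_smul' := fun _ _ => rfl

/-- The first inclusion into a direct sum. -/
def inl (X Y : FinGSet.{u, w} G) : X →[G] X.sum Y where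
  toFun := Sum.inl
  map_smul' := fun _ _ => rfl

/-- The second inclusion into a direct sum. -/
def inr (X Y : FinGSet.{u, w} G) : Y →[G] X.sum Y where
  toFun := Sum.inr
  map_smul' := fun _ _ => rfl

/-- The map out of a direct sum given by two maps. -/
def copair {X Y Z : FinGSet.{u, w} G} (f : X →[G] Z) (g : Y →[G] Z) : X.sum Y →[G] Z where
  toFun := Sum.elim f g
  map_smul' := fun a q => by
    rcases q with q | q
    · exact map_smul f a q
    · exact map_smul g a q

/-- The first projection of a product. -/
def fst (X Y : FinGSet.{u, w} G) : X.prod Y →[G] X where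
  toFun := Prod.fst
  map_smul' := fun _ _ => rfl

/-- The second projection of a product. -/
def snd (X Y : FinGSet.{u, w} G) : X.prod Y →[G] Y where
  toFun := Prod.snd
  map_smul' := fun _ _ => rfl

/-- The map into a product given by two maps. -/
def pair {W X Y : FinGSet.{u, w} G} (f : W →[G] X) (g : W →[G] Y) : W →[G] X.prod Y where
  toFun := fun a => (f a, g a)
  map_smul' := fun a q => Prod.ext (map_smul f a q) (map_smul g a q)

/-- The product `f × g` of two maps. -/
def prodMap {X Y X' Y' : FinGSet.{u, w} G} (f : X →[G] X') (g : Y →[G] Y') :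
    X.prod Y →[G] X'.prod Y' :=
  pair (f.comp (fst X Y)) (g.comp (snd X Y))

/-- The first projection of a fibre product. -/
def pullFst {X Y Z : FinGSet.{u, w} G} (f : X →[G] Z) (g : Y →[G] Z) : pull f g →[G] X where
  toFun := fun q => q.1.1
  map_smul' := fun _ _ => rfl

/-- The second projection of a fibre product. -/
def pullSnd {X Y Z : FinGSet.{u, w} G} (f : X →[G] Z) (g : Y →[G] Z) : pull f g →[G] Y where
  toFun := fun q => q.1.2
  map_smul' := fun _ _ => rfl

/-- The square with `top : P → Y`, `left : P → X`, `right : Y → Z`, `bot : X → Z` is a pull-back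
square of finite `G`-sets (pull-backs of `G`-sets are computed on underlying sets). -/
def IsPullback {P X Y Z : FinGSet.{u, w} G} (top : P →[G] Y) (left : P →[G] X)
    (right : Y →[G] Z) (bot : X →[G] Z) : Prop :=
  (∀ p, bot (left p) = right (top p)) ∧
    ∀ a b, bot a = right b → ∃! p, left p = a ∧ top p = b

/-- The set of pairs `(y, σ)` with `y : Y` and `σ` a map `η⁻¹(y) → A` with `p ∘ σ = id`. -/
structure Sections {A X Y : FinGSet.{u, w} G} (η : X →[G] Y) (p : A →[G] X) : Type w where
  /-- the point `y` -/
  base : Y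
  /-- the section over the fibre of `y` -/
  sec : {a : X // η a = base} → A
  sec_spec : ∀ a, p (sec a) = a.1

theorem Sections.ext' {A X Y : FinGSet.{u, w} G} {η : X →[G] Y} {p : A →[G] X}
    {s t : Sections η p} (hb : s.base = t.base)
    (hs : ∀ a h h', s.sec ⟨a, h⟩ = t.sec ⟨a, h'⟩) : s = t := by
  rcases s with ⟨b, σ, hσ⟩
  rcases t with ⟨b', τ, hτ⟩
  obtain rfl : b = b' := hb
  have : σ = τ := funext fun a => hs a.1 a.2 a.2
  subst this
  rfl

theorem Sections.sec_congr {A X Y : FinGSet.{u, w} G} {η : X →[G] Y} {p : A →[G] X}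
    (s : Sections η p) {a b : X} (hab : a = b) {h : η a = s.base} :
    s.sec ⟨a, h⟩ = s.sec ⟨b, hab ▸ h⟩ := by
  subst hab
  rfl

/-- The action of `G` on `Π_η(A)`: `g • (y, σ) = (g • y, a ↦ g • σ (g⁻¹ • a))`. -/
def Sections.smul {A X Y : FinGSet.{u, w} G} {η : X →[G] Y} {p : A →[G] X} (g : G)
    (s : Sections η p) : Sections η p where
  base := g • s.base
  sec := fun a => g • s.sec ⟨g⁻¹ • a.1, by rw [map_smul, a.2, inv_smul_smul]⟩
  sec_spec := fun a => by rw [map_smul, s.sec_spec, smul_inv_smul]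

/-- The finite `G`-set `Π_η(A)`. -/
def sections {A X Y : FinGSet.{u, w} G} (η : X →[G] Y) (p : A →[G] X) : FinGSet.{u, w} G where
  carrier := Sections η p
  fin := by
    refine Finite.of_injective
      (β := Σ y : Y, {a : X // η a = y} → A) (fun s => ⟨s.base, s.sec⟩) ?_
    rintro ⟨b, σ, hσ⟩ ⟨b', τ, hτ⟩ h
    simp only [Sigma.mk.injEq] at h
    obtain ⟨rfl, h⟩ := h
    obtain rfl := eq_of_heq h
    rfl
  act :=
    { smul := Sections.smul
      one_smul := fun s => by
        refine Sections.ext' (s := Sections.smul 1 s) (one_smul G s.base) fun a h h' => ?_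
        refine (one_smul G _).trans (s.sec_congr ?_)
        rw [inv_one, one_smul]
      mul_smul := fun g k s => by
        refine Sections.ext' (s := Sections.smul (g * k) s)
          (t := Sections.smul g (Sections.smul k s)) (mul_smul g k s.base) fun a h h' => ?_
        refine (mul_smul g k _).trans ?_
        refine congrArg (fun z => g • k • z) (s.sec_congr ?_)
        rw [mul_inv_rev, mul_smul] }

/-- The diagram `X ← Z ← X' → Y' → Y` with arrows `ξ, ζ, η', υ`, together with `η : X → Y`, is an
exponential diagram: it is isomorphic to the diagram
`X ← Z ← X ×_Y Π_η(Z) → Π_η(Z) → Y` whose second arrow is the evaluation `(a, (y, σ)) ↦ σ(a)` and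
whose other arrows are `ξ` and the projections. -/
def IsExponential {X Y Z X' Y' : FinGSet.{u, w} G} (η : X →[G] Y) (ξ : Z →[G] X)
    (ζ : X' →[G] Z) (η' : X' →[G] Y') (υ : Y' →[G] Y) : Prop :=
  IsPullback η' (ξ.comp ζ) υ η ∧
    ∃ e : Y' →[G] sections η ξ, Function.Bijective e ∧
      (∀ b, Sections.base (e b) = υ b) ∧
      ∀ c h, Sections.sec (e (η' c)) ⟨ξ (ζ c), h⟩ = ζ c

/-- Every pair `Z → X → Y` is part of an exponential diagram. -/
theorem exists_isExponential {X Y Z : FinGSet.{u, w} G} (η : X →[G] Y) (ξ : Z →[G] X) :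
    ∃ (X' Y' : FinGSet.{u, w} G) (ζ : X' →[G] Z) (η' : X' →[G] Y') (υ : Y' →[G] Y),
      IsExponential η ξ ζ η' υ := by
  let υ : sections η ξ →[G] Y := { toFun := Sections.base, map_smul' := fun _ _ => rfl }
  let ζ : pull η υ →[G] Z :=
    { toFun := fun q => Sections.sec q.1.2 ⟨q.1.1, q.2⟩
      map_smul' := fun g q => by
        refine congrArg (fun z => g • z) (Sections.sec_congr q.1.2 ?_)
        exact inv_smul_smul g q.1.1 }
  have hζ : ∀ q, ξ (ζ q) = q.1.1 := fun q => Sections.sec_spec q.1.2 _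
  refine ⟨pull η υ, sections η ξ, ζ, pullSnd η υ, υ, ⟨fun q => ?_, fun a b hab => ?_⟩,
    MulActionHom.id G, Function.bijective_id, fun _ => rfl, fun c h => ?_⟩
  · change η (ξ (ζ q)) = _
    rw [hζ]
    exact q.2
  · refine ⟨⟨(a, b), hab⟩, ⟨hζ _, rfl⟩, ?_⟩
    rintro q ⟨h1, h2⟩
    refine Subtype.ext (Prod.ext ?_ h2)
    exact (hζ q).symm.trans h1
  · exact Sections.sec_congr c.1.2 (hζ c)

/-! Auxiliary facts on finite `G`-sets. -/

theorem exists_inverse {X Y : FinGSet.{u, w} G} (f : X →[G] Y) (hf : Function.Bijective f) :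
    ∃ g : Y →[G] X, (∀ a, g (f a) = a) ∧ ∀ b, f (g b) = b := by
  let e := Equiv.ofBijective f hf
  exact ⟨f.inverse e.symm e.left_inv e.right_inv, e.left_inv, e.right_inv⟩

theorem isPullback_pull {X Y Z : FinGSet.{u, w} G} (f : X →[G] Z) (g : Y →[G] Z) :
    IsPullback (pullSnd f g) (pullFst f g) g f :=
  ⟨fun q => q.2, fun a b h => ⟨⟨(a, b), h⟩, ⟨rfl, rfl⟩, fun _ hq =>
    Subtype.ext (Prod.ext hq.1 hq.2)⟩⟩

end FinGSet

open FinGSet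

/-! ### Additive contravariant functors, semi-Mackey functors -/

/-- An additive contravariant functor from finite `G`-sets to commutative monoids. -/
structure AdditiveFunctor (G : Type u) [Group G] where
  /-- the value at a finite `G`-set -/
  obj : FinGSet.{u, w} G → Type v
  [commMonoid : ∀ X, CommMonoid (obj X)]
  /-- the contravariant functoriality -/
  map : ∀ {X Y : FinGSet.{u, w} G}, (X →[G] Y) → (obj Y →* obj X)
  map_id : ∀ (X : FinGSet.{u, w} G) (m : obj X), map (MulActionHom.id G) m = m
  map_comp : ∀ {X Y Z : FinGSet.{u, w} G} (g : Y →[G] Z) (f : X →[G] Y) (m : obj Z),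
    map (g.comp f) m = map f (map g m)
  additive_empty : Subsingleton (obj (FinGSet.empty G))
  additive_sum : ∀ X Y : FinGSet.{u, w} G,
    Function.Bijective fun m : obj (X.sum Y) => (map (inl X Y) m, map (inr X Y) m)

attribute [instance] AdditiveFunctor.commMonoid

/-- A semi-Mackey functor on the finite group `G`, with values in commutative monoids: an additive
contravariant functor `M^*` together with a covariant functor `M_*` with the same values,
satisfying the Mackey condition. -/
structure SemiMackeyFunctor (G : Type u) [Group G] extends AdditiveFunctor.{u, v, w} G where
  /-- the covariant functoriality -/
  tr : ∀ {X Y : FinGSet.{u, w} G}, (X →[G] Y) → (obj X →* obj Y)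
  tr_id : ∀ (X : FinGSet.{u, w} G) (m : obj X), tr (MulActionHom.id G) m = m
  tr_comp : ∀ {X Y Z : FinGSet.{u, w} G} (g : Y →[G] Z) (f : X →[G] Y) (m : obj X),
    tr (g.comp f) m = tr g (tr f m)
  mackey : ∀ {X' Y' X Y : FinGSet.{u, w} G} (g' : X' →[G] Y') (f' : X' →[G] X)
    (f : Y' →[G] Y) (g : X →[G] Y), IsPullback g' f' f g →
    ∀ m : obj X, map f (tr g m) = tr g' (map f' m)

/-! ### Mackey functors and Green functors -/

/-- A Mackey functor on the finite group `G` (with values in abelian groups, written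
additively). -/
structure MackeyFunctor (G : Type u) [Group G] where
  /-- the value at a finite `G`-set -/
  obj : FinGSet.{u, w} G → Type v
  [addCommGroup : ∀ X, AddCommGroup (obj X)]
  /-- the contravariant part -/
  res : ∀ {X Y : FinGSet.{u, w} G}, (X →[G] Y) → (obj Y →+ obj X)
  /-- the covariant part -/
  tr : ∀ {X Y : FinGSet.{u, w} G}, (X →[G] Y) → (obj X →+ obj Y)
  res_id : ∀ (X : FinGSet.{u, w} G) (m : obj X), res (MulActionHom.id G) m = m
  res_comp : ∀ {X Y Z : FinGSet.{u, w} G} (g : Y →[G] Z) (f : X →[G] Y) (m : obj Z),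
    res (g.comp f) m = res f (res g m)
  tr_id : ∀ (X : FinGSet.{u, w} G) (m : obj X), tr (MulActionHom.id G) m = m
  tr_comp : ∀ {X Y Z : FinGSet.{u, w} G} (g : Y →[G] Z) (f : X →[G] Y) (m : obj X),
    tr (g.comp f) m = tr g (tr f m)
  mackey : ∀ {X' Y' X Y : FinGSet.{u, w} G} (g' : X' →[G] Y') (f' : X' →[G] X)
    (f : Y' →[G] Y) (g : X →[G] Y), IsPullback g' f' f g →
    ∀ m : obj X, res f (tr g m) = tr g' (res f' m)
  additive_empty : Subsingleton (obj (FinGSet.empty G))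
  additive_sum : ∀ X Y : FinGSet.{u, w} G,
    Function.Bijective fun m : obj (X.sum Y) => (res (inl X Y) m, res (inr X Y) m)

attribute [instance] MackeyFunctor.addCommGroup

/-- A Green functor: a Mackey functor with a bilinear, bifunctorial, associative and unital cross
product. The products `(X × Y) × Z` and `X × (Y × Z)`, and `pt × X`, `X × pt` and `X`, are
identified along the canonical isomorphisms. -/
structure GreenFunctor (G : Type u) [Group G] extends MackeyFunctor.{u, v, w} G where
  /-- the cross product -/
  cross : ∀ X Y : FinGSet.{u, w} G, obj X →+ obj Y →+ obj (X.prod Y)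
  /-- the unit -/
  unit : obj (FinGSet.pt G)
  cross_res : ∀ {X Y X' Y' : FinGSet.{u, w} G} (f : X →[G] X') (g : Y →[G] Y')
    (a : obj X') (b : obj Y'),
    res (prodMap f g) (cross X' Y' a b) = cross X Y (res f a) (res g b)
  cross_tr : ∀ {X Y X' Y' : FinGSet.{u, w} G} (f : X →[G] X') (g : Y →[G] Y')
    (a : obj X) (b : obj Y),
    tr (prodMap f g) (cross X Y a b) = cross X' Y' (tr f a) (tr g b)
  cross_assoc : ∀ (X Y Z : FinGSet.{u, w} G) (a : obj X) (b : obj Y) (c : obj Z),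
    cross (X.prod Y) Z (cross X Y a b) c =
      res (pair ((fst X Y).comp (fst (X.prod Y) Z))
          (pair ((snd X Y).comp (fst (X.prod Y) Z)) (snd (X.prod Y) Z)))
        (cross X (Y.prod Z) a (cross Y Z b c))
  unit_cross : ∀ (X : FinGSet.{u, w} G) (a : obj X),
    cross (FinGSet.pt G) X unit a = res (snd (FinGSet.pt G) X) a
  cross_unit : ∀ (X : FinGSet.{u, w} G) (a : obj X),
    cross X (FinGSet.pt G) a unit = res (fst X (FinGSet.pt G)) a

/-- An isomorphism of Green functors. -/
structure GreenIso {G : Type u} [Group G] (A B : GreenFunctor.{u, v, w} G) where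
  /-- the components -/
  app : ∀ X : FinGSet.{u, w} G, A.obj X ≃+ B.obj X
  app_res : ∀ {X Y : FinGSet.{u, w} G} (f : X →[G] Y) (a : A.obj Y),
    app X (A.res f a) = B.res f (app Y a)
  app_tr : ∀ {X Y : FinGSet.{u, w} G} (f : X →[G] Y) (a : A.obj X),
    app Y (A.tr f a) = B.tr f (app X a)
  app_cross : ∀ (X Y : FinGSet.{u, w} G) (a : A.obj X) (b : A.obj Y),
    app (X.prod Y) (A.cross X Y a b) = B.cross X Y (app X a) (app Y b)
  app_unit : app (FinGSet.pt G) A.unit = B.unit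

/-! ### Semi-Tambara functors and Tambara functors -/

/-- A semi-Tambara functor on the finite group `G`. -/
structure SemiTambaraFunctor (G : Type u) [Group G] where
  /-- the value at a finite `G`-set -/
  obj : FinGSet.{u, w} G → Type v
  [commSemiring : ∀ X, CommSemiring (obj X)]
  /-- the contravariant part -/
  res : ∀ {X Y : FinGSet.{u, w} G}, (X →[G] Y) → (obj Y →+* obj X)
  /-- the additive transfers -/
  tr : ∀ {X Y : FinGSet.{u, w} G}, (X →[G] Y) → (obj X →+ obj Y)
  /-- the multiplicative transfers -/
  nm : ∀ {X Y : FinGSet.{u, w} G}, (X →[G] Y) → (obj X →* obj Y)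
  res_id : ∀ (X : FinGSet.{u, w} G) (m : obj X), res (MulActionHom.id G) m = m
  res_comp : ∀ {X Y Z : FinGSet.{u, w} G} (g : Y →[G] Z) (f : X →[G] Y) (m : obj Z),
    res (g.comp f) m = res f (res g m)
  tr_id : ∀ (X : FinGSet.{u, w} G) (m : obj X), tr (MulActionHom.id G) m = m
  tr_comp : ∀ {X Y Z : FinGSet.{u, w} G} (g : Y →[G] Z) (f : X →[G] Y) (m : obj X),
    tr (g.comp f) m = tr g (tr f m)
  nm_id : ∀ (X : FinGSet.{u, w} G) (m : obj X), nm (MulActionHom.id G) m = m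
  nm_comp : ∀ {X Y Z : FinGSet.{u, w} G} (g : Y →[G] Z) (f : X →[G] Y) (m : obj X),
    nm (g.comp f) m = nm g (nm f m)
  mackey_tr : ∀ {X' Y' X Y : FinGSet.{u, w} G} (g' : X' →[G] Y') (f' : X' →[G] X)
    (f : Y' →[G] Y) (g : X →[G] Y), IsPullback g' f' f g →
    ∀ m : obj X, res f (tr g m) = tr g' (res f' m)
  mackey_nm : ∀ {X' Y' X Y : FinGSet.{u, w} G} (g' : X' →[G] Y') (f' : X' →[G] X)
    (f : Y' →[G] Y) (g : X →[G] Y), IsPullback g' f' f g →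
    ∀ m : obj X, res f (nm g m) = nm g' (res f' m)
  additive_empty : Subsingleton (obj (FinGSet.empty G))
  additive_sum : ∀ X Y : FinGSet.{u, w} G,
    Function.Bijective fun m : obj (X.sum Y) => (res (inl X Y) m, res (inr X Y) m)
  exponential : ∀ {X Y Z X' Y' : FinGSet.{u, w} G} (η : X →[G] Y) (ξ : Z →[G] X)
    (ζ : X' →[G] Z) (η' : X' →[G] Y') (υ : Y' →[G] Y), IsExponential η ξ ζ η' υ →
    ∀ m : obj Z, tr υ (nm η' (res ζ m)) = nm η (tr ξ m)

attribute [instance] SemiTambaraFunctor.commSemiring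

/-- A Tambara functor: a semi-Tambara functor whose values are rings. -/
structure TambaraFunctor (G : Type u) [Group G] extends SemiTambaraFunctor.{u, v, w} G where
  exists_add_eq_zero : ∀ (X : FinGSet.{u, w} G) (a : obj X), ∃ b, a + b = 0

/-- A morphism of semi-Tambara functors. -/
structure SemiTambaraHom {G : Type u} [Group G] (S T : SemiTambaraFunctor.{u, v, w} G) where
  /-- the components -/
  app : ∀ X : FinGSet.{u, w} G, S.obj X →+* T.obj X
  app_res : ∀ {X Y : FinGSet.{u, w} G} (f : X →[G] Y) (a : S.obj Y),
    app X (S.res f a) = T.res f (app Y a)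
  app_tr : ∀ {X Y : FinGSet.{u, w} G} (f : X →[G] Y) (a : S.obj X),
    app Y (S.tr f a) = T.tr f (app X a)
  app_nm : ∀ {X Y : FinGSet.{u, w} G} (f : X →[G] Y) (a : S.obj X),
    app Y (S.nm f a) = T.nm f (app X a)

namespace SemiTambaraFunctor

variable {G : Type u} [Group G] (S : SemiTambaraFunctor.{u, v, w} G)

/-! Multiplication is the multiplicative transfer along the fold map; this gives the projection
formula. -/

theorem res_nm_inl (X Y : FinGSet.{u, w} G) (a : S.obj X) :
    S.res (inl X Y) (S.nm (inl X Y) a) = a := by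
  rw [S.mackey_nm (MulActionHom.id G) (MulActionHom.id G) (inl X Y) (inl X Y), S.nm_id, S.res_id]
  refine ⟨fun _ => rfl, fun p q h => ⟨p, ⟨rfl, Sum.inl_injective h⟩, fun r hr => hr.1⟩⟩

theorem res_nm_inr (X Y : FinGSet.{u, w} G) (a : S.obj Y) :
    S.res (inr X Y) (S.nm (inr X Y) a) = a := by
  rw [S.mackey_nm (MulActionHom.id G) (MulActionHom.id G) (inr X Y) (inr X Y), S.nm_id, S.res_id]
  refine ⟨fun _ => rfl, fun p q h => ⟨p, ⟨rfl, Sum.inr_injective h⟩, fun r hr => hr.1⟩⟩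

theorem res_inr_nm_inl (X Y : FinGSet.{u, w} G) (a : S.obj X) :
    S.res (inr X Y) (S.nm (inl X Y) a) = 1 := by
  have := S.additive_empty
  rw [S.mackey_nm (FinGSet.elim Y) (FinGSet.elim X) (inr X Y) (inl X Y),
    Subsingleton.elim (S.res (FinGSet.elim X) a) 1, map_one]
  exact ⟨fun p => PEmpty.elim p, fun p q h => absurd h Sum.inl_ne_inr⟩

theorem res_inl_nm_inr (X Y : FinGSet.{u, w} G) (a : S.obj Y) :
    S.res (inl X Y) (S.nm (inr X Y) a) = 1 := by
  have := S.additive_empty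
  rw [S.mackey_nm (FinGSet.elim X) (FinGSet.elim Y) (inl X Y) (inr X Y),
    Subsingleton.elim (S.res (FinGSet.elim Y) a) 1, map_one]
  exact ⟨fun p => PEmpty.elim p, fun p q h => absurd h Sum.inr_ne_inl⟩

theorem nm_copair (X Y Z : FinGSet.{u, w} G) (f : X →[G] Z) (g : Y →[G] Z)
    (c : S.obj (X.sum Y)) :
    S.nm (copair f g) c = S.nm f (S.res (inl X Y) c) * S.nm g (S.res (inr X Y) c) := by
  have hc : c = S.nm (inl X Y) (S.res (inl X Y) c) * S.nm (inr X Y) (S.res (inr X Y) c) := by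
    apply (S.additive_sum X Y).1
    simp only [map_mul, res_nm_inl, res_nm_inr, res_inr_nm_inl, res_inl_nm_inr, mul_one, one_mul]
  conv_lhs => rw [hc]
  rw [map_mul, ← S.nm_comp, ← S.nm_comp]
  rfl

theorem projection {X Y : FinGSet.{u, w} G} (f : X →[G] Y) (a : S.obj X) (b : S.obj Y) :
    S.tr f (a * S.res f b) = S.tr f a * b := by
  obtain ⟨c, hc⟩ := (S.additive_sum X Y).2 (a, b)
  have hc1 : S.res (inl X Y) c = a := congrArg Prod.fst hc
  have hc2 : S.res (inr X Y) c = b := congrArg Prod.snd hc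
  let idY : Y →[G] Y := MulActionHom.id G
  let idX : X →[G] X := MulActionHom.id G
  let η : Y.sum Y →[G] Y := copair idY idY
  let ξ : X.sum Y →[G] Y.sum Y := copair ((inl Y Y).comp f) (inr Y Y)
  let ζ : X.sum X →[G] X.sum Y := copair (inl X Y) ((inr X Y).comp f)
  let η' : X.sum X →[G] X := copair idX idX
  have hexp : IsExponential η ξ ζ η' f := by
    refine ⟨⟨?_, ?_⟩, ?_⟩
    · rintro (p | p) <;> rfl
    · rintro (p | p) q h
      · refine ⟨Sum.inl q, ⟨congrArg Sum.inl (show p = f q from h).symm, rfl⟩, ?_⟩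
        rintro (r | r) ⟨h1, h2⟩
        · exact congrArg Sum.inl h2
        · exact absurd h1 Sum.inr_ne_inl
      · refine ⟨Sum.inr q, ⟨congrArg Sum.inr (show p = f q from h).symm, rfl⟩, ?_⟩
        rintro (r | r) ⟨h1, h2⟩
        · exact absurd h1 Sum.inl_ne_inr
        · exact congrArg Sum.inr h2
    · let σ : ∀ p : X, {q : Y.sum Y // η q = f p} → X.sum Y := fun p q =>
        match q with
        | ⟨Sum.inl _, _⟩ => Sum.inl p
        | ⟨Sum.inr _, _⟩ => Sum.inr (f p)
      let e : X →[G] sections η ξ :=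
        { toFun := fun p => ⟨f p, σ p, by
            rintro ⟨q | q, h⟩
            · exact congrArg Sum.inl (show q = f p from h).symm
            · exact congrArg Sum.inr (show q = f p from h).symm⟩
          map_smul' := fun g p => by
            refine Sections.ext' (map_smul f g p) ?_
            rintro (q | q) h h'
            · rfl
            · exact congrArg Sum.inr (map_smul f g p) }
      refine ⟨e, ⟨fun p p' h => ?_, fun s => ?_⟩, fun _ => rfl, ?_⟩
      · have h1 : ∀ (s t : Sections η ξ) (q : Y.sum Y) (hq : η q = s.base), s = t →
            ∃ hq' : η q = t.base, s.sec ⟨q, hq⟩ = t.sec ⟨q, hq'⟩ := by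
          rintro s t q hq rfl
          exact ⟨hq, rfl⟩
        obtain ⟨hq', h2⟩ := h1 (e p) (e p') (Sum.inl (f p)) rfl h
        exact Sum.inl_injective h2
      · rcases s with ⟨y, τ, hτ⟩
        rcases h1 : τ ⟨Sum.inl y, rfl⟩ with p | p
        · have h2 := hτ ⟨Sum.inl y, rfl⟩
          rw [h1] at h2
          have h3 : f p = y := Sum.inl_injective h2
          refine ⟨p, Sections.ext' h3 ?_⟩
          rintro (q | q) h h'
          · obtain rfl : q = y := h'
            exact h1.symm
          · obtain rfl : q = y := h'
            rcases h4 : τ ⟨Sum.inr q, rfl⟩ with r | r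
            · have h5 := hτ ⟨Sum.inr q, rfl⟩
              rw [h4] at h5
              exact absurd h5 Sum.inl_ne_inr
            · have h5 := hτ ⟨Sum.inr q, rfl⟩
              rw [h4] at h5
              have h6 : r = q := Sum.inr_injective h5
              change Sum.inr (f p) = τ ⟨Sum.inr q, rfl⟩
              rw [h4, h3, h6]
        · have h2 := hτ ⟨Sum.inl y, rfl⟩
          rw [h1] at h2
          exact absurd h2 Sum.inr_ne_inl
      · rintro (p | p) h <;> rfl
  have key := S.exponential η ξ ζ η' f hexp c
  have e1 : ζ.comp (inl X X) = inl X Y := rfl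
  have e2 : ζ.comp (inr X X) = (inr X Y).comp f := rfl
  have e3 : S.nm η' (S.res ζ c) = a * S.res f b := by
    rw [S.nm_copair, ← S.res_comp, ← S.res_comp, e1, e2, S.res_comp, hc1, hc2, S.nm_id, S.nm_id]
  have e4 : S.res (inl Y Y) (S.tr ξ c) = S.tr f a := by
    rw [S.mackey_tr f (inl X Y) (inl Y Y) ξ, hc1]
    refine ⟨fun _ => rfl, ?_⟩
    rintro (p | p) q h
    · exact ⟨p, ⟨rfl, Sum.inl_injective h⟩, fun r hr => Sum.inl_injective hr.1⟩
    · exact absurd h Sum.inr_ne_inl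
  have e5 : S.res (inr Y Y) (S.tr ξ c) = b := by
    rw [S.mackey_tr idY (inr X Y) (inr Y Y) ξ, hc2, S.tr_id]
    refine ⟨fun _ => rfl, ?_⟩
    rintro (p | p) q h
    · exact absurd h Sum.inl_ne_inr
    · exact ⟨p, ⟨rfl, Sum.inr_injective h⟩, fun r hr => Sum.inr_injective hr.1⟩
  rw [e3, S.nm_copair, e4, e5, S.nm_id, S.nm_id] at key
  exact key

end SemiTambaraFunctor

namespace TambaraFunctor

variable {G : Type u} [Group G] (T : TambaraFunctor.{u, v, w} G)

/-- The additive groups of the rings `T(X)`. -/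
@[reducible]
noncomputable def addCommGroup (X : FinGSet.{u, w} G) : AddCommGroup (T.obj X) :=
  { (inferInstance : AddCommMonoid (T.obj X)) with
    neg := fun a => Classical.choose (T.exists_add_eq_zero X a)
    zsmul := @zsmulRec _ _ _ ⟨fun a => Classical.choose (T.exists_add_eq_zero X a)⟩ nsmulRec
    neg_add_cancel := fun a => by
      rw [add_comm]
      exact Classical.choose_spec (T.exists_add_eq_zero X a) }

/-- The underlying Mackey functor `(T^*, T_+)` of a Tambara functor. -/
noncomputable def toMackey : MackeyFunctor.{u, v, w} G where
  obj := T.obj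
  addCommGroup := T.addCommGroup
  res := fun f => (T.res f).toAddMonoidHom
  tr := fun f => T.tr f
  res_id := T.res_id
  res_comp := T.res_comp
  tr_id := T.tr_id
  tr_comp := T.tr_comp
  mackey := T.mackey_tr
  additive_empty := T.additive_empty
  additive_sum := T.additive_sum

/-- The additive transfers of a Tambara functor are compatible with the cross product
`(a, b) ↦ T^*(p_X)(a) * T^*(p_Y)(b)`. -/
theorem cross_tr {X Y X' Y' : FinGSet.{u, w} G} (f : X →[G] X') (g : Y →[G] Y')
    (a : T.obj X) (b : T.obj Y) :
    T.tr (prodMap f g) (T.res (fst X Y) a * T.res (snd X Y) b) =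
      T.res (fst X' Y') (T.tr f a) * T.res (snd X' Y') (T.tr g b) := by
  let f1 : X.prod Y →[G] X'.prod Y := prodMap f (MulActionHom.id G)
  let g1 : X'.prod Y →[G] X'.prod Y' := prodMap (MulActionHom.id G) g
  have h0 : prodMap f g = g1.comp f1 := rfl
  have h1 : snd X Y = (snd X' Y).comp f1 := rfl
  have h2 : fst X' Y = (fst X' Y').comp g1 := rfl
  rw [h0, T.tr_comp, h1, T.res_comp, T.projection,
    ← T.mackey_tr f1 (fst X Y) (fst X' Y) f, h2, T.res_comp, mul_comm, T.projection,
    ← T.mackey_tr g1 (snd X' Y) (snd X' Y') g, mul_comm]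
  · refine ⟨fun _ => rfl, fun p q h => ⟨(q.1, p), ⟨rfl, Prod.ext rfl h⟩, fun r hr => ?_⟩⟩
    have h3 : fst X' Y' (g1 r) = fst X' Y' q := congrArg _ hr.2
    exact Prod.ext h3 hr.1
  · refine ⟨fun _ => rfl, fun p q h => ⟨(p, q.2), ⟨rfl, Prod.ext h rfl⟩, fun r hr => ?_⟩⟩
    have h3 : snd X' Y (f1 r) = snd X' Y q := congrArg _ hr.2
    exact Prod.ext hr.1 h3

/-- The cross product `(a, b) ↦ T^*(p_X)(a) * T^*(p_Y)(b)` of a Tambara functor. -/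
def cross (X Y : FinGSet.{u, w} G) : T.obj X →+ T.obj Y →+ T.obj (X.prod Y) where
  toFun := fun a =>
    { toFun := fun b => T.res (fst X Y) a * T.res (snd X Y) b
      map_zero' := by rw [map_zero, mul_zero]
      map_add' := fun b c => by rw [map_add, mul_add] }
  map_zero' := AddMonoidHom.ext fun b => by
    change T.res (fst X Y) 0 * T.res (snd X Y) b = 0
    rw [map_zero, zero_mul]
  map_add' := fun a c => AddMonoidHom.ext fun b => by
    change T.res (fst X Y) (a + c) * T.res (snd X Y) b =
      T.res (fst X Y) a * T.res (snd X Y) b + T.res (fst X Y) c * T.res (snd X Y) b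
    rw [map_add, add_mul]

theorem cross_res {X Y X' Y' : FinGSet.{u, w} G} (f : X →[G] X') (g : Y →[G] Y')
    (a : T.obj X') (b : T.obj Y') :
    T.res (prodMap f g) (T.cross X' Y' a b) = T.cross X Y (T.res f a) (T.res g b) := by
  change T.res (prodMap f g) (T.res (fst X' Y') a * T.res (snd X' Y') b) =
    T.res (fst X Y) (T.res f a) * T.res (snd X Y) (T.res g b)
  rw [map_mul, ← T.res_comp, ← T.res_comp, ← T.res_comp, ← T.res_comp]
  rfl

theorem cross_assoc (X Y Z : FinGSet.{u, w} G) (a : T.obj X) (b : T.obj Y) (c : T.obj Z) :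
    T.cross (X.prod Y) Z (T.cross X Y a b) c =
      T.res (pair ((fst X Y).comp (fst (X.prod Y) Z))
          (pair ((snd X Y).comp (fst (X.prod Y) Z)) (snd (X.prod Y) Z)))
        (T.cross X (Y.prod Z) a (T.cross Y Z b c)) := by
  change T.res (fst (X.prod Y) Z) (T.res (fst X Y) a * T.res (snd X Y) b) *
    T.res (snd (X.prod Y) Z) c = T.res _ (T.res (fst X (Y.prod Z)) a *
      T.res (snd X (Y.prod Z)) (T.res (fst Y Z) b * T.res (snd Y Z) c))
  simp only [map_mul, ← T.res_comp]
  rw [mul_assoc]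
  rfl

theorem one_cross (X : FinGSet.{u, w} G) (a : T.obj X) :
    T.cross (FinGSet.pt G) X 1 a = T.res (snd (FinGSet.pt G) X) a := by
  change T.res (fst (FinGSet.pt G) X) 1 * T.res (snd (FinGSet.pt G) X) a = _
  rw [map_one, one_mul]

theorem cross_one (X : FinGSet.{u, w} G) (a : T.obj X) :
    T.cross X (FinGSet.pt G) a 1 = T.res (fst X (FinGSet.pt G)) a := by
  change T.res (fst X (FinGSet.pt G)) a * T.res (snd X (FinGSet.pt G)) 1 = _
  rw [map_one, mul_one]

/-- The underlying Green functor of a Tambara functor: the Mackey functor `(T^*, T_+)` with the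
cross product `(a, b) ↦ T^*(p_X)(a) * T^*(p_Y)(b)`. -/
noncomputable def toGreen : GreenFunctor.{u, v, w} G where
  toMackeyFunctor := T.toMackey
  cross := T.cross
  unit := (1 : T.obj (FinGSet.pt G))
  cross_res := T.cross_res
  cross_tr := T.cross_tr
  cross_assoc := T.cross_assoc
  unit_cross := T.one_cross
  cross_unit := T.cross_one

end TambaraFunctor

/-! ### The category of pairs `(A → X, m)` and its isomorphism classes -/

namespace AdditiveFunctor

variable {G : Type u} [Group G] (F : AdditiveFunctor.{u, v, w} G)

/-- The element of `F(A ⊔ B)` with given restrictions to `A` and `B`. -/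
noncomputable def glue {A B : FinGSet.{u, w} G} (m : F.obj A) (n : F.obj B) : F.obj (A.sum B) :=
  (Equiv.ofBijective _ (F.additive_sum A B)).symm (m, n)

theorem map_inl_glue {A B : FinGSet.{u, w} G} (m : F.obj A) (n : F.obj B) :
    F.map (inl A B) (F.glue m n) = m :=
  congrArg Prod.fst ((Equiv.ofBijective _ (F.additive_sum A B)).apply_symm_apply (m, n))

theorem map_inr_glue {A B : FinGSet.{u, w} G} (m : F.obj A) (n : F.obj B) :
    F.map (inr A B) (F.glue m n) = n :=
  congrArg Prod.snd ((Equiv.ofBijective _ (F.additive_sum A B)).apply_symm_apply (m, n))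

theorem sum_ext {A B : FinGSet.{u, w} G} {m n : F.obj (A.sum B)}
    (h1 : F.map (inl A B) m = F.map (inl A B) n)
    (h2 : F.map (inr A B) m = F.map (inr A B) n) : m = n :=
  (F.additive_sum A B).1 (Prod.ext h1 h2)

/-- The objects of the category `(G, X, F)`: pairs of a map `p : A → X` of finite `G`-sets and an
element `m` of `F(A)`. -/
structure Over (X : FinGSet.{u, w} G) where
  /-- the finite `G`-set `A` -/
  left : FinGSet.{u, w} G
  /-- the structure map -/
  hom : left →[G] X
  /-- the element of `F(A)` -/
  elt : F.obj left

variable {F}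

/-- `f` is an isomorphism in `(G, X, F)` from `(A → X, m)` to `(B → X, n)`: a map over `X` with
`F(f)(n) = m` which is bijective (its inverse map is then again a morphism). -/
def IsOverIso {X : FinGSet.{u, w} G} (a b : F.Over X) (f : a.left →[G] b.left) : Prop :=
  Function.Bijective f ∧ (∀ p, b.hom (f p) = a.hom p) ∧ F.map f b.elt = a.elt

variable (F)

/-- Isomorphism in `(G, X, F)`. -/
def overSetoid (X : FinGSet.{u, w} G) : Setoid (F.Over X) where
  r a b := ∃ f, IsOverIso a b f
  iseqv :=
    { refl := fun _ => ⟨MulActionHom.id G, Function.bijective_id, fun _ => rfl, F.map_id _ _⟩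
      symm := fun {a b} => by
        rintro ⟨f, hf, h1, h2⟩
        obtain ⟨g, hg1, hg2⟩ := exists_inverse f hf
        refine ⟨g, ⟨fun p q h => ?_, fun p => ⟨f p, hg1 p⟩⟩, fun p => ?_, ?_⟩
        · rw [← hg2 p, h, hg2]
        · rw [← h1, hg2]
        · rw [← h2, ← F.map_comp]
          have : f.comp g = MulActionHom.id G := MulActionHom.ext hg2
          rw [this, F.map_id]
      trans := fun {a b c} => by
        rintro ⟨f, hf, h1, h2⟩ ⟨g, hg, h3, h4⟩
        refine ⟨g.comp f, hg.comp hf, fun p => (h3 (f p)).trans (h1 p), ?_⟩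
        rw [F.map_comp, h4, h2] }

/-- Isomorphism classes of objects of `(G, X, F)`. -/
def IsoClass (X : FinGSet.{u, w} G) : Type (max u v (w + 1)) := Quotient (F.overSetoid X)

variable {F}

/-- The isomorphism class of `(p : A → X, m)`. -/
def cls {X A : FinGSet.{u, w} G} (p : A →[G] X) (m : F.obj A) : F.IsoClass X :=
  Quotient.mk (F.overSetoid X) ⟨A, p, m⟩

theorem cls_eq {X A B : FinGSet.{u, w} G} {p : A →[G] X} {m : F.obj A} {q : B →[G] X}
    {n : F.obj B} (f : A →[G] B) (hf : Function.Bijective f) (h1 : ∀ a, q (f a) = p a)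
    (h2 : F.map f n = m) : cls p m = cls q n :=
  Quotient.sound (s := F.overSetoid X) ⟨f, hf, h1, h2⟩

theorem ind_cls {X : FinGSet.{u, w} G} {P : F.IsoClass X → Prop}
    (h : ∀ (A : FinGSet.{u, w} G) (p : A →[G] X) (m : F.obj A), P (cls p m)) (a) : P a :=
  Quotient.inductionOn (s := F.overSetoid X) a fun ⟨A, p, m⟩ => h A p m

theorem sumMap_bijective {A A' B B' : FinGSet.{u, w} G} {f : A →[G] A'} {g : B →[G] B'}
    (hf : Function.Bijective f) (hg : Function.Bijective g) :
    Function.Bijective (copair ((inl A' B').comp f) ((inr A' B').comp g)) := by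
  refine ⟨?_, ?_⟩
  · rintro (p | p) (q | q) h
    · exact congrArg Sum.inl (hf.1 (Sum.inl_injective h))
    · exact absurd h Sum.inl_ne_inr
    · exact absurd h Sum.inr_ne_inl
    · exact congrArg Sum.inr (hg.1 (Sum.inr_injective h))
  · rintro (p | p)
    · obtain ⟨q, rfl⟩ := hf.2 p
      exact ⟨Sum.inl q, rfl⟩
    · obtain ⟨q, rfl⟩ := hg.2 p
      exact ⟨Sum.inr q, rfl⟩

/-- The sum `(A ⊔ B → X, m ⊔ n)` of isomorphism classes. -/
noncomputable def addCls {X : FinGSet.{u, w} G} (a b : F.IsoClass X) : F.IsoClass X :=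
  Quotient.map₂ (sa := F.overSetoid X) (sb := F.overSetoid X) (sc := F.overSetoid X)
    (fun a b => ⟨a.left.sum b.left, copair a.hom b.hom, F.glue a.elt b.elt⟩)
    (by
      rintro a a' ⟨f, hf, h1, h2⟩ b b' ⟨g, hg, h3, h4⟩
      refine ⟨copair ((inl _ _).comp f) ((inr _ _).comp g), sumMap_bijective hf hg, ?_, ?_⟩
      · rintro (p | p)
        · exact h1 p
        · exact h3 p
      · apply F.sum_ext
        · rw [← F.map_comp, F.map_inl_glue]
          refine (F.map_comp (inl _ _) f _).trans ?_
          rw [F.map_inl_glue, h2]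
        · rw [← F.map_comp, F.map_inr_glue]
          refine (F.map_comp (inr _ _) g _).trans ?_
          rw [F.map_inr_glue, h4]) a b

noncomputable instance (X : FinGSet.{u, w} G) : Add (F.IsoClass X) := ⟨addCls⟩

instance (X : FinGSet.{u, w} G) : Zero (F.IsoClass X) := ⟨cls (FinGSet.elim X) 1⟩

theorem cls_add_cls {X A B : FinGSet.{u, w} G} (p : A →[G] X) (m : F.obj A) (q : B →[G] X)
    (n : F.obj B) : cls p m + cls q n = cls (copair p q) (F.glue m n) := rfl

theorem cls_of_isEmpty {X A : FinGSet.{u, w} G} [IsEmpty A] (p : A →[G] X) (m : F.obj A) :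
    cls p m = 0 := by
  refine (cls_eq (FinGSet.elim A) ⟨fun a => PEmpty.elim a, fun b => isEmptyElim b⟩
    (fun a => PEmpty.elim a) ?_).symm
  have := F.additive_empty
  exact Subsingleton.elim _ _

theorem cls_eq_add {X A B C : FinGSet.{u, w} G} {p : A →[G] X} {m : F.obj A} {q : B →[G] X}
    {n : F.obj B} {r : C →[G] X} {l : F.obj C} (f : A →[G] C) (g : B →[G] C)
    (hb : Function.Bijective (copair f g)) (hf : ∀ a, r (f a) = p a) (hg : ∀ a, r (g a) = q a)
    (h1 : F.map f l = m) (h2 : F.map g l = n) : cls p m + cls q n = cls r l := by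
  refine cls_eq (copair f g) hb ?_ ?_
  · rintro (a | a)
    · exact hf a
    · exact hg a
  · apply F.sum_ext
    · rw [← F.map_comp, F.map_inl_glue]
      exact h1
    · rw [← F.map_comp, F.map_inr_glue]
      exact h2

theorem addCls_zero {X : FinGSet.{u, w} G} (a : F.IsoClass X) : a + 0 = a := by
  induction a using ind_cls with
  | h A p m =>
    refine cls_eq_add (MulActionHom.id G) (FinGSet.elim A) ⟨?_, ?_⟩ (fun _ => rfl)
      (fun a => PEmpty.elim a) (F.map_id _ _) ?_
    · rintro (a | a) (b | b) h
      · exact congrArg Sum.inl h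
      · exact PEmpty.elim b
      · exact PEmpty.elim a
      · exact PEmpty.elim a
    · exact fun a => ⟨Sum.inl a, rfl⟩
    · have := F.additive_empty
      exact Subsingleton.elim _ _

theorem addCls_comm {X : FinGSet.{u, w} G} (a b : F.IsoClass X) : a + b = b + a := by
  induction a using ind_cls with
  | h A p m =>
  induction b using ind_cls with
  | h B q n =>
    refine cls_eq_add (inr B A) (inl B A) ⟨?_, ?_⟩ (fun _ => rfl) (fun _ => rfl)
      (F.map_inr_glue _ _) (F.map_inl_glue _ _)
    · rintro (a | a) (b | b) h
      · exact congrArg Sum.inl (Sum.inr_injective h)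
      · exact absurd h Sum.inr_ne_inl
      · exact absurd h Sum.inl_ne_inr
      · exact congrArg Sum.inr (Sum.inl_injective h)
    · rintro (a | a)
      · exact ⟨Sum.inr a, rfl⟩
      · exact ⟨Sum.inl a, rfl⟩

theorem addCls_assoc {X : FinGSet.{u, w} G} (a b c : F.IsoClass X) :
    a + b + c = a + (b + c) := by
  induction a using ind_cls with
  | h A p m =>
  induction b using ind_cls with
  | h B q n =>
  induction c using ind_cls with
  | h C r l =>
    rw [cls_add_cls p m, cls_add_cls q n, cls_add_cls p m]
    refine cls_eq_add (copair (inl A (B.sum C)) ((inr A (B.sum C)).comp (inl B C)))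
      ((inr A (B.sum C)).comp (inr B C)) ⟨?_, ?_⟩ ?_ (fun _ => rfl) ?_ ?_
    · rintro ((a | a) | a) ((b | b) | b) h
      all_goals first
        | exact absurd h Sum.inl_ne_inr
        | exact absurd h Sum.inr_ne_inl
        | exact absurd (Sum.inr_injective h) Sum.inl_ne_inr
        | exact absurd (Sum.inr_injective h) Sum.inr_ne_inl
        | exact congrArg (fun z => Sum.inl (Sum.inl z)) (Sum.inl_injective h)
        | exact congrArg (fun z => Sum.inl (Sum.inr z)) (Sum.inl_injective (Sum.inr_injective h))
        | exact congrArg Sum.inr (Sum.inr_injective (Sum.inr_injective h))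
    · rintro (a | (a | a))
      · exact ⟨Sum.inl (Sum.inl a), rfl⟩
      · exact ⟨Sum.inl (Sum.inr a), rfl⟩
      · exact ⟨Sum.inr a, rfl⟩
    · rintro (a | a) <;> rfl
    · apply F.sum_ext
      · rw [← F.map_comp, F.map_inl_glue]
        exact F.map_inl_glue _ _
      · rw [← F.map_comp, F.map_inr_glue]
        refine (F.map_comp (inr _ _) (inl _ _) _).trans ?_
        rw [F.map_inr_glue, F.map_inl_glue]
    · rw [F.map_comp, F.map_inr_glue, F.map_inr_glue]

noncomputable instance (X : FinGSet.{u, w} G) : AddCommMonoid (F.IsoClass X) where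
  add_assoc := addCls_assoc
  zero_add := fun a => (addCls_comm 0 a).trans (addCls_zero a)
  add_zero := addCls_zero
  add_comm := addCls_comm
  nsmul := nsmulRec

/-! ### Operations on isomorphism classes -/

theorem pull_lift_bijective {P A X Y : FinGSet.{u, w} G} {top : P →[G] Y} {left : P →[G] A}
    {f : Y →[G] X} {p : A →[G] X} (h : IsPullback top left f p) :
    ∃ k : P →[G] pull p f, Function.Bijective k ∧ (∀ a, pullFst p f (k a) = left a) ∧
      ∀ a, pullSnd p f (k a) = top a := by
  refine ⟨{ toFun := fun a => ⟨(left a, top a), h.1 a⟩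
            map_smul' := fun g a => Subtype.ext (Prod.ext (map_smul left g a) (map_smul top g a)) },
    ⟨fun a b hab => ?_, fun q => ?_⟩, fun _ => rfl, fun _ => rfl⟩
  · obtain ⟨c, -, hc⟩ := h.2 (left b) (top b) (h.1 b)
    have h1 : left a = left b := congrArg (pullFst p f) hab
    have h2 : top a = top b := congrArg (pullSnd p f) hab
    rw [hc a ⟨h1, h2⟩, hc b ⟨rfl, rfl⟩]
  · obtain ⟨c, ⟨h1, h2⟩, -⟩ := h.2 q.1.1 q.1.2 q.2
    exact ⟨c, Subtype.ext (Prod.ext h1 h2)⟩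

/-- The restriction `f^*(A → X, m) = (A ×_X Y → Y, F(pr)(m))` of isomorphism classes. -/
def resFun {X Y : FinGSet.{u, w} G} (f : Y →[G] X) : F.IsoClass X → F.IsoClass Y :=
  Quotient.map (sa := F.overSetoid X) (sb := F.overSetoid Y)
    (fun a => ⟨pull a.hom f, pullSnd a.hom f, F.map (pullFst a.hom f) a.elt⟩)
    (by
      rintro a b ⟨e, he, h1, h2⟩
      have hP : IsPullback (pullSnd a.hom f) (e.comp (pullFst a.hom f)) f b.hom := by
        refine ⟨fun q => (h1 _).trans q.2, fun c d h => ?_⟩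
        obtain ⟨c, rfl⟩ := he.2 c
        refine ⟨⟨(c, d), (h1 c).symm.trans h⟩, ⟨rfl, rfl⟩, fun q hq => ?_⟩
        exact Subtype.ext (Prod.ext (he.1 hq.1) hq.2)
      obtain ⟨k, hk, h3, h4⟩ := pull_lift_bijective hP
      refine ⟨k, hk, h4, ?_⟩
      have h5 : (pullFst b.hom f).comp k = e.comp (pullFst a.hom f) := MulActionHom.ext h3
      rw [← F.map_comp, h5, F.map_comp, h2])

theorem resFun_cls {P A X Y : FinGSet.{u, w} G} {top : P →[G] Y} {left : P →[G] A}
    {f : Y →[G] X} {p : A →[G] X} (h : IsPullback top left f p) (m : F.obj A) :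
    resFun f (cls p m) = cls top (F.map left m) := by
  obtain ⟨k, hk, h3, h4⟩ := pull_lift_bijective h
  refine (cls_eq (n := F.map (pullFst p f) m) (q := pullSnd p f) k hk h4 ?_).symm
  have h5 : (pullFst p f).comp k = left := MulActionHom.ext h3
  rw [← F.map_comp, h5]

theorem resFun_add {X Y : FinGSet.{u, w} G} (f : Y →[G] X) (a b : F.IsoClass X) :
    resFun f (a + b) = resFun f a + resFun f b := by
  induction a using ind_cls with
  | h A p m =>
  induction b using ind_cls with
  | h B q n =>
    rw [cls_add_cls, resFun_cls (isPullback_pull _ _), resFun_cls (isPullback_pull _ _),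
      resFun_cls (isPullback_pull _ _)]
    symm
    let i : pull p f →[G] pull (copair p q) f :=
      { toFun := fun z => ⟨(Sum.inl z.1.1, z.1.2), z.2⟩, map_smul' := fun _ _ => rfl }
    let j : pull q f →[G] pull (copair p q) f :=
      { toFun := fun z => ⟨(Sum.inr z.1.1, z.1.2), z.2⟩, map_smul' := fun _ _ => rfl }
    refine cls_eq_add i j ⟨?_, ?_⟩ (fun _ => rfl) (fun _ => rfl) ?_ ?_
    · have hfst : ∀ z z' : pull (copair p q) f, z = z' → z.1.1 = z'.1.1 := fun z z' h => h ▸ rfl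
      have hsnd : ∀ z z' : pull (copair p q) f, z = z' → z.1.2 = z'.1.2 := fun z z' h => h ▸ rfl
      rintro (z | z) (z' | z') h
      · exact congrArg Sum.inl (Subtype.ext
          (Prod.ext (Sum.inl_injective (hfst _ _ h)) (hsnd _ _ h)))
      · exact absurd (hfst _ _ h) Sum.inl_ne_inr
      · exact absurd (hfst _ _ h) Sum.inr_ne_inl
      · exact congrArg Sum.inr (Subtype.ext
          (Prod.ext (Sum.inr_injective (hfst _ _ h)) (hsnd _ _ h)))
    · rintro ⟨⟨c | c, y⟩, h⟩
      · exact ⟨Sum.inl ⟨(c, y), h⟩, rfl⟩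
      · exact ⟨Sum.inr ⟨(c, y), h⟩, rfl⟩
    · have : (pullFst (copair p q) f).comp i = (inl A B).comp (pullFst p f) := rfl
      rw [← F.map_comp, this, F.map_comp, F.map_inl_glue]
    · have : (pullFst (copair p q) f).comp j = (inr A B).comp (pullFst q f) := rfl
      rw [← F.map_comp, this, F.map_comp, F.map_inr_glue]

/-- Restriction of isomorphism classes, as an additive homomorphism. -/
def resCls {X Y : FinGSet.{u, w} G} (f : Y →[G] X) : F.IsoClass X →+ F.IsoClass Y where
  toFun := resFun f
  map_zero' := by
    change resFun f (cls (FinGSet.elim X) 1) = 0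
    rw [resFun_cls (isPullback_pull _ _)]
    have : IsEmpty (pull (FinGSet.elim X) f) := ⟨fun z => PEmpty.elim z.1.1⟩
    exact cls_of_isEmpty _ _
  map_add' := resFun_add f

theorem resCls_cls {P A X Y : FinGSet.{u, w} G} {top : P →[G] Y} {left : P →[G] A}
    {f : Y →[G] X} {p : A →[G] X} (h : IsPullback top left f p) (m : F.obj A) :
    resCls f (cls p m) = cls top (F.map left m) := resFun_cls h m

/-- The transfer `f_+(A → X, m) = (A → X → Y, m)` of isomorphism classes. -/
def trFun {X Y : FinGSet.{u, w} G} (f : X →[G] Y) : F.IsoClass X → F.IsoClass Y :=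
  Quotient.map (sa := F.overSetoid X) (sb := F.overSetoid Y)
    (fun a => ⟨a.left, f.comp a.hom, a.elt⟩)
    (by
      rintro a b ⟨e, he, h1, h2⟩
      exact ⟨e, he, fun p => congrArg f (h1 p), h2⟩)

/-- Transfer of isomorphism classes, as an additive homomorphism. -/
def trCls {X Y : FinGSet.{u, w} G} (f : X →[G] Y) : F.IsoClass X →+ F.IsoClass Y where
  toFun := trFun f
  map_zero' := cls_of_isEmpty (f.comp (FinGSet.elim X)) 1
  map_add' := fun a b => by
    induction a using ind_cls with
    | h A p m =>
    induction b using ind_cls with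
    | h B q n =>
      refine cls_eq (p := f.comp (copair p q)) (q := copair (f.comp p) (f.comp q))
        (MulActionHom.id G) Function.bijective_id ?_ (F.map_id _ _)
      rintro (z | z) <;> rfl

theorem trCls_cls {A X Y : FinGSet.{u, w} G} (f : X →[G] Y) (p : A →[G] X) (m : F.obj A) :
    trCls f (cls p m) = cls (f.comp p) m := rfl

/-- The cross product `(A × B → X × Y, F(pr_A)(m) * F(pr_B)(n))` of isomorphism classes. -/
def crossFun {X Y : FinGSet.{u, w} G} :
    F.IsoClass X → F.IsoClass Y → F.IsoClass (X.prod Y) :=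
  Quotient.map₂ (sa := F.overSetoid X) (sb := F.overSetoid Y) (sc := F.overSetoid (X.prod Y))
    (fun a b => ⟨a.left.prod b.left, prodMap a.hom b.hom,
      F.map (fst a.left b.left) a.elt * F.map (snd a.left b.left) b.elt⟩)
    (by
      rintro a a' ⟨f, hf, h1, h2⟩ b b' ⟨g, hg, h3, h4⟩
      refine ⟨prodMap f g, ⟨fun p q h => ?_, fun p => ?_⟩, fun p => ?_, ?_⟩
      · have h5 : f p.1 = f q.1 := congrArg (fst a'.left b'.left) h
        have h6 : g p.2 = g q.2 := congrArg (snd a'.left b'.left) h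
        exact Prod.ext (hf.1 h5) (hg.1 h6)
      · obtain ⟨c, hc⟩ := hf.2 p.1
        obtain ⟨d, hd⟩ := hg.2 p.2
        exact ⟨(c, d), Prod.ext hc hd⟩
      · exact Prod.ext (h1 p.1) (h3 p.2)
      · have h5 : (fst a'.left b'.left).comp (prodMap f g) = f.comp (fst a.left b.left) := rfl
        have h6 : (snd a'.left b'.left).comp (prodMap f g) = g.comp (snd a.left b.left) := rfl
        rw [map_mul, ← F.map_comp, ← F.map_comp, h5, h6, F.map_comp, F.map_comp, h2, h4])

theorem crossFun_cls {A B X Y : FinGSet.{u, w} G} (p : A →[G] X) (m : F.obj A) (q : B →[G] Y)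
    (n : F.obj B) :
    crossFun (cls p m) (cls q n) = cls (prodMap p q) (F.map (fst A B) m * F.map (snd A B) n) :=
  rfl

theorem crossFun_zero_left {X Y : FinGSet.{u, w} G} (b : F.IsoClass Y) :
    crossFun (0 : F.IsoClass X) b = 0 := by
  induction b using ind_cls with
  | h B q n =>
    have : IsEmpty ((FinGSet.empty G).prod B) := ⟨fun z => PEmpty.elim z.1⟩
    exact cls_of_isEmpty _ _

theorem crossFun_zero_right {X Y : FinGSet.{u, w} G} (a : F.IsoClass X) :
    crossFun a (0 : F.IsoClass Y) = 0 := by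
  induction a using ind_cls with
  | h A p m =>
    have : IsEmpty (A.prod (FinGSet.empty G)) := ⟨fun z => PEmpty.elim z.2⟩
    exact cls_of_isEmpty _ _

theorem crossFun_add_left {X Y : FinGSet.{u, w} G} (a a' : F.IsoClass X) (b : F.IsoClass Y) :
    crossFun (a + a') b = crossFun a b + crossFun a' b := by
  induction a using ind_cls with
  | h A p m =>
  induction a' using ind_cls with
  | h A' p' m' =>
  induction b using ind_cls with
  | h B q n =>
    rw [cls_add_cls, crossFun_cls, crossFun_cls, crossFun_cls]
    symm
    let iB : B →[G] B := MulActionHom.id G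
    refine cls_eq_add (prodMap (inl A A') iB) (prodMap (inr A A') iB) ⟨?_, ?_⟩ (fun _ => rfl)
      (fun _ => rfl) ?_ ?_
    · have hfst : ∀ z z' : (A.sum A').prod B, z = z' → z.1 = z'.1 := fun z z' h => h ▸ rfl
      have hsnd : ∀ z z' : (A.sum A').prod B, z = z' → z.2 = z'.2 := fun z z' h => h ▸ rfl
      rintro (z | z) (z' | z') h
      · exact congrArg Sum.inl (Prod.ext (Sum.inl_injective (hfst _ _ h)) (hsnd _ _ h))
      · exact absurd (hfst _ _ h) Sum.inl_ne_inr
      · exact absurd (hfst _ _ h) Sum.inr_ne_inl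
      · exact congrArg Sum.inr (Prod.ext (Sum.inr_injective (hfst _ _ h)) (hsnd _ _ h))
    · rintro ⟨c | c, d⟩
      · exact ⟨Sum.inl (c, d), rfl⟩
      · exact ⟨Sum.inr (c, d), rfl⟩
    · have h1 : (fst (A.sum A') B).comp (prodMap (inl A A') iB) = (inl A A').comp (fst A B) := rfl
      have h2 : (snd (A.sum A') B).comp (prodMap (inl A A') iB) = snd A B := rfl
      rw [map_mul, ← F.map_comp, ← F.map_comp, h1, h2, F.map_comp, F.map_inl_glue]
    · have h1 : (fst (A.sum A') B).comp (prodMap (inr A A') iB) = (inr A A').comp (fst A' B) := rfl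
      have h2 : (snd (A.sum A') B).comp (prodMap (inr A A') iB) = snd A' B := rfl
      rw [map_mul, ← F.map_comp, ← F.map_comp, h1, h2, F.map_comp, F.map_inr_glue]

theorem crossFun_add_right {X Y : FinGSet.{u, w} G} (a : F.IsoClass X) (b b' : F.IsoClass Y) :
    crossFun a (b + b') = crossFun a b + crossFun a b' := by
  induction a using ind_cls with
  | h A p m =>
  induction b using ind_cls with
  | h B q n =>
  induction b' using ind_cls with
  | h B' q' n' =>
    rw [cls_add_cls, crossFun_cls, crossFun_cls, crossFun_cls]
    symm
    let iA : A →[G] A := MulActionHom.id G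
    refine cls_eq_add (prodMap iA (inl B B')) (prodMap iA (inr B B')) ⟨?_, ?_⟩ (fun _ => rfl)
      (fun _ => rfl) ?_ ?_
    · have hfst : ∀ z z' : A.prod (B.sum B'), z = z' → z.1 = z'.1 := fun z z' h => h ▸ rfl
      have hsnd : ∀ z z' : A.prod (B.sum B'), z = z' → z.2 = z'.2 := fun z z' h => h ▸ rfl
      rintro (z | z) (z' | z') h
      · exact congrArg Sum.inl (Prod.ext (hfst _ _ h) (Sum.inl_injective (hsnd _ _ h)))
      · exact absurd (hsnd _ _ h) Sum.inl_ne_inr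
      · exact absurd (hsnd _ _ h) Sum.inr_ne_inl
      · exact congrArg Sum.inr (Prod.ext (hfst _ _ h) (Sum.inr_injective (hsnd _ _ h)))
    · rintro ⟨c, d | d⟩
      · exact ⟨Sum.inl (c, d), rfl⟩
      · exact ⟨Sum.inr (c, d), rfl⟩
    · have h1 : (snd A (B.sum B')).comp (prodMap iA (inl B B')) = (inl B B').comp (snd A B) := rfl
      have h2 : (fst A (B.sum B')).comp (prodMap iA (inl B B')) = fst A B := rfl
      rw [map_mul, ← F.map_comp, ← F.map_comp, h1, h2, F.map_comp, F.map_inl_glue]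
    · have h1 : (snd A (B.sum B')).comp (prodMap iA (inr B B')) = (inr B B').comp (snd A B') := rfl
      have h2 : (fst A (B.sum B')).comp (prodMap iA (inr B B')) = fst A B' := rfl
      rw [map_mul, ← F.map_comp, ← F.map_comp, h1, h2, F.map_comp, F.map_inr_glue]

theorem resCls_id {X : FinGSet.{u, w} G} (a : F.IsoClass X) :
    resCls (MulActionHom.id G) a = a := by
  induction a using ind_cls with
  | h A p m =>
    rw [resCls_cls (top := p) (left := MulActionHom.id G)
      ⟨fun _ => rfl, fun c d h => ⟨c, ⟨rfl, h⟩, fun r hr => hr.1⟩⟩, F.map_id]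

theorem resCls_comp {X Y Z : FinGSet.{u, w} G} (g : Y →[G] Z) (f : X →[G] Y)
    (a : F.IsoClass Z) : resCls (g.comp f) a = resCls f (resCls g a) := by
  induction a using ind_cls with
  | h A p m =>
    rw [resCls_cls (isPullback_pull p g), resCls_cls (isPullback_pull _ f), ← F.map_comp]
    refine resCls_cls ⟨fun z => ?_, fun c d h => ?_⟩ m
    · have h1 : p z.1.1.1.1 = g z.1.1.1.2 := z.1.1.2
      have h2 : z.1.1.1.2 = f z.1.2 := z.2
      exact h1.trans (congrArg g h2)
    · refine ⟨⟨(⟨(c, f d), h⟩, d), rfl⟩, ⟨rfl, rfl⟩, ?_⟩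
      rintro ⟨⟨⟨⟨c', e⟩, h1⟩, d'⟩, h2⟩ ⟨h3, h4⟩
      obtain rfl : c' = c := h3
      obtain rfl : d' = d := h4
      obtain rfl : e = f d' := h2
      rfl

theorem res_trCls {X' Y' X Y : FinGSet.{u, w} G} (g' : X' →[G] Y') (f' : X' →[G] X)
    (f : Y' →[G] Y) (g : X →[G] Y) (h : IsPullback g' f' f g) (a : F.IsoClass X) :
    resCls f (trCls g a) = trCls g' (resCls f' a) := by
  induction a using ind_cls with
  | h A p m =>
    rw [resCls_cls (isPullback_pull p f'), trCls_cls, trCls_cls]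
    refine resCls_cls ⟨fun z => ?_, fun c d hcd => ?_⟩ m
    · have h1 : p z.1.1 = f' z.1.2 := z.2
      exact (congrArg g h1).trans (h.1 _)
    · obtain ⟨e, ⟨h1, h2⟩, h3⟩ := h.2 (p c) d hcd
      refine ⟨⟨(c, e), h1.symm⟩, ⟨rfl, h2⟩, ?_⟩
      rintro ⟨⟨c', e'⟩, h4⟩ ⟨h5, h6⟩
      obtain rfl : c' = c := h5
      obtain rfl : e' = e := h3 e' ⟨(show p c' = f' e' from h4).symm, h6⟩
      rfl

theorem res_crossFun {X Y X' Y' : FinGSet.{u, w} G} (f : X →[G] X') (g : Y →[G] Y')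
    (a : F.IsoClass X') (b : F.IsoClass Y') :
    resCls (prodMap f g) (crossFun a b) = crossFun (resCls f a) (resCls g b) := by
  induction a using ind_cls with
  | h A p m =>
  induction b using ind_cls with
  | h B q n =>
    rw [resCls_cls (isPullback_pull p f), resCls_cls (isPullback_pull q g), crossFun_cls,
      crossFun_cls]
    rw [resCls_cls (top := prodMap (pullSnd p f) (pullSnd q g))
      (left := prodMap (pullFst p f) (pullFst q g)), map_mul, ← F.map_comp, ← F.map_comp,
      ← F.map_comp, ← F.map_comp]
    · rfl
    · refine ⟨fun z => Prod.ext z.1.2 z.2.2, fun c d h => ?_⟩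
      have h1 : p c.1 = f d.1 := congrArg (fst X' Y') h
      have h2 : q c.2 = g d.2 := congrArg (snd X' Y') h
      refine ⟨(⟨(c.1, d.1), h1⟩, ⟨(c.2, d.2), h2⟩), ⟨rfl, rfl⟩, ?_⟩
      rintro ⟨⟨⟨c1, d1⟩, h3⟩, ⟨⟨c2, d2⟩, h4⟩⟩ ⟨rfl, rfl⟩
      rfl

theorem tr_crossFun {X Y X' Y' : FinGSet.{u, w} G} (f : X →[G] X') (g : Y →[G] Y')
    (a : F.IsoClass X) (b : F.IsoClass Y) :
    trCls (prodMap f g) (crossFun a b) = crossFun (trCls f a) (trCls g b) := by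
  induction a using ind_cls with
  | h A p m =>
  induction b using ind_cls with
  | h B q n => rfl

theorem crossFun_assoc {X Y Z : FinGSet.{u, w} G} (a : F.IsoClass X) (b : F.IsoClass Y)
    (c : F.IsoClass Z) :
    crossFun (crossFun a b) c =
      resCls (pair ((fst X Y).comp (fst (X.prod Y) Z))
          (pair ((snd X Y).comp (fst (X.prod Y) Z)) (snd (X.prod Y) Z)))
        (crossFun a (crossFun b c)) := by
  induction a using ind_cls with
  | h A p m =>
  induction b using ind_cls with
  | h B q n =>
  induction c using ind_cls with
  | h C r l =>
    rw [crossFun_cls, crossFun_cls, crossFun_cls, crossFun_cls]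
    rw [resCls_cls (top := prodMap (prodMap p q) r)
      (left := pair ((fst A B).comp (fst (A.prod B) C))
          (pair ((snd A B).comp (fst (A.prod B) C)) (snd (A.prod B) C)))]
    · simp only [map_mul, ← F.map_comp]
      rw [mul_assoc]
      rfl
    · refine ⟨fun _ => rfl, ?_⟩
      rintro ⟨c1, c2, c3⟩ ⟨⟨d1, d2⟩, d3⟩ h
      refine ⟨((c1, c2), c3), ⟨rfl, ?_⟩, ?_⟩
      · have h1 : p c1 = d1 := congrArg (fst X (Y.prod Z)) h
        have h2 : q c2 = d2 := congrArg (fun z => fst Y Z (snd X (Y.prod Z) z)) h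
        have h3 : r c3 = d3 := congrArg (fun z => snd Y Z (snd X (Y.prod Z) z)) h
        exact Prod.ext (Prod.ext h1 h2) h3
      · rintro ⟨⟨e1, e2⟩, e3⟩ ⟨h1, -⟩
        have h2 : e1 = c1 := congrArg (fst A (B.prod C)) h1
        have h3 : e2 = c2 := congrArg (fun z => fst B C (snd A (B.prod C) z)) h1
        have h4 : e3 = c3 := congrArg (fun z => snd B C (snd A (B.prod C) z)) h1
        exact Prod.ext (Prod.ext h2 h3) h4

theorem unit_crossFun {X : FinGSet.{u, w} G} (a : F.IsoClass X) :
    crossFun (cls (X := FinGSet.pt G) (MulActionHom.id G) 1) a =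
      resCls (snd (FinGSet.pt G) X) a := by
  induction a using ind_cls with
  | h A p m =>
    rw [crossFun_cls, map_one, one_mul, resCls_cls]
    refine ⟨fun _ => rfl, fun c d h => ⟨(d.1, c), ⟨rfl, Prod.ext rfl h⟩, ?_⟩⟩
    rintro ⟨e1, e2⟩ ⟨h1, -⟩
    exact Prod.ext rfl h1

theorem crossFun_unit {X : FinGSet.{u, w} G} (a : F.IsoClass X) :
    crossFun a (cls (X := FinGSet.pt G) (MulActionHom.id G) 1) =
      resCls (fst X (FinGSet.pt G)) a := by
  induction a using ind_cls with
  | h A p m =>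
    rw [crossFun_cls, map_one, mul_one, resCls_cls]
    refine ⟨fun _ => rfl, fun c d h => ⟨(c, d.2), ⟨rfl, Prod.ext h rfl⟩, ?_⟩⟩
    rintro ⟨e1, e2⟩ ⟨h1, -⟩
    exact Prod.ext h1 rfl

theorem res_inl_tr_inl {X Y : FinGSet.{u, w} G} (a : F.IsoClass X) :
    resCls (inl X Y) (trCls (inl X Y) a) = a := by
  rw [res_trCls (MulActionHom.id G) (MulActionHom.id G) (inl X Y) (inl X Y), resCls_id]
  · induction a using ind_cls with
    | h A p m => rfl
  · exact ⟨fun _ => rfl, fun p q h => ⟨p, ⟨rfl, Sum.inl_injective h⟩, fun r hr => hr.1⟩⟩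

theorem res_inr_tr_inr {X Y : FinGSet.{u, w} G} (a : F.IsoClass Y) :
    resCls (inr X Y) (trCls (inr X Y) a) = a := by
  rw [res_trCls (MulActionHom.id G) (MulActionHom.id G) (inr X Y) (inr X Y), resCls_id]
  · induction a using ind_cls with
    | h A p m => rfl
  · exact ⟨fun _ => rfl, fun p q h => ⟨p, ⟨rfl, Sum.inr_injective h⟩, fun r hr => hr.1⟩⟩

theorem eq_zero_of_isEmpty {X : FinGSet.{u, w} G} [IsEmpty X] (a : F.IsoClass X) : a = 0 := by
  induction a using ind_cls with
  | h A p m =>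
    have : IsEmpty A := ⟨fun z => isEmptyElim (p z)⟩
    exact cls_of_isEmpty _ _

theorem res_inr_tr_inl {X Y : FinGSet.{u, w} G} (a : F.IsoClass X) :
    resCls (inr X Y) (trCls (inl X Y) a) = 0 := by
  rw [res_trCls (FinGSet.elim Y) (FinGSet.elim X) (inr X Y) (inl X Y),
    eq_zero_of_isEmpty (resCls (FinGSet.elim X) a), map_zero]
  exact ⟨fun p => PEmpty.elim p, fun p q h => absurd h Sum.inl_ne_inr⟩

theorem res_inl_tr_inr {X Y : FinGSet.{u, w} G} (a : F.IsoClass Y) :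
    resCls (inl X Y) (trCls (inr X Y) a) = 0 := by
  rw [res_trCls (FinGSet.elim X) (FinGSet.elim Y) (inl X Y) (inr X Y),
    eq_zero_of_isEmpty (resCls (FinGSet.elim Y) a), map_zero]
  exact ⟨fun p => PEmpty.elim p, fun p q h => absurd h Sum.inr_ne_inl⟩

theorem tr_res_sum {X Y : FinGSet.{u, w} G} (a : F.IsoClass (X.sum Y)) :
    trCls (inl X Y) (resCls (inl X Y) a) + trCls (inr X Y) (resCls (inr X Y) a) = a := by
  induction a using ind_cls with
  | h A p m =>
    rw [resCls_cls (isPullback_pull _ _), resCls_cls (isPullback_pull _ _), trCls_cls, trCls_cls]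
    refine cls_eq_add (pullFst p (inl X Y)) (pullFst p (inr X Y)) ⟨?_, ?_⟩ (fun z => z.2)
      (fun z => z.2) rfl rfl
    · have hl : ∀ z : pull p (inl X Y), p z.1.1 = Sum.inl z.1.2 := fun z => z.2
      have hr : ∀ z : pull p (inr X Y), p z.1.1 = Sum.inr z.1.2 := fun z => z.2
      rintro (z | z) (z' | z') h
      · have h' : z.1.1 = z'.1.1 := h
        refine congrArg Sum.inl (Subtype.ext (Prod.ext h'
          (Sum.inl_injective (β := Y) ?_)))
        rw [← hl, ← hl, h']
      · have h' : z.1.1 = z'.1.1 := h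
        have h1 := hr z'
        rw [← h', hl z] at h1
        exact absurd h1 Sum.inl_ne_inr
      · have h' : z.1.1 = z'.1.1 := h
        have h1 := hl z'
        rw [← h', hr z] at h1
        exact absurd h1 Sum.inr_ne_inl
      · have h' : z.1.1 = z'.1.1 := h
        refine congrArg Sum.inr (Subtype.ext (Prod.ext h'
          (Sum.inr_injective (α := X) ?_)))
        rw [← hr, ← hr, h']
    · intro c
      rcases hc : p c with d | d
      · exact ⟨Sum.inl ⟨(c, d), hc⟩, rfl⟩
      · exact ⟨Sum.inr ⟨(c, d), hc⟩, rfl⟩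

/-! ### The F-Burnside Green functor -/

variable (F)

/-- `A_F(X)`: the Grothendieck group of the isomorphism classes of `(G, X, F)`. -/
abbrev Burnside (X : FinGSet.{u, w} G) : Type (max u v (w + 1)) :=
  Algebra.GrothendieckAddGroup (F.IsoClass X)

variable {F}

/-- The class in `A_F(X)` of an isomorphism class. -/
noncomputable abbrev toBurnside {X : FinGSet.{u, w} G} : F.IsoClass X →+ F.Burnside X :=
  Algebra.GrothendieckAddGroup.of

theorem lift_toBurnside {X : FinGSet.{u, w} G} {K : Type*} [AddCommGroup K]
    (φ : F.IsoClass X →+ K) (a : F.IsoClass X) :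
    Algebra.GrothendieckAddGroup.lift φ (toBurnside a) = φ a :=
  DFunLike.congr_fun (Algebra.GrothendieckAddGroup.lift.symm_apply_apply φ) a

theorem burnside_ind {X : FinGSet.{u, w} G} {P : F.Burnside X → Prop}
    (hof : ∀ a, P (toBurnside a)) (hsub : ∀ a b, P a → P b → P (a - b)) (a : F.Burnside X) :
    P a := by
  induction a using AddLocalization.ind with
  | H y =>
    obtain ⟨c, d⟩ := y
    have h : (AddLocalization.mk c d : F.Burnside X) = toBurnside c - toBurnside d.1 := by
      rw [eq_sub_iff_add_eq, AddLocalization.mk_eq_addMonoidOf_mk']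
      exact AddSubmonoid.LocalizationMap.mk'_spec _ c d
    rw [h]
    exact hsub _ _ (hof c) (hof d.1)

/-- Restriction on `A_F`. -/
noncomputable def burnsideRes {X Y : FinGSet.{u, w} G} (f : Y →[G] X) :
    F.Burnside X →+ F.Burnside Y :=
  Algebra.GrothendieckAddGroup.lift (toBurnside.comp (resCls f))

/-- Transfer on `A_F`. -/
noncomputable def burnsideTr {X Y : FinGSet.{u, w} G} (f : X →[G] Y) :
    F.Burnside X →+ F.Burnside Y :=
  Algebra.GrothendieckAddGroup.lift (toBurnside.comp (trCls f))

/-- The cross product on `A_F`: the bilinear extension of the cross product of classes. -/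
noncomputable def burnsideCross (X Y : FinGSet.{u, w} G) :
    F.Burnside X →+ F.Burnside Y →+ F.Burnside (X.prod Y) :=
  Algebra.GrothendieckAddGroup.lift
    { toFun := fun a => Algebra.GrothendieckAddGroup.lift
        { toFun := fun b => toBurnside (crossFun a b)
          map_zero' := by rw [crossFun_zero_right, map_zero]
          map_add' := fun b c => by rw [crossFun_add_right, map_add] }
      map_zero' := AddMonoidHom.ext <| burnside_ind
        (fun b => by
          rw [lift_toBurnside]
          change toBurnside (crossFun 0 b) = 0
          rw [crossFun_zero_left, map_zero])
        (fun b c hb hc => by rw [map_sub, hb, hc, map_sub])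
      map_add' := fun a a' => AddMonoidHom.ext <| burnside_ind
        (fun b => by
          rw [AddMonoidHom.add_apply, lift_toBurnside, lift_toBurnside, lift_toBurnside]
          change toBurnside (crossFun (a + a') b) =
            toBurnside (crossFun a b) + toBurnside (crossFun a' b)
          rw [crossFun_add_left, map_add])
        (fun b c hb hc => by rw [map_sub, hb, hc, map_sub]) }

theorem burnsideRes_of {X Y : FinGSet.{u, w} G} (f : Y →[G] X) (a : F.IsoClass X) :
    burnsideRes f (toBurnside a) = toBurnside (resCls f a) := lift_toBurnside _ a

theorem burnsideTr_of {X Y : FinGSet.{u, w} G} (f : X →[G] Y) (a : F.IsoClass X) :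
    burnsideTr f (toBurnside a) = toBurnside (trCls f a) := lift_toBurnside _ a

theorem burnsideCross_of {X Y : FinGSet.{u, w} G} (a : F.IsoClass X) (b : F.IsoClass Y) :
    burnsideCross X Y (toBurnside a) (toBurnside b) = toBurnside (crossFun a b) := by
  unfold burnsideCross
  rw [lift_toBurnside]
  exact lift_toBurnside _ b

variable (F)

/-- The `F`-Burnside Mackey functor. -/
noncomputable def burnsideMackey : MackeyFunctor.{u, max u v (w + 1), w} G where
  obj := F.Burnside
  res := burnsideRes
  tr := burnsideTr
  res_id := fun X => burnside_ind (fun a => by rw [burnsideRes_of, resCls_id])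
    (fun a b ha hb => by rw [map_sub, ha, hb])
  res_comp := fun g f => burnside_ind
    (fun a => by rw [burnsideRes_of, burnsideRes_of, burnsideRes_of, resCls_comp])
    (fun a b ha hb => by rw [map_sub, map_sub, map_sub, ha, hb])
  tr_id := fun X => burnside_ind
    (fun a => by
      rw [burnsideTr_of]
      induction a using ind_cls with
      | h A p m => rfl)
    (fun a b ha hb => by rw [map_sub, ha, hb])
  tr_comp := fun g f => burnside_ind
    (fun a => by
      rw [burnsideTr_of, burnsideTr_of, burnsideTr_of]
      induction a using ind_cls with
      | h A p m => rfl)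
    (fun a b ha hb => by rw [map_sub, map_sub, map_sub, ha, hb])
  mackey := fun g' f' f g h => burnside_ind
    (fun a => by
      rw [burnsideTr_of, burnsideRes_of, burnsideRes_of, burnsideTr_of, res_trCls g' f' f g h])
    (fun a b ha hb => by rw [map_sub, map_sub, map_sub, map_sub, ha, hb])
  additive_empty := by
    have h : ∀ a : F.Burnside (FinGSet.empty G), a = 0 := burnside_ind
      (fun a => by rw [eq_zero_of_isEmpty a, map_zero]) (fun a b ha hb => by rw [ha, hb, sub_zero])
    exact ⟨fun a b => (h a).trans (h b).symm⟩
  additive_sum := fun X Y => by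
    have h1 : ∀ a : F.Burnside X, burnsideRes (inl X Y) (burnsideTr (inl X Y) a) = a :=
      burnside_ind (fun a => by rw [burnsideTr_of, burnsideRes_of, res_inl_tr_inl])
        (fun a b ha hb => by rw [map_sub, map_sub, ha, hb])
    have h2 : ∀ a : F.Burnside Y, burnsideRes (inr X Y) (burnsideTr (inr X Y) a) = a :=
      burnside_ind (fun a => by rw [burnsideTr_of, burnsideRes_of, res_inr_tr_inr])
        (fun a b ha hb => by rw [map_sub, map_sub, ha, hb])
    have h3 : ∀ a : F.Burnside X, burnsideRes (inr X Y) (burnsideTr (inl X Y) a) = 0 :=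
      burnside_ind (fun a => by rw [burnsideTr_of, burnsideRes_of, res_inr_tr_inl, map_zero])
        (fun a b ha hb => by rw [map_sub, map_sub, ha, hb, sub_zero])
    have h4 : ∀ a : F.Burnside Y, burnsideRes (inl X Y) (burnsideTr (inr X Y) a) = 0 :=
      burnside_ind (fun a => by rw [burnsideTr_of, burnsideRes_of, res_inl_tr_inr, map_zero])
        (fun a b ha hb => by rw [map_sub, map_sub, ha, hb, sub_zero])
    have h5 : ∀ a : F.Burnside (X.sum Y),
        burnsideTr (inl X Y) (burnsideRes (inl X Y) a) +
          burnsideTr (inr X Y) (burnsideRes (inr X Y) a) = a :=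
      burnside_ind
        (fun a => by
          rw [burnsideRes_of, burnsideRes_of, burnsideTr_of, burnsideTr_of, ← map_add, tr_res_sum])
        (fun a b ha hb => by
          rw [map_sub, map_sub, map_sub, map_sub, sub_add_sub_comm, ha, hb])
    refine ⟨fun a b hab => ?_, fun c => ?_⟩
    · have h6 : burnsideRes (inl X Y) a = burnsideRes (inl X Y) b := congrArg Prod.fst hab
      have h7 : burnsideRes (inr X Y) a = burnsideRes (inr X Y) b := congrArg Prod.snd hab
      rw [← h5 a, h6, h7, h5]
    · refine ⟨burnsideTr (inl X Y) c.1 + burnsideTr (inr X Y) c.2, Prod.ext ?_ ?_⟩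
      · change burnsideRes (inl X Y) _ = _
        rw [map_add, h1, h4, add_zero]
      · change burnsideRes (inr X Y) _ = _
        rw [map_add, h3, h2, zero_add]

/-- The `F`-Burnside Green functor `A_F`. -/
noncomputable def burnsideGreen : GreenFunctor.{u, max u v (w + 1), w} G where
  toMackeyFunctor := F.burnsideMackey
  cross := burnsideCross
  unit := toBurnside (cls (X := FinGSet.pt G) (MulActionHom.id G) 1)
  cross_res := fun {X Y X' Y'} f g => by
    change ∀ (a : F.Burnside X') (b : F.Burnside Y'),
      burnsideRes (prodMap f g) (burnsideCross X' Y' a b) =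
        burnsideCross X Y (burnsideRes f a) (burnsideRes g b)
    refine burnside_ind (fun a => burnside_ind (fun b => ?_) fun b b' h h' => ?_)
      fun a a' h h' b => ?_
    · rw [burnsideCross_of, burnsideRes_of, burnsideRes_of, burnsideRes_of, burnsideCross_of,
        res_crossFun]
    · simp only [map_sub, h, h']
    · simp only [map_sub, AddMonoidHom.sub_apply, h, h']
  cross_tr := fun {X Y X' Y'} f g => by
    change ∀ (a : F.Burnside X) (b : F.Burnside Y),
      burnsideTr (prodMap f g) (burnsideCross X Y a b) =
        burnsideCross X' Y' (burnsideTr f a) (burnsideTr g b)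
    refine burnside_ind (fun a => burnside_ind (fun b => ?_) fun b b' h h' => ?_)
      fun a a' h h' b => ?_
    · rw [burnsideCross_of, burnsideTr_of, burnsideTr_of, burnsideTr_of, burnsideCross_of,
        tr_crossFun]
    · simp only [map_sub, h, h']
    · simp only [map_sub, AddMonoidHom.sub_apply, h, h']
  cross_assoc := fun X Y Z => by
    change ∀ (a : F.Burnside X) (b : F.Burnside Y) (c : F.Burnside Z),
      burnsideCross (X.prod Y) Z (burnsideCross X Y a b) c =
        burnsideRes (pair ((fst X Y).comp (fst (X.prod Y) Z))
          (pair ((snd X Y).comp (fst (X.prod Y) Z)) (snd (X.prod Y) Z)))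
        (burnsideCross X (Y.prod Z) a (burnsideCross Y Z b c))
    refine burnside_ind (fun a => burnside_ind (fun b => burnside_ind (fun c => ?_)
      fun c c' h h' => ?_) fun b b' h h' c => ?_) fun a a' h h' b c => ?_
    · rw [burnsideCross_of, burnsideCross_of, burnsideCross_of, burnsideCross_of, burnsideRes_of,
        crossFun_assoc]
    · simp only [map_sub, h, h']
    · simp only [map_sub, AddMonoidHom.sub_apply, h, h']
    · simp only [map_sub, AddMonoidHom.sub_apply, h, h']
  unit_cross := fun X => by
    change ∀ a : F.Burnside X, burnsideCross (FinGSet.pt G) X (toBurnside _) a =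
      burnsideRes (snd (FinGSet.pt G) X) a
    refine burnside_ind (fun a => ?_) fun a a' h h' => ?_
    · rw [burnsideCross_of, burnsideRes_of, unit_crossFun]
    · rw [map_sub, map_sub, h, h']
  cross_unit := fun X => by
    change ∀ a : F.Burnside X, burnsideCross X (FinGSet.pt G) a (toBurnside _) =
      burnsideRes (fst X (FinGSet.pt G)) a
    refine burnside_ind (fun a => ?_) fun a a' h h' => ?_
    · rw [burnsideCross_of, burnsideRes_of, crossFun_unit]
    · rw [map_sub, map_sub, AddMonoidHom.sub_apply, h, h']

end AdditiveFunctor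

/-! ### The Tambara functor associated with a semi-Mackey functor -/

open AdditiveFunctor

/-- `S` is the semi-Tambara functor `S_M`: the semiring `S(X)` is the set of isomorphism classes
of pairs `(A → X, m)` with sum given by direct sums and product given by fibre products over `X`;
restrictions are given by pull-back, additive transfers by composition, and multiplicative
transfers by `η_•(A → X, m) = (Y' → Y, M_*(ρ) M^*(λ) m)` for any exponential diagram
`X ← A ← X' → Y' → Y` with arrows `p, λ, ρ, υ`. -/
def IsSemiTambarization {G : Type u} [Group G] (M : SemiMackeyFunctor.{u, v, w} G)
    (S : SemiTambaraFunctor.{u, max u v (w + 1), w} G) : Prop :=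
  ∃ e : ∀ X : FinGSet.{u, w} G, M.toAdditiveFunctor.IsoClass X ≃ S.obj X,
    (∀ X a b, e X (a + b) = e X a + e X b) ∧
    (∀ (X A B : FinGSet.{u, w} G) (p : A →[G] X) (m : M.obj A) (q : B →[G] X) (n : M.obj B),
      e X (cls p m) * e X (cls q n) =
        e X (cls (p.comp (pullFst p q)) (M.map (pullFst p q) m * M.map (pullSnd p q) n))) ∧
    (∀ (X Y A : FinGSet.{u, w} G) (f : Y →[G] X) (p : A →[G] X) (m : M.obj A),
      S.res f (e X (cls p m)) = e Y (cls (pullSnd p f) (M.map (pullFst p f) m))) ∧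
    (∀ (X Y A : FinGSet.{u, w} G) (f : X →[G] Y) (p : A →[G] X) (m : M.obj A),
      S.tr f (e X (cls p m)) = e Y (cls (f.comp p) m)) ∧
    ∀ (X Y A X' Y' : FinGSet.{u, w} G) (η : X →[G] Y) (p : A →[G] X) (lam : X' →[G] A)
      (ρ : X' →[G] Y') (υ : Y' →[G] Y), IsExponential η p lam ρ υ → ∀ m : M.obj A,
      S.nm η (e X (cls p m)) = e Y (cls υ (M.tr ρ (M.map lam m)))

/-- The ring `R` together with `ι : S → R` is the ring completion (Grothendieck ring) `K_0(S)` of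
the semiring `S`. -/
def IsRingCompletion {S R : Type*} [CommSemiring S] [CommSemiring R] (ι : S →+* R) : Prop :=
  (∀ r : R, ∃ s, r + s = 0) ∧ (∀ r : R, ∃ a b, r + ι b = ι a) ∧
    ∀ a b, ι a = ι b ↔ ∃ c, a + c = b + c

/-- `T` is the Tambara functor `T_M`: the ring completion of `S_M`. -/
def IsTambarization {G : Type u} [Group G] (M : SemiMackeyFunctor.{u, v, w} G)
    (T : TambaraFunctor.{u, max u v (w + 1), w} G) : Prop :=
  ∃ S : SemiTambaraFunctor.{u, max u v (w + 1), w} G, IsSemiTambarization M S ∧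
    ∃ ι : SemiTambaraHom S T.toSemiTambaraFunctor, ∀ X, IsRingCompletion (ι.app X)

end MackeyTambara

open MackeyTambara

namespace MackeyTambara

/-! The isomorphism classes of pairs (A → X, m) already form a semiring with restrictions and
additive transfers; the cross product restricted to the diagonal is the multiplication. The
covariant part of M supplies the missing multiplicative transfers, by exponential diagrams. Each law
for them combines a fact about exponential diagrams of finite G-sets (uniqueness, composition in
either variable, base change, fibre products) with functoriality, multiplicativity or the Mackey
formula of M. The facts about diagrams are proved on points: `of_points`, `exists_point` and
`point_ext` identify the points of Y' over y with the sections over the fibre of y. This gives the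
semi-Tambara functor `semiTambarization`.

The second half is ring completion. Restrictions and additive transfers extend because they are
additive; multiplicative transfers are not. They are polynomial, however: decomposing the
exponential diagram of η and the fold map of X (`exists_fold_exponential`) gives N_η(a + b) = N_η(a)
+ tr(N_s(res a) · N_s'(res b)) with s having strictly smaller fibres than η (`exists_nm_add`), so
N_η has degree at most the maximal cardinality of a fibre (`hasDegreeLT_nm`). A polynomial map from
a commutative monoid to an abelian group extends to the group completion (`exists_extension`), and
polynomial maps on the completion are determined by their values on the monoid (`ext_of_degreeLT`).
Thus norms extend, and the Tambara identities, whose two sides are polynomial, are inherited from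
the semi-Tambara functor. For functoriality of norms one also needs that a norm composed with a
polynomial map is polynomial (`exists_hasDegreeLT_completionNorm`).

The comparison with the F-Burnside functor only involves the additive structure and the cross
product: every ring completion of S_M(X) is a group completion of the monoid of isomorphism classes,
hence is the Grothendieck group, and the cross product is p_X^* a · p_Y^* b (`crossFun_eq_mul`). -/

/-! ### Polynomial maps -/

/-- A map from a commutative monoid to an abelian group is polynomial of degree less than `n` if
its iterated differences of order `n` vanish. -/
def HasDegreeLT {A B : Type*} [AddCommMonoid A] [AddCommGroup B] : ℕ → (A → B) → Prop
  | 0, φ => ∀ a, φ a = 0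
  | n + 1, φ => ∀ c, HasDegreeLT n fun a => φ (a + c) - φ a

namespace HasDegreeLT

variable {A A' B B' : Type*} [AddCommMonoid A] [AddCommMonoid A'] [AddCommGroup B]
  [AddCommGroup B'] {n : ℕ}

theorem congr {φ ψ : A → B} (h : HasDegreeLT n φ) (e : ∀ a, φ a = ψ a) : HasDegreeLT n ψ := by
  obtain rfl : φ = ψ := funext e
  exact h

theorem succ {φ : A → B} (h : HasDegreeLT n φ) : HasDegreeLT (n + 1) φ := by
  induction n generalizing φ with
  | zero => exact fun c a => sub_eq_zero.2 ((h _).trans (h _).symm)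
  | succ n ih => exact fun c => ih (h c)

theorem mono {m : ℕ} (hmn : n ≤ m) {φ : A → B} (h : HasDegreeLT n φ) : HasDegreeLT m φ := by
  induction hmn with
  | refl => exact h
  | step _ ih => exact ih.succ

theorem add {φ ψ : A → B} (hφ : HasDegreeLT n φ) (hψ : HasDegreeLT n ψ) :
    HasDegreeLT n fun a => φ a + ψ a := by
  induction n generalizing φ ψ with
  | zero => exact fun a => (congrArg₂ (· + ·) (hφ a) (hψ a)).trans (add_zero 0)
  | succ n ih => exact fun c => (ih (hφ c) (hψ c)).congr fun a => by dsimp only; abel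

theorem comp_hom {φ : A → B} (h : HasDegreeLT n φ) (f : A' →+ A) :
    HasDegreeLT n fun a => φ (f a) := by
  induction n generalizing φ with
  | zero => exact fun a => h _
  | succ n ih => exact fun c => (ih (h (f c))).congr fun a => by dsimp only; rw [map_add]

theorem hom_comp {φ : A → B} (h : HasDegreeLT n φ) (f : B →+ B') :
    HasDegreeLT n fun a => f (φ a) := by
  induction n generalizing φ with
  | zero => exact fun a => (congrArg f (h a)).trans (map_zero f)
  | succ n ih => exact fun c => (ih (h c)).congr fun a => by rw [map_sub]

theorem sub {φ ψ : A → B} (hφ : HasDegreeLT n φ) (hψ : HasDegreeLT n ψ) :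
    HasDegreeLT n fun a => φ a - ψ a :=
  (hφ.add (hψ.hom_comp (-AddMonoidHom.id B))).congr fun _ => (sub_eq_add_neg _ _).symm

theorem shift {φ : A → B} (h : HasDegreeLT n φ) (d : A) : HasDegreeLT n fun a => φ (a + d) := by
  induction n generalizing φ with
  | zero => exact fun a => h _
  | succ n ih => exact fun c => (ih (h c)).congr fun a => by rw [add_right_comm]

theorem const (b : B) : HasDegreeLT 1 fun _ : A => b := fun _ _ => sub_self b

/-- Leibniz rule: Δ_c(φψ) = Δ_cφ · ψ + φ(· + c) · Δ_cψ, by induction on p + q. The bound is not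
sharp when p and q are positive, but only finiteness of the degree matters later. -/
theorem mul {R : Type*} [CommRing R] {p q : ℕ} {φ ψ : A → R} (hφ : HasDegreeLT p φ)
    (hψ : HasDegreeLT q ψ) : HasDegreeLT (p + q) fun a => φ a * ψ a := by
  induction h : p + q generalizing p q φ ψ with
  | zero =>
    obtain rfl : p = 0 := by omega
    exact fun a => (congrArg (· * ψ a) (hφ a)).trans (zero_mul _)
  | succ n ih =>
    rcases p with _ | p
    · exact mono (Nat.zero_le _) fun a => (congrArg (· * ψ a) (hφ a)).trans (zero_mul _)
    rcases q with _ | q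
    · exact mono (Nat.zero_le _) fun a => (congrArg (φ a * ·) (hψ a)).trans (mul_zero _)
    intro c
    have h1 := ih (hφ c) hψ (by omega)
    have h2 := ih (hφ.shift c) (hψ c) (by omega)
    exact (h1.add h2).congr fun a => by ring

end HasDegreeLT

/-- `ι : A → K` is the group completion of `A`. -/
structure IsGroupCompletion {A K : Type*} [AddCommMonoid A] [AddCommGroup K] (ι : A →+ K) :
    Prop where
  exists_add_eq : ∀ k, ∃ a b, k + ι b = ι a
  eq_iff : ∀ a b, ι a = ι b ↔ ∃ c, a + c = b + c

namespace IsGroupCompletion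

variable {A K B : Type*} [AddCommMonoid A] [AddCommGroup K] [AddCommGroup B] {ι : A →+ K}

/-- If k + ι b = ι a, the difference of φ in direction ι b has smaller degree and vanishes on the
image of ι, so it vanishes at k; hence φ k = φ (ι a) = 0. -/
theorem eq_zero (hι : IsGroupCompletion ι) {n : ℕ} {φ : K → B} (h : HasDegreeLT n φ)
    (h0 : ∀ a, φ (ι a) = 0) (k : K) : φ k = 0 := by
  induction n generalizing φ k with
  | zero => exact h k
  | succ n ih =>
    obtain ⟨a, b, hab⟩ := hι.exists_add_eq k
    have h1 := ih (h (ι b)) (fun a => by rw [← map_add, h0, h0, sub_zero]) k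
    rw [hab, h0, zero_sub, neg_eq_zero] at h1
    exact h1

theorem ext_of_degreeLT (hι : IsGroupCompletion ι) {n m : ℕ} {φ ψ : K → B}
    (hφ : HasDegreeLT n φ) (hψ : HasDegreeLT m ψ) (h : ∀ a, φ (ι a) = ψ (ι a)) (k : K) :
    φ k = ψ k :=
  sub_eq_zero.1 <| hι.eq_zero ((hφ.mono (le_max_left n m)).sub (hψ.mono (le_max_right n m)))
    (fun a => sub_eq_zero.2 (h a)) k

/-- Polynomial maps extend to the group completion. -/
theorem exists_extension (hι : IsGroupCompletion ι) {n : ℕ} {φ : A → B} (h : HasDegreeLT n φ) :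
    ∃ ψ : K → B, HasDegreeLT n ψ ∧ ∀ a, ψ (ι a) = φ a := by
  induction n generalizing φ with
  | zero => exact ⟨fun _ => 0, fun _ => rfl, fun a => (h a).symm⟩
  | succ n ih =>
    -- `ψ d` extends the difference of φ in direction d, which has smaller degree. The extension Ψ
    -- sought must satisfy Ψ(k + ι b) − Ψ(k) = ψ b k, which forces Ψ(k) = φ a − ψ b k whenever k + ι
    -- b = ι a.
    choose ψ hψ hψι using fun d => ih (h d)
    -- The relation Δ_{b+c} = Δ_b + Δ_c(· + b) holds for φ, and it passes to the extensions by
    -- uniqueness.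
    have cocycle : ∀ b c k, ψ (b + c) k = ψ b k + ψ c (k + ι b) := fun b c =>
      hι.ext_of_degreeLT (hψ _) ((hψ b).add ((hψ c).shift (ι b))) fun a => by
        rw [← map_add, hψι, hψι, hψι, add_assoc]
        abel
    have stable : ∀ k a b c, k + ι b = ι a → φ (a + c) - ψ (b + c) k = φ a - ψ b k := by
      intro k a b c hk
      rw [cocycle, hk, hψι]
      abel
    -- Two presentations of k become equal after adding elements of A to numerator and denominator,
    -- and `stable` says that this does not change the value.
    have indep : ∀ k a b a' b', k + ι b = ι a → k + ι b' = ι a' →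
        φ a - ψ b k = φ a' - ψ b' k := by
      intro k a b a' b' hk hk'
      obtain ⟨c, hc⟩ := (hι.eq_iff (a + b') (a' + b)).1 (by
        rw [map_add, map_add, ← hk, ← hk']; abel)
      rw [← stable k a b (b' + c) hk, ← stable k a' b' (b + c) hk', ← add_assoc, hc, add_assoc,
        add_left_comm b]
    choose p q hpq using hι.exists_add_eq
    have eval : ∀ k a b, k + ι b = ι a → φ (p k) - ψ (q k) k = φ a - ψ b k :=
      fun k a b hk => indep _ _ _ _ _ (hpq k) hk
    have diff : ∀ d k, (φ (p (k + ι d)) - ψ (q (k + ι d)) (k + ι d)) -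
        (φ (p k) - ψ (q k) k) = ψ d k := by
      intro d k
      have h1 := eval (k + ι d) (p k + d) (q k) (by rw [map_add, ← hpq]; abel)
      -- The cocycle relation is expanded in both orders of `q k` and `d`, and the results are
      -- compared.
      have h2 := cocycle (q k) d k
      rw [add_comm (q k), cocycle, hpq, hψι] at h2
      have h3 : ψ (q k) (k + ι d) = ψ (q k) k + (φ (p k + d) - φ (p k)) - ψ d k :=
        eq_sub_of_add_eq' h2
      rw [h1, h3]
      abel
    refine ⟨fun k => φ (p k) - ψ (q k) k, fun c => ?_, fun a => ?_⟩
    -- For a general direction c = ι d − ι e, the difference of Ψ at k is the one in direction ι d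
    -- minus the one in direction ι e, both based at k − ι e.
    · obtain ⟨d, e, hde⟩ := hι.exists_add_eq c
      refine (((hψ d).sub (hψ e)).shift (-ι e)).congr fun k => ?_
      have h1 := diff d (k + -ι e)
      have h2 := diff e (k + -ι e)
      have h3 : k + -ι e + ι d = k + c := by rw [← hde]; abel
      have h4 : k + -ι e + ι e = k := by abel
      rw [h3] at h1
      rw [h4] at h2
      dsimp only
      rw [← h1, ← h2]
      abel
    · have h0 : ψ 0 (ι a) = 0 := by rw [hψι, add_zero, sub_self]
      exact (eval (ι a) a 0 (by rw [map_zero, add_zero])).trans (by rw [h0, sub_zero])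

end IsGroupCompletion

/-! ### The ring completion of a semiring -/

section RingCompletion

open Algebra

variable {A : Type*} [AddCommMonoid A]

/-- Every element is a difference of two elements of A. This reduces identities between additive
maps to A; norms are not additive and need `completion_ext` instead. -/
theorem grothendieck_ind {P : GrothendieckAddGroup A → Prop}
    (hof : ∀ a : A, P (GrothendieckAddGroup.of a)) (hsub : ∀ a b, P a → P b → P (a - b))
    (k : GrothendieckAddGroup A) : P k := by
  induction k using AddLocalization.ind with
  | H y =>
    obtain ⟨c, d⟩ := y
    have h : (AddLocalization.mk c d : GrothendieckAddGroup A) =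
        GrothendieckAddGroup.of c - GrothendieckAddGroup.of d.1 := by
      rw [eq_sub_iff_add_eq, AddLocalization.mk_eq_addMonoidOf_mk']
      exact AddSubmonoid.LocalizationMap.mk'_spec _ c d
    rw [h]
    exact hsub _ _ (hof c) (hof d.1)

theorem grothendieck_lift_of {K : Type*} [AddCommGroup K] (φ : A →+ K) (a : A) :
    GrothendieckAddGroup.lift φ (GrothendieckAddGroup.of a) = φ a :=
  DFunLike.congr_fun (GrothendieckAddGroup.lift.symm_apply_apply φ) a

theorem isGroupCompletion_of (A : Type*) [AddCommMonoid A] :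
    IsGroupCompletion (GrothendieckAddGroup.of (M := A)) where
  exists_add_eq := grothendieck_ind (fun a => ⟨a, 0, by rw [map_zero, add_zero]⟩) (by
    rintro k l ⟨a, b, h⟩ ⟨c, d, h'⟩
    refine ⟨a + d, b + c, ?_⟩
    rw [map_add, map_add, ← h, ← h']
    abel)
  eq_iff := fun a b => by
    refine ((AddLocalization.addMonoidOf (⊤ : AddSubmonoid A)).eq_iff_exists).trans ⟨?_, ?_⟩
    · rintro ⟨c, hc⟩
      exact ⟨c.1, by rw [add_comm a, add_comm b, hc]⟩
    · rintro ⟨c, hc⟩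
      exact ⟨⟨c, trivial⟩, by rw [add_comm _ a, add_comm _ b, hc]⟩

variable {R : Type*} [CommSemiring R]

/-- The multiplication of the ring completion. -/
noncomputable def grothendieckMul :
    GrothendieckAddGroup R →+ GrothendieckAddGroup R →+ GrothendieckAddGroup R :=
  GrothendieckAddGroup.lift
    { toFun := fun a => GrothendieckAddGroup.lift
        (GrothendieckAddGroup.of.comp (AddMonoidHom.mulLeft a))
      map_zero' := AddMonoidHom.ext <| grothendieck_ind
        (fun b => by
          rw [grothendieck_lift_of]
          change GrothendieckAddGroup.of (0 * b) = 0
          rw [zero_mul, map_zero])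
        (fun b c hb hc => by rw [map_sub, hb, hc, map_sub])
      map_add' := fun a a' => AddMonoidHom.ext <| grothendieck_ind
        (fun b => by
          rw [AddMonoidHom.add_apply, grothendieck_lift_of, grothendieck_lift_of,
            grothendieck_lift_of]
          change GrothendieckAddGroup.of ((a + a') * b) =
            GrothendieckAddGroup.of (a * b) + GrothendieckAddGroup.of (a' * b)
          rw [add_mul, map_add])
        (fun b c hb hc => by rw [map_sub, hb, hc, map_sub]) }

theorem grothendieckMul_of (a b : R) :
    grothendieckMul (GrothendieckAddGroup.of a) (GrothendieckAddGroup.of b) =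
      GrothendieckAddGroup.of (a * b) := by
  unfold grothendieckMul
  rw [grothendieck_lift_of]
  exact grothendieck_lift_of _ b

theorem grothendieckMul_comm (k l : GrothendieckAddGroup R) :
    grothendieckMul k l = grothendieckMul l k := by
  refine grothendieck_ind (P := fun k => ∀ l, grothendieckMul k l = grothendieckMul l k)
    (fun a => grothendieck_ind (fun b => ?_) fun b b' h h' => ?_) (fun a a' h h' l => ?_) k l
  · rw [grothendieckMul_of, grothendieckMul_of, mul_comm]
  · rw [map_sub, map_sub, AddMonoidHom.sub_apply, h, h']
  · rw [map_sub, map_sub, AddMonoidHom.sub_apply, h, h']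

theorem grothendieckMul_assoc (k l m : GrothendieckAddGroup R) :
    grothendieckMul (grothendieckMul k l) m = grothendieckMul k (grothendieckMul l m) := by
  refine grothendieck_ind (P := fun k => ∀ l m, grothendieckMul (grothendieckMul k l) m =
      grothendieckMul k (grothendieckMul l m))
    (fun a => grothendieck_ind (fun b => grothendieck_ind (fun c => ?_) fun c c' h h' => ?_)
      fun b b' h h' m => ?_) (fun a a' h h' l m => ?_) k l m
  · simp only [grothendieckMul_of, mul_assoc]
  · simp only [map_sub, h, h']
  · simp only [map_sub, AddMonoidHom.sub_apply, h, h']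
  · simp only [map_sub, AddMonoidHom.sub_apply, h, h']

theorem grothendieckMul_one (k : GrothendieckAddGroup R) :
    grothendieckMul k (GrothendieckAddGroup.of 1) = k := by
  refine grothendieck_ind (P := fun k => grothendieckMul k (GrothendieckAddGroup.of 1) = k)
    (fun a => ?_) (fun a a' h h' => ?_) k
  · rw [grothendieckMul_of, mul_one]
  · rw [map_sub, AddMonoidHom.sub_apply, h, h']

/-- The ring structure on the group completion of a semiring. -/
noncomputable instance grothendieckCommRing : CommRing (GrothendieckAddGroup R) :=
  { (inferInstance : AddCommGroup (GrothendieckAddGroup R)) with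
    mul := fun k l => grothendieckMul k l
    one := GrothendieckAddGroup.of 1
    left_distrib := fun k l m => map_add (grothendieckMul k) l m
    right_distrib := fun k l m => DFunLike.congr_fun (map_add grothendieckMul k l) m
    zero_mul := fun k => DFunLike.congr_fun (map_zero grothendieckMul) k
    mul_zero := fun k => map_zero (grothendieckMul k)
    mul_assoc := grothendieckMul_assoc
    one_mul := fun k => (grothendieckMul_comm _ k).trans (grothendieckMul_one k)
    mul_one := grothendieckMul_one
    mul_comm := grothendieckMul_comm }

variable (R) in
/-- The canonical homomorphism from a semiring to its ring completion. -/
noncomputable def toRingCompletion : R →+* GrothendieckAddGroup R where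
  toFun := GrothendieckAddGroup.of
  map_one' := rfl
  map_mul' := fun a b => (grothendieckMul_of a b).symm
  map_zero' := map_zero _
  map_add' := map_add _

theorem isGroupCompletion_toRingCompletion :
    IsGroupCompletion (toRingCompletion R).toAddMonoidHom :=
  isGroupCompletion_of R

theorem isRingCompletion_toRingCompletion : IsRingCompletion (toRingCompletion R) :=
  ⟨fun r => ⟨-r, add_neg_cancel r⟩, (isGroupCompletion_of R).1, (isGroupCompletion_of R).2⟩

/-- The additive homomorphism of ring completions induced by an additive homomorphism. -/
noncomputable def completionMap {R' : Type*} [CommSemiring R'] (f : R →+ R') :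
    GrothendieckAddGroup R →+ GrothendieckAddGroup R' :=
  GrothendieckAddGroup.lift ((toRingCompletion R').toAddMonoidHom.comp f)

theorem completionMap_of {R' : Type*} [CommSemiring R'] (f : R →+ R') (a : R) :
    completionMap f (toRingCompletion R a) = toRingCompletion R' (f a) :=
  grothendieck_lift_of _ a

theorem completion_ind {P : GrothendieckAddGroup R → Prop}
    (hof : ∀ a : R, P (toRingCompletion R a)) (hsub : ∀ a b, P a → P b → P (a - b))
    (k : GrothendieckAddGroup R) : P k :=
  grothendieck_ind hof hsub k

/-- The ring homomorphism of ring completions induced by a homomorphism of semirings. -/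
noncomputable def completionRingMap {R' : Type*} [CommSemiring R'] (f : R →+* R') :
    GrothendieckAddGroup R →+* GrothendieckAddGroup R' :=
  { completionMap f.toAddMonoidHom with
    map_one' := by
      change completionMap f.toAddMonoidHom (toRingCompletion R 1) = toRingCompletion R' 1
      rw [completionMap_of]
      exact congrArg _ (map_one f)
    map_mul' := by
      change ∀ k l, completionMap f.toAddMonoidHom (k * l) =
        completionMap f.toAddMonoidHom k * completionMap f.toAddMonoidHom l
      refine completion_ind (fun a => completion_ind (fun b => ?_) fun b b' h h' => ?_)
        fun a a' h h' l => ?_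
      · rw [← map_mul, completionMap_of, completionMap_of, completionMap_of, ← map_mul]
        exact congrArg _ (map_mul f a b)
      · rw [mul_sub, map_sub, map_sub, h, h', mul_sub]
      · rw [sub_mul, map_sub, map_sub, h, h', sub_mul] }

theorem completionRingMap_of {R' : Type*} [CommSemiring R'] (f : R →+* R') (a : R) :
    completionRingMap f (toRingCompletion R a) = toRingCompletion R' (f a) :=
  grothendieck_lift_of _ a

end RingCompletion

namespace FinGSet

variable {G : Type u} [Group G]

/-! ### Pull-back squares -/

namespace IsPullback

variable {P X Y Z U V W : FinGSet.{u, w} G}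

theorem symm {top : P →[G] Y} {left : P →[G] X} {right : Y →[G] Z} {bot : X →[G] Z}
    (h : IsPullback top left right bot) : IsPullback left top bot right :=
  ⟨fun p => (h.1 p).symm, fun a b hab => by
    obtain ⟨p, h1, h2⟩ := h.2 b a hab.symm
    exact ⟨p, h1.symm, fun q hq => h2 q hq.symm⟩⟩

theorem ext {top : P →[G] Y} {left : P →[G] X} {right : Y →[G] Z} {bot : X →[G] Z}
    (h : IsPullback top left right bot) {p q : P} (h1 : left p = left q) (h2 : top p = top q) :
    p = q :=
  (h.2 (left q) (top q) (h.1 q)).unique ⟨h1, h2⟩ ⟨rfl, rfl⟩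

theorem exists_lift {top : P →[G] Y} {left : P →[G] X} {right : Y →[G] Z} {bot : X →[G] Z}
    (h : IsPullback top left right bot) (a : W →[G] X) (b : W →[G] Y)
    (hab : ∀ c, bot (a c) = right (b c)) :
    ∃ k : W →[G] P, (∀ c, left (k c) = a c) ∧ ∀ c, top (k c) = b c := by
  -- The lift is chosen pointwise; its equivariance follows from the uniqueness of points with given
  -- projections.
  choose k hk using fun c => (h.2 (a c) (b c) (hab c)).exists
  refine ⟨{ toFun := k, map_smul' := fun g c => h.ext ?_ ?_ }, fun c => (hk c).1,
    fun c => (hk c).2⟩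
  · rw [map_smul, (hk c).1, (hk _).1, map_smul, id]
  · rw [map_smul, (hk c).2, (hk _).2, map_smul, id]

theorem paste {top : P →[G] Y} {l₁ : P →[G] X} {r₁ : Y →[G] Z} {mid : X →[G] Z}
    {l₂ : X →[G] U} {r₂ : Z →[G] V} {bot : U →[G] V} (h₁ : IsPullback top l₁ r₁ mid)
    (h₂ : IsPullback mid l₂ r₂ bot) : IsPullback top (l₂.comp l₁) (r₂.comp r₁) bot := by
  refine ⟨fun p => (h₂.1 _).trans (congrArg r₂ (h₁.1 p)), fun a b hab => ?_⟩
  obtain ⟨c, ⟨hc, hc'⟩, -⟩ := h₂.2 a (r₁ b) hab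
  obtain ⟨p, ⟨hp, hp'⟩, -⟩ := h₁.2 c b hc'
  refine ⟨p, ⟨(congrArg l₂ hp).trans hc, hp'⟩, fun q hq => h₁.ext (h₂.ext ?_ ?_) ?_⟩
  · exact hq.1.trans ((congrArg l₂ hp).trans hc).symm
  · rw [h₁.1, h₁.1, hq.2, hp']
  · rw [hq.2, hp']

theorem paste_right {t₁ : P →[G] X} {t₂ : X →[G] U} {left : P →[G] Y} {mid : X →[G] Z}
    {right : U →[G] V} {b₁ : Y →[G] Z} {b₂ : Z →[G] V} (h₁ : IsPullback t₁ left mid b₁)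
    (h₂ : IsPullback t₂ mid right b₂) : IsPullback (t₂.comp t₁) left right (b₂.comp b₁) :=
  (h₁.symm.paste h₂.symm).symm

/-- Cancellation law for pull-back squares. It is what recognises an induced map between fibre
products as a base change of the map between their second factors. -/
theorem of_paste {top : P →[G] Y} {l₁ : P →[G] X} {r₁ : Y →[G] Z} {mid : X →[G] Z}
    {l₂ : X →[G] U} {r₂ : Z →[G] V} {bot : U →[G] V}
    (h : IsPullback top (l₂.comp l₁) (r₂.comp r₁) bot) (h₂ : IsPullback mid l₂ r₂ bot)
    (hc : ∀ p, mid (l₁ p) = r₁ (top p)) : IsPullback top l₁ r₁ mid := by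
  refine ⟨hc, fun a b hab => ?_⟩
  obtain ⟨p, ⟨hp, hp'⟩, -⟩ := h.2 (l₂ a) b ((h₂.1 a).trans (congrArg r₂ hab))
  refine ⟨p, ⟨h₂.ext hp ?_, hp'⟩, fun q hq => h.ext ?_ (hq.2.trans hp'.symm)⟩
  · rw [hc, hp', hab]
  · exact (congrArg l₂ hq.1).trans hp.symm

end IsPullback

/-! ### Exponential diagrams -/

/-- The domain of `s.sec` depends on `s.base`, so an equality of sections cannot be rewritten inside
an application. With arbitrary points and membership proofs, substitution suffices. -/
theorem Sections.sec_eq {A X Y : FinGSet.{u, w} G} {η : X →[G] Y} {p : A →[G] X}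
    {s t : Sections η p} (h : s = t) {a b : X} (hab : a = b) (ha : η a = s.base)
    (hb : η b = t.base) : s.sec ⟨a, ha⟩ = t.sec ⟨b, hb⟩ := by
  subst h hab
  rfl

namespace IsExponential

variable {X Y Z X' Y' : FinGSet.{u, w} G} {η : X →[G] Y} {ξ : Z →[G] X}
  {ζ : X' →[G] Z} {η' : X' →[G] Y'} {υ : Y' →[G] Y}

/-- The points of `Y'` over `y` are the sections over the fibre of `y`: existence. -/
theorem exists_point (h : IsExponential η ξ ζ η' υ) (y : Y) (σ : ∀ x, η x = y → Z)
    (hσ : ∀ x hx, ξ (σ x hx) = x) :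
    ∃ b, υ b = y ∧ ∀ c x hx, ξ (ζ c) = x → η' c = b → ζ c = σ x hx := by
  obtain ⟨hp, e, he, h1, h2⟩ := h
  obtain ⟨b, hb⟩ := he.2 ⟨y, fun a => σ a.1 a.2, fun a => hσ a.1 a.2⟩
  refine ⟨b, (h1 b).symm.trans (congrArg Sections.base hb), ?_⟩
  rintro c x hc rfl rfl
  exact (h2 c ((hp.1 c).trans (h1 _).symm)).symm.trans (Sections.sec_eq hb rfl _ hc)

/-- The points of `Y'` over `y` are the sections over the fibre of `y`: uniqueness. -/
theorem point_ext (h : IsExponential η ξ ζ η' υ) {b b' : Y'} (hb : υ b = υ b')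
    (hs : ∀ c c', η' c = b → η' c' = b' → ξ (ζ c) = ξ (ζ c') → ζ c = ζ c') : b = b' := by
  obtain ⟨hp, e, he, h1, h2⟩ := h
  refine he.1 (Sections.ext' ((h1 b).trans (hb.trans (h1 b').symm)) fun a ha ha' => ?_)
  obtain ⟨c, ⟨hc, rfl⟩, -⟩ := hp.2 a b (ha.trans (h1 b))
  obtain ⟨c', ⟨hc', rfl⟩, -⟩ := hp.2 a b' (ha'.trans (h1 b'))
  have e1 := h2 c ((hp.1 c).trans (h1 _).symm)
  have e2 := h2 c' ((hp.1 c').trans (h1 _).symm)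
  refine (Sections.sec_eq rfl hc.symm _ _).trans (e1.trans ?_)
  refine Eq.trans ?_ (e2.symm.trans (Sections.sec_eq rfl hc' _ _))
  exact hs c c' rfl rfl (hc.trans hc'.symm)

/-- Pointwise criterion for exponential diagrams. -/
theorem of_points (hp : IsPullback η' (ξ.comp ζ) υ η)
    (hex : ∀ (y : Y) (σ : ∀ x, η x = y → Z), (∀ x hx, ξ (σ x hx) = x) →
      ∃ b, υ b = y ∧ ∀ c hc, η' c = b → ζ c = σ (ξ (ζ c)) hc)
    (hext : ∀ b b', υ b = υ b' →
      (∀ c c', η' c = b → η' c' = b' → ξ (ζ c) = ξ (ζ c') → ζ c = ζ c') → b = b') :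
    IsExponential η ξ ζ η' υ := by
  -- `s b a` is the point of X' = X ×_Y Y' with coordinates a and b, so ζ (s b a) is the value at a
  -- of the section encoded by b.
  choose s hs hs' using fun (b : Y') (a : {a : X // η a = υ b}) => (hp.2 a.1 b a.2).exists
  have key : ∀ c b (hb : η' c = b) h, ζ (s b ⟨ξ (ζ c), h⟩) = ζ c := fun c b hb h =>
    congrArg ζ (hp.ext (hs _ _) ((hs' _ _).trans hb.symm))
  refine ⟨hp, { toFun := fun b => ⟨υ b, fun a => ζ (s b a), fun a => hs b a⟩,
                map_smul' := fun g b => ?_ }, ⟨fun b b' h => ?_, fun t => ?_⟩, fun _ => rfl, ?_⟩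
  · refine Sections.ext' (map_smul υ g b) fun a h h' => ?_
    change ζ (s (g • b) ⟨a, h⟩) = g • ζ (s b ⟨g⁻¹ • a, _⟩)
    rw [← map_smul]
    -- Both points of X' have coordinates a and g • b.
    refine congrArg ζ (hp.ext ?_ ?_)
    · refine (hs (g • b) ⟨a, h⟩).trans ?_
      exact ((map_smul (ξ.comp ζ) g _).trans ((congrArg (g • ·) (hs b _)).trans
        (smul_inv_smul g a))).symm
    · rw [hs', map_smul, hs']
  · refine hext b b' (congrArg Sections.base h) fun c c' hc hc' hcc => ?_
    have h1 : η (ξ (ζ c)) = υ b := hc ▸ hp.1 c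
    have h2 : η (ξ (ζ c')) = υ b' := hc' ▸ hp.1 c'
    exact (key c b hc h1).symm.trans ((Sections.sec_eq h hcc h1 h2).trans (key c' b' hc' h2))
  · obtain ⟨b, hb, hbs⟩ := hex t.base (fun x hx => t.sec ⟨x, hx⟩) fun x hx => t.sec_spec _
    refine ⟨b, Sections.ext' hb fun a h h' => ?_⟩
    have h1 : ξ (ζ (s b ⟨a, h⟩)) = a := hs b ⟨a, h⟩
    exact (hbs (s b ⟨a, h⟩) (by rw [h1]; exact h') (hs' _ _)).trans (Sections.sec_eq rfl h1 _ _)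
  · exact fun c h => key c _ rfl h

/-- Uniqueness of exponential diagrams. -/
theorem exists_iso {X'' Y'' : FinGSet.{u, w} G} {ζ' : X'' →[G] Z} {η'' : X'' →[G] Y''}
    {υ' : Y'' →[G] Y} (h : IsExponential η ξ ζ η' υ) (h' : IsExponential η ξ ζ' η'' υ') :
    ∃ (k : Y' →[G] Y'') (l : X' →[G] X''), Function.Bijective k ∧ (∀ b, υ' (k b) = υ b) ∧
      (∀ c, ζ' (l c) = ζ c) ∧ IsPullback η' l k η'' := by
  obtain ⟨hp, e, he, h1, h2⟩ := h
  obtain ⟨hp', e', he', h1', h2'⟩ := h'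
  -- Both Y' and Y'' are identified with the G-set of sections, so k is the inverse of e' after e,
  -- and l is induced on the fibre products with X. That l respects evaluation holds because both
  -- values are those of one section at one point.
  obtain ⟨i, hi, hi'⟩ := exists_inverse e' he'
  have hk : ∀ b, υ' (i (e b)) = υ b := fun b => by rw [← h1', hi', h1]
  obtain ⟨l, hl, hl'⟩ := hp'.exists_lift (ξ.comp ζ) ((i.comp e).comp η')
    fun c => (hp.1 c).trans (hk _).symm
  have hζ : ∀ c, ζ' (l c) = ζ c := by
    intro c
    refine (h2' (l c) ((hp'.1 _).trans (h1' _).symm)).symm.trans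
      (Eq.trans ?_ (h2 c ((hp.1 _).trans (h1 _).symm)))
    refine Sections.sec_eq ?_ (hl c) _ _
    rw [hl']
    exact hi' _
  refine ⟨i.comp e, l, ⟨fun b b' hb => he.1 ?_, fun b => ?_⟩, hk, hζ, fun c => hl' c,
    fun a b hab => ?_⟩
  · rw [← hi' (e b), ← hi' (e b')]
    exact congrArg e' hb
  · obtain ⟨c, hc⟩ := he.2 (e' b)
    exact ⟨c, (congrArg i hc).trans (hi b)⟩
  · obtain ⟨c, ⟨hc, hc'⟩, -⟩ := hp.2 (ξ (ζ' a)) b ((hp'.1 a).trans (hab.symm ▸ hk b))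
    refine ⟨c, ⟨hp'.ext ((hl c).trans hc) ?_, hc'⟩, fun d hd => hp.ext ?_ (hd.2.trans hc'.symm)⟩
    · rw [hl', hab]
      exact congrArg (i.comp e) hc'
    · refine Eq.trans ?_ hc.symm
      rw [← hd.1]
      exact congrArg ξ (hζ d).symm

/-- Exponential diagrams along isomorphic maps to `X`. -/
theorem congr_iso {Z₁ : FinGSet.{u, w} G} {ξ₁ : Z₁ →[G] X} (h : IsExponential η ξ ζ η' υ)
    (f : Z →[G] Z₁) (hf : Function.Bijective f) (hfξ : ∀ a, ξ₁ (f a) = ξ a) :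
    IsExponential η ξ₁ (f.comp ζ) η' υ := by
  have e1 : ξ₁.comp (f.comp ζ) = ξ.comp ζ := MulActionHom.ext fun c => hfξ (ζ c)
  obtain ⟨i, hi, hi'⟩ := exists_inverse f hf
  refine of_points (e1 ▸ h.1) (fun y σ hσ => ?_) fun b b' hb hs => ?_
  · obtain ⟨b, hb, hbs⟩ := h.exists_point y (fun x hx => i (σ x hx)) fun x hx => by
      rw [← hfξ, hi', hσ]
    refine ⟨b, hb, fun c hc hcb => ?_⟩
    exact (congrArg f (hbs c _ hc (hfξ _).symm hcb)).trans (hi' _)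
  · exact h.point_ext hb fun c c' hc hc' hcc => hf.1 (hs c c' hc hc'
      ((hfξ _).trans (hcc.trans (hfξ _).symm)))

/-- The exponential diagram of an identity. -/
theorem id_left (ξ : Z →[G] X) :
    IsExponential (MulActionHom.id G) ξ (MulActionHom.id G) (MulActionHom.id G) ξ :=
  of_points ⟨fun _ => rfl, fun a b hab => ⟨b, ⟨hab.symm, rfl⟩, fun _ hq => hq.2⟩⟩
    -- The fibre of the identity over y is {y}, so a section is a point of Z over y.
    (fun y σ hσ => ⟨σ y rfl, hσ y rfl, fun c hc hcb => by
      obtain rfl : ξ c = y := hc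
      exact hcb⟩)
    fun _ _ hb hs => hs _ _ rfl rfl hb

/-- The exponential diagram of an identity over `η`. -/
theorem id_right (η : X →[G] Y) :
    IsExponential η (MulActionHom.id G) (MulActionHom.id G) η (MulActionHom.id G) :=
  of_points ⟨fun _ => rfl, fun a _ hab => ⟨a, ⟨rfl, hab⟩, fun _ hq => hq.1⟩⟩
    (fun y _ hσ => ⟨y, rfl, fun c hc _ => (hσ c hc).symm⟩) fun _ _ h _ => h

/-- Exponential diagrams along a composite `η₂ ∘ η`. -/
theorem comp_left {W X₂ W₂ P : FinGSet.{u, w} G} {η₂ : Y →[G] W} {ζ₂ : X₂ →[G] Y'}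
    {ρ₂ : X₂ →[G] W₂} {υ₂ : W₂ →[G] W} {r : P →[G] X₂} {l : P →[G] X'}
    (h : IsExponential η ξ ζ η' υ) (h₂ : IsExponential η₂ υ ζ₂ ρ₂ υ₂)
    (hP : IsPullback r l ζ₂ η') :
    IsExponential (η₂.comp η) ξ (ζ.comp l) (ρ₂.comp r) υ₂ := by
  have hP' : IsPullback (ρ₂.comp r) (ξ.comp (ζ.comp l)) υ₂ (η₂.comp η) :=
    (hP.paste h.1).paste_right h₂.1
  refine of_points hP' (fun y σ hσ => ?_) fun b b' hb hs => ?_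
  -- A section over the fibre of η₂ ∘ η at y is a family, indexed by the z in the η₂-fibre of y, of
  -- sections over η⁻¹(z). Such a family is a section β of υ over the η₂-fibre, hence a point of W₂.
  · choose β hβ hβ' using fun (z : Y) (hz : η₂ z = y) =>
      h.exists_point z (fun x hx => σ x ((congrArg η₂ hx).trans hz)) fun x hx => hσ x _
    obtain ⟨b, hb, hbs⟩ := h₂.exists_point y β hβ
    refine ⟨b, hb, fun c hc hcb => ?_⟩
    have h1 : υ (ζ₂ (r c)) = η (ξ (ζ (l c))) := by
      rw [← hP.1]
      exact (h.1.1 (l c)).symm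
    exact hβ' _ hc (l c) _ rfl rfl ((hP.1 c).trans (hbs (r c) _ hc h1 hcb))
  · refine h₂.point_ext hb fun c c' hc hc' hcc => h.point_ext hcc fun d d' hd hd' hdd => ?_
    obtain ⟨p, ⟨hp1, hp2⟩, -⟩ := hP.2 d c hd
    obtain ⟨p', ⟨hp1', hp2'⟩, -⟩ := hP.2 d' c' hd'
    have := hs p p' ((congrArg ρ₂ hp2).trans hc) ((congrArg ρ₂ hp2').trans hc')
    subst hp1 hp1'
    exact this hdd

/-- Base change of exponential diagrams. -/
theorem base_change {X₁ Y₁ Z₁ X₁' Y₁' : FinGSet.{u, w} G} {η₁ : X₁ →[G] Y₁} {f' : X₁ →[G] X}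
    {f : Y₁ →[G] Y} {ξ₁ : Z₁ →[G] X₁} {fZ : Z₁ →[G] Z} {υ₁ : Y₁' →[G] Y₁} {k : Y₁' →[G] Y'}
    {η₁' : X₁' →[G] Y₁'} {l : X₁' →[G] X'} (h : IsExponential η ξ ζ η' υ)
    (hX : IsPullback η₁ f' f η) (hZ : IsPullback ξ₁ fZ f' ξ) (hY' : IsPullback υ₁ k f υ)
    (hX' : IsPullback η₁' l k η') :
    ∃ ζ₁ : X₁' →[G] Z₁, (∀ c, fZ (ζ₁ c) = ζ (l c)) ∧ IsExponential η₁ ξ₁ ζ₁ η₁' υ₁ := by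
  -- q is the projection of X₁' to X₁; together with ζ ∘ l it determines ζ₁, since Z₁ = X₁ ×_X Z.
  obtain ⟨q, hq, hq'⟩ := hX.exists_lift (ξ.comp (ζ.comp l)) (υ₁.comp η₁') fun c => by
    refine (h.1.1 (l c)).trans ?_
    rw [hX'.1]
    exact hY'.1 _
  obtain ⟨ζ₁, hζ, hζ'⟩ := hZ.exists_lift (ζ.comp l) q fun c => (hq c).symm
  refine ⟨ζ₁, hζ, of_points ?_ (fun y σ hσ => ?_) fun b b' hb hs => ?_⟩
  · have e1 : f'.comp (ξ₁.comp ζ₁) = (ξ.comp ζ).comp l := MulActionHom.ext fun c => by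
      refine (congrArg f' (hζ' c)).trans (hq c)
    have e2 : f.comp υ₁ = υ.comp k := MulActionHom.ext fun c => (hY'.1 c).symm
    refine IsPullback.of_paste (l₂ := f') (r₂ := f) (bot := η) ?_ hX fun c => ?_
    · rw [e1, e2]
      exact hX'.paste h.1
    · exact (congrArg η₁ (hζ' c)).trans (hq' c)
  -- `s` is the bijection from η⁻¹(f y) to η₁⁻¹(y). Transported along it and composed with fZ, σ
  -- becomes a section of ξ, that is, a point of Y' over f y.
  · choose s hs hs' using fun (x : X) (hx : η x = f y) => (hX.2 x y hx).exists
    obtain ⟨b, hb, hbs⟩ := h.exists_point (f y) (fun x hx => fZ (σ (s x hx) (hs' x hx)))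
      fun x hx => by rw [hZ.1, hσ, hs]
    obtain ⟨b₁, ⟨hb1, hb2⟩, -⟩ := hY'.2 b y hb
    refine ⟨b₁, hb2, fun c hc hcb => hZ.ext ?_ (hσ _ _).symm⟩
    have h1 : η (ξ (ζ (l c))) = f y := by
      refine (h.1.1 (l c)).trans ?_
      rw [hX'.1, hcb, hb1, hb]
    refine (hζ c).trans ((hbs (l c) _ h1 rfl (by rw [hX'.1, hcb, hb1])).trans ?_)
    have h2 : s (ξ (ζ (l c))) h1 = ξ₁ (ζ₁ c) := by
      refine hX.ext ?_ ((hs' _ _).trans hc.symm)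
      rw [hs, ← hZ.1, hζ]
      rfl
    congr 1
    congr 1
  · have hl : ∀ c, f' (ξ₁ (ζ₁ c)) = ξ (ζ (l c)) := fun c => by rw [← hZ.1, hζ]; rfl
    have hη : ∀ c, η₁ (ξ₁ (ζ₁ c)) = υ₁ (η₁' c) := fun c => by rw [hζ', hq']; rfl
    refine hY'.ext (h.point_ext ?_ fun c c' hc hc' hcc => ?_) hb
    · rw [hY'.1, hY'.1, hb]
    · obtain ⟨d, ⟨rfl, hd2⟩, -⟩ := hX'.2 c b hc
      obtain ⟨d', ⟨rfl, hd2'⟩, -⟩ := hX'.2 c' b' hc'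
      refine (hζ d).symm.trans ((congrArg fZ (hs d d' hd2 hd2' (hX.ext ?_ ?_))).trans (hζ d'))
      · rw [hl, hl, hcc]
      · rw [hη, hη, hd2, hd2', hb]

/-- The exponential diagram of a fibre product is the fibre product of exponential diagrams. -/
theorem fiber_prod {Z₂ X₂ Y₂ P Q R : FinGSet.{u, w} G} {ξ₂ : Z₂ →[G] X} {ζ₂ : X₂ →[G] Z₂}
    {η₂ : X₂ →[G] Y₂} {υ₂ : Y₂ →[G] Y} (h : IsExponential η ξ ζ η' υ)
    (h₂ : IsExponential η ξ₂ ζ₂ η₂ υ₂) {a₁ : P →[G] Z} {a₂ : P →[G] Z₂} {b₁ : Q →[G] Y'}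
    {b₂ : Q →[G] Y₂} {ρ : R →[G] Q} {x : R →[G] X} (hP : IsPullback a₂ a₁ ξ₂ ξ)
    (hQ : IsPullback b₂ b₁ υ₂ υ) (hR : IsPullback ρ x (υ.comp b₁) η) :
    ∃ (ζ₃ : R →[G] P) (c₁ : R →[G] X') (c₂ : R →[G] X₂), IsPullback ρ c₁ b₁ η' ∧
      IsPullback ρ c₂ b₂ η₂ ∧ (∀ c, a₁ (ζ₃ c) = ζ (c₁ c)) ∧ (∀ c, a₂ (ζ₃ c) = ζ₂ (c₂ c)) ∧
      IsExponential η (ξ.comp a₁) ζ₃ ρ (υ.comp b₁) := by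
  have e1 : υ.comp b₁ = υ₂.comp b₂ := MulActionHom.ext hQ.1
  obtain ⟨c₁, hc1, hc1'⟩ := h.1.exists_lift x (b₁.comp ρ) hR.1
  obtain ⟨c₂, hc2, hc2'⟩ := h₂.1.exists_lift x (b₂.comp ρ) fun c =>
    (hR.1 c).trans (hQ.1 _)
  have hx1 : (ξ.comp ζ).comp c₁ = x := MulActionHom.ext hc1
  have hx2 : (ξ₂.comp ζ₂).comp c₂ = x := MulActionHom.ext hc2
  obtain ⟨ζ₃, hζ1, hζ2⟩ := hP.exists_lift (ζ.comp c₁) (ζ₂.comp c₂) fun c =>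
    (hc1 c).trans (hc2 c).symm
  -- R = X ×_Y Q and X' = X ×_Y Y', so R = X' ×_{Y'} Q by cancellation; similarly for the second
  -- factor.
  have h1 : IsPullback ρ c₁ b₁ η' := IsPullback.of_paste (hx1.symm ▸ hR) h.1 hc1'
  have h2 : IsPullback ρ c₂ b₂ η₂ := IsPullback.of_paste (hx2.symm ▸ e1 ▸ hR) h₂.1 hc2'
  have hx3 : (ξ.comp a₁).comp ζ₃ = x := MulActionHom.ext fun c => by
    refine (congrArg ξ (hζ1 c)).trans (hc1 c)
  refine ⟨ζ₃, c₁, c₂, h1, h2, hζ1, hζ2, of_points (hx3.symm ▸ hR) (fun y σ hσ => ?_)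
    fun b b' hb hs => ?_⟩
  -- A section of P = Z ×_X Z₂ is a pair of sections, that is, a pair of points of Y' and Y₂ over
  -- the same y.
  · obtain ⟨p, hp, hps⟩ := h.exists_point y (fun x hx => a₁ (σ x hx)) hσ
    obtain ⟨q, hq, hqs⟩ := h₂.exists_point y (fun x hx => a₂ (σ x hx)) fun x hx =>
      (hP.1 _).symm.trans (hσ x hx)
    obtain ⟨b, ⟨hb1, hb2⟩, -⟩ := hQ.2 p q (hp.trans hq.symm)
    refine ⟨b, (congrArg υ hb1).trans hp, fun c hc hcb => hP.ext ?_ ?_⟩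
    · refine (hζ1 c).trans (hps (c₁ c) _ _ (congrArg ξ (hζ1 c)).symm ?_)
      rw [h1.1, hcb, hb1]
    · refine (hζ2 c).trans (hqs (c₂ c) _ _ ?_ ?_)
      · exact (hc2 c).trans (DFunLike.congr_fun hx3 c).symm
      · rw [h2.1, hcb, hb2]
  · refine hQ.ext (h.point_ext hb fun c c' hc hc' hcc => ?_)
      (h₂.point_ext ((hQ.1 b).symm.trans (Eq.trans hb (hQ.1 b'))) fun c c' hc hc' hcc => ?_)
    · obtain ⟨d, ⟨rfl, hd2⟩, -⟩ := h1.2 c b hc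
      obtain ⟨d', ⟨rfl, hd2'⟩, -⟩ := h1.2 c' b' hc'
      refine (hζ1 d).symm.trans ((congrArg a₁ (hs d d' hd2 hd2' ?_)).trans (hζ1 d'))
      exact (congrArg ξ (hζ1 d)).trans (hcc.trans (congrArg ξ (hζ1 d')).symm)
    · obtain ⟨d, ⟨rfl, hd2⟩, -⟩ := h2.2 c b hc
      obtain ⟨d', ⟨rfl, hd2'⟩, -⟩ := h2.2 c' b' hc'
      refine (hζ2 d).symm.trans ((congrArg a₂ (hs d d' hd2 hd2' ?_)).trans (hζ2 d'))
      refine (hP.1 _).trans (Eq.trans ?_ (hP.1 _).symm)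
      rw [hζ2, hζ2]
      exact hcc

/-- Exponential diagrams along a composite `ξ ∘ p`. -/
theorem comp_right {A A' X₂ Y₂ : FinGSet.{u, w} G} {p : A →[G] Z} {p' : A' →[G] X'}
    {ζA : A' →[G] A} {ζ₂ : X₂ →[G] A'} {ρ₂ : X₂ →[G] Y₂} {υ₂ : Y₂ →[G] Y'}
    (h : IsExponential η ξ ζ η' υ) (hA : IsPullback p' ζA ζ p)
    (h₂ : IsExponential η' p' ζ₂ ρ₂ υ₂) :
    IsExponential η (ξ.comp p) (ζA.comp ζ₂) ρ₂ (υ.comp υ₂) := by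
  have e1 : (ξ.comp p).comp (ζA.comp ζ₂) = (ξ.comp ζ).comp (p'.comp ζ₂) :=
    MulActionHom.ext fun c => congrArg ξ (hA.1 (ζ₂ c))
  refine of_points (e1 ▸ h₂.1.paste h.1) (fun y σ hσ => ?_) fun b b' hb hs => ?_
  -- A section σ of ξ ∘ p amounts to the section p ∘ σ of ξ, which is a point b of Y', together with
  -- a lift of it to A. As A' = A ×_Z X', the lift is a section τ of p' over the η'-fibre of b,
  -- which is a point of Y₂ over b.
  · obtain ⟨b, hb, hbs⟩ := h.exists_point y (fun x hx => p (σ x hx)) hσ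
    have hy : ∀ c, η' c = b → η (ξ (ζ c)) = y := fun c hc =>
      (h.1.1 c).trans ((congrArg υ hc).trans hb)
    choose τ hτ hτ' using fun c hc =>
      (hA.2 (σ (ξ (ζ c)) (hy c hc)) c (hbs c _ (hy c hc) rfl hc).symm).exists
    obtain ⟨d, hd, hds⟩ := h₂.exists_point b τ hτ'
    refine ⟨d, (congrArg υ hd).trans hb, fun c hc hcd => ?_⟩
    have h1 : η' (p' (ζ₂ c)) = b := (h₂.1.1 c).trans ((congrArg υ₂ hcd).trans hd)
    refine (congrArg ζA (hds c _ h1 rfl hcd)).trans ((hτ _ _).trans ?_)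
    have h2 : ξ (ζ (p' (ζ₂ c))) = (ξ.comp p) ((ζA.comp ζ₂) c) := (DFunLike.congr_fun e1 c).symm
    congr 1
  · have h3 : υ₂ b = υ₂ b' := by
      refine h.point_ext hb fun c c' hc hc' hcc => ?_
      obtain ⟨d, ⟨rfl, hd2⟩, -⟩ := h₂.1.2 c b hc
      obtain ⟨d', ⟨rfl, hd2'⟩, -⟩ := h₂.1.2 c' b' hc'
      refine (hA.1 _).symm.trans (Eq.trans ?_ (hA.1 _))
      refine congrArg p (hs d d' hd2 hd2' ?_)
      exact (DFunLike.congr_fun e1 d).trans (hcc.trans (DFunLike.congr_fun e1 d').symm)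
    refine h₂.point_ext h3 fun c c' hc hc' hcc => hA.ext (hs c c' hc hc' ?_) hcc
    refine (DFunLike.congr_fun e1 c).trans (Eq.trans ?_ (DFunLike.congr_fun e1 c').symm)
    exact congrArg (fun z => ξ (ζ z)) hcc

end IsExponential

end FinGSet

open FinGSet

/-! ### The semiring of isomorphism classes -/

namespace AdditiveFunctor

variable {G : Type u} [Group G] {F : AdditiveFunctor.{u, v, w} G}

/-- The product of isomorphism classes: the restriction of the cross product to the diagonal. -/
noncomputable def mulCls {X : FinGSet.{u, w} G} (a b : F.IsoClass X) : F.IsoClass X :=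
  resCls (pair (MulActionHom.id G) (MulActionHom.id G)) (crossFun a b)

/-- A × B → X × X pulled back along the diagonal is A ×_X B. Allowing any model P of the fibre
product makes commutativity a mere transposition of the square. -/
theorem mulCls_cls {X A B P : FinGSet.{u, w} G} {p : A →[G] X} {q : B →[G] X} {a : P →[G] A}
    {b : P →[G] B} (h : IsPullback b a q p) (m : F.obj A) (n : F.obj B) :
    mulCls (cls p m) (cls q n) = cls (p.comp a) (F.map a m * F.map b n) := by
  unfold mulCls
  rw [crossFun_cls, resCls_cls (top := p.comp a) (left := pair a b), map_mul, ← F.map_comp,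
    ← F.map_comp]
  · rfl
  · refine ⟨fun c => Prod.ext rfl (h.1 c).symm, fun c x hc => ?_⟩
    have h1 : p c.1 = x := congrArg (fst X X) hc
    have h2 : q c.2 = x := congrArg (snd X X) hc
    obtain ⟨d, ⟨hd, hd'⟩, -⟩ := h.2 c.1 c.2 (h1.trans h2.symm)
    refine ⟨d, ⟨Prod.ext hd hd', (congrArg p hd).trans h1⟩, fun e he => h.ext ?_ ?_⟩
    · exact (congrArg (fst A B) he.1).trans hd.symm
    · exact (congrArg (snd A B) he.1).trans hd'.symm

theorem mulCls_comm {X : FinGSet.{u, w} G} (a b : F.IsoClass X) : mulCls a b = mulCls b a := by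
  induction a using ind_cls with
  | h A p m =>
  induction b using ind_cls with
  | h B q n =>
    have h := isPullback_pull p q
    have e : p.comp (pullFst p q) = q.comp (pullSnd p q) := MulActionHom.ext h.1
    rw [mulCls_cls h, mulCls_cls h.symm, e, mul_comm]

theorem res_mulCls {X Y : FinGSet.{u, w} G} (f : Y →[G] X) (a b : F.IsoClass X) :
    resCls f (mulCls a b) = mulCls (resCls f a) (resCls f b) := by
  unfold mulCls
  rw [← res_crossFun, ← resCls_comp, ← resCls_comp]
  rfl

theorem mulCls_assoc {X : FinGSet.{u, w} G} (a b c : F.IsoClass X) :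
    mulCls (mulCls a b) c = mulCls a (mulCls b c) := by
  unfold mulCls
  -- The unrestricted factor is written as a restriction along the identity, so that `res_crossFun`
  -- applies. Both sides become the restriction of the triple cross product along the triple
  -- diagonal.
  conv_lhs => rw [← resCls_id c]
  conv_rhs => rw [← resCls_id a]
  rw [← res_crossFun, ← res_crossFun, crossFun_assoc, ← resCls_comp, ← resCls_comp,
    ← resCls_comp]
  rfl

theorem mulCls_one {X : FinGSet.{u, w} G} (a : F.IsoClass X) :
    mulCls a (cls (MulActionHom.id G) 1) = a := by
  induction a using ind_cls with
  | h A p m =>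
    rw [mulCls_cls (a := MulActionHom.id G) (b := p), F.map_id, map_one, mul_one]
    · rfl
    · exact ⟨fun _ => rfl, fun c d h => ⟨c, ⟨rfl, h⟩, fun _ he => he.1⟩⟩

theorem mulCls_add {X : FinGSet.{u, w} G} (a b c : F.IsoClass X) :
    mulCls a (b + c) = mulCls a b + mulCls a c := by
  unfold mulCls
  rw [crossFun_add_right, map_add]

theorem mulCls_zero {X : FinGSet.{u, w} G} (a : F.IsoClass X) : mulCls a 0 = 0 := by
  unfold mulCls
  rw [crossFun_zero_right, map_zero]

noncomputable instance isoClassCommSemiring (X : FinGSet.{u, w} G) :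
    CommSemiring (F.IsoClass X) :=
  { (inferInstance : AddCommMonoid (F.IsoClass X)) with
    mul := mulCls
    one := cls (MulActionHom.id G) 1
    left_distrib := mulCls_add
    right_distrib := fun a b c => by
      change mulCls (a + b) c = mulCls a c + mulCls b c
      rw [mulCls_comm, mulCls_add, mulCls_comm c, mulCls_comm c]
    zero_mul := fun a => (mulCls_comm 0 a).trans (mulCls_zero a)
    mul_zero := mulCls_zero
    mul_assoc := mulCls_assoc
    one_mul := fun a => (mulCls_comm _ a).trans (mulCls_one a)
    mul_one := mulCls_one
    mul_comm := mulCls_comm }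

theorem one_eq_cls {X : FinGSet.{u, w} G} :
    (1 : F.IsoClass X) = cls (MulActionHom.id G) 1 := rfl

theorem cls_mul_cls {X A B P : FinGSet.{u, w} G} {p : A →[G] X} {q : B →[G] X} {a : P →[G] A}
    {b : P →[G] B} (h : IsPullback b a q p) (m : F.obj A) (n : F.obj B) :
    cls p m * cls q n = cls (p.comp a) (F.map a m * F.map b n) :=
  mulCls_cls h m n

/-- Restriction of isomorphism classes, as a homomorphism of semirings. -/
noncomputable def resHom {X Y : FinGSet.{u, w} G} (f : Y →[G] X) :
    F.IsoClass X →+* F.IsoClass Y :=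
  { resCls f with
    map_one' := by
      change resCls f (cls (MulActionHom.id G) 1) = cls (MulActionHom.id G) 1
      rw [resCls_cls (top := MulActionHom.id G) (left := f), map_one]
      exact ⟨fun _ => rfl, fun c d h => ⟨d, ⟨h.symm, rfl⟩, fun _ he => he.2⟩⟩
    map_mul' := res_mulCls f }

/-- The diagonal of X × Y followed by p_X × p_Y is the identity. This matches the cross product of
the Burnside functor with that of the Green functor underlying a Tambara functor. -/
theorem crossFun_eq_mul {X Y : FinGSet.{u, w} G} (a : F.IsoClass X) (b : F.IsoClass Y) :
    crossFun a b = resCls (fst X Y) a * resCls (snd X Y) b := by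
  change _ = resCls _ (crossFun _ _)
  rw [← res_crossFun, ← resCls_comp]
  exact (resCls_id _).symm

theorem additive_isoClass (X Y : FinGSet.{u, w} G) :
    Function.Bijective fun a : F.IsoClass (X.sum Y) =>
      (resCls (inl X Y) a, resCls (inr X Y) a) := by
  refine ⟨fun a b hab => ?_, fun c => ⟨trCls (inl X Y) c.1 + trCls (inr X Y) c.2, ?_⟩⟩
  · have h1 : resCls (inl X Y) a = resCls (inl X Y) b := congrArg Prod.fst hab
    have h2 : resCls (inr X Y) a = resCls (inr X Y) b := congrArg Prod.snd hab
    rw [← tr_res_sum a, h1, h2, tr_res_sum]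
  · simp only [map_add, res_inl_tr_inl, res_inl_tr_inr, res_inr_tr_inl, res_inr_tr_inr, add_zero,
      zero_add]

end AdditiveFunctor

open AdditiveFunctor

/-! ### The semi-Tambara functor of isomorphism classes -/

namespace SemiMackeyFunctor

variable {G : Type u} [Group G] (M : SemiMackeyFunctor.{u, v, w} G)

/-- Well-definedness of the norm. An isomorphism A → A₁ over X turns the first diagram into an
exponential diagram for p₁. Uniqueness then gives a bijection Y' → Y'' over Y lying in a pull-back
square with ρ and ρ₁, and the Mackey formula on this square matches the elements. -/
theorem cls_exponential_congr {X Y A A₁ X' Y' X'' Y'' : FinGSet.{u, w} G} {η : X →[G] Y}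
    {p : A →[G] X} {lam : X' →[G] A} {ρ : X' →[G] Y'} {υ : Y' →[G] Y} {p₁ : A₁ →[G] X}
    {lam₁ : X'' →[G] A₁} {ρ₁ : X'' →[G] Y''} {υ₁ : Y'' →[G] Y} {m : M.obj A} {m₁ : M.obj A₁}
    (h : IsExponential η p lam ρ υ) (h₁ : IsExponential η p₁ lam₁ ρ₁ υ₁)
    (e : (cls p m : M.toAdditiveFunctor.IsoClass X) = cls p₁ m₁) :
    (cls υ (M.tr ρ (M.map lam m)) : M.toAdditiveFunctor.IsoClass Y) =
      cls υ₁ (M.tr ρ₁ (M.map lam₁ m₁)) := by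
  obtain ⟨f, hf, hf1, hf2⟩ := Quotient.exact (s := M.overSetoid X) e
  have hf2' : M.map f m₁ = m := hf2
  obtain ⟨k, l, hk, hυ, hl, hP⟩ := (h.congr_iso f hf hf1).exists_iso h₁
  have hl' : lam₁.comp l = f.comp lam := MulActionHom.ext hl
  refine cls_eq k hk hυ ?_
  rw [M.mackey ρ l k ρ₁ hP, ← M.map_comp, hl', M.map_comp, hf2']

/-- Requiring the formula for every exponential diagram, not only the standard one, lets each law
below be proved with the diagram suited to it. -/
theorem exists_norm {X Y : FinGSet.{u, w} G} (η : X →[G] Y) :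
    ∃ N : M.toAdditiveFunctor.IsoClass X → M.toAdditiveFunctor.IsoClass Y,
      ∀ (A X' Y' : FinGSet.{u, w} G) (p : A →[G] X) (lam : X' →[G] A) (ρ : X' →[G] Y')
        (υ : Y' →[G] Y), IsExponential η p lam ρ υ → ∀ m : M.obj A,
        N (cls p m) = cls υ (M.tr ρ (M.map lam m)) := by
  have key : ∀ a : M.toAdditiveFunctor.IsoClass X, ∃ b : M.toAdditiveFunctor.IsoClass Y,
      ∀ (A X' Y' : FinGSet.{u, w} G) (p : A →[G] X) (lam : X' →[G] A) (ρ : X' →[G] Y')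
        (υ : Y' →[G] Y), IsExponential η p lam ρ υ → ∀ m : M.obj A, cls p m = a →
        b = cls υ (M.tr ρ (M.map lam m)) := by
    refine ind_cls fun A p m => ?_
    obtain ⟨X', Y', lam, ρ, υ, h⟩ := exists_isExponential η p
    exact ⟨cls υ (M.tr ρ (M.map lam m)), fun A₁ X'' Y'' p₁ lam₁ ρ₁ υ₁ h₁ m₁ e =>
      M.cls_exponential_congr h h₁ e.symm⟩
  choose N hN using key
  exact ⟨N, fun A X' Y' p lam ρ υ h m => hN _ A X' Y' p lam ρ υ h m rfl⟩

/-- The multiplicative transfer of isomorphism classes. -/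
noncomputable def normFun {X Y : FinGSet.{u, w} G} (η : X →[G] Y) :
    M.toAdditiveFunctor.IsoClass X → M.toAdditiveFunctor.IsoClass Y :=
  (M.exists_norm η).choose

variable {M}

theorem normFun_cls {X Y A X' Y' : FinGSet.{u, w} G} {η : X →[G] Y} {p : A →[G] X}
    {lam : X' →[G] A} {ρ : X' →[G] Y'} {υ : Y' →[G] Y} (h : IsExponential η p lam ρ υ)
    (m : M.obj A) : M.normFun η (cls p m) = cls υ (M.tr ρ (M.map lam m)) :=
  (M.exists_norm η).choose_spec A X' Y' p lam ρ υ h m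

theorem normFun_id {X : FinGSet.{u, w} G} (a : M.toAdditiveFunctor.IsoClass X) :
    M.normFun (MulActionHom.id G) a = a := by
  induction a using ind_cls with
  | h A p m => rw [normFun_cls (IsExponential.id_left p), M.tr_id, M.map_id]

/-- The two exponential diagrams are joined by the pull-back of ρ and λ₂ (`comp_left`), where the
Mackey formula exchanges M^*(λ₂) and M_*(ρ). -/
theorem normFun_comp {X Y Z : FinGSet.{u, w} G} (g : Y →[G] Z) (f : X →[G] Y)
    (a : M.toAdditiveFunctor.IsoClass X) :
    M.normFun (g.comp f) a = M.normFun g (M.normFun f a) := by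
  induction a using ind_cls with
  | h A p m =>
    obtain ⟨X₁, Y₁, lam, ρ, υ, h⟩ := exists_isExponential f p
    obtain ⟨X₂, Y₂, lam₂, ρ₂, υ₂, h₂⟩ := exists_isExponential g υ
    have hP := isPullback_pull ρ lam₂
    rw [normFun_cls h, normFun_cls h₂, normFun_cls (h.comp_left h₂ hP), M.tr_comp, M.map_comp,
      M.mackey _ _ _ _ hP]

/-- Exponential diagrams are stable under base change; the Mackey formula of M for the pull-back of
ρ does the rest. -/
theorem res_normFun {X' Y' X Y : FinGSet.{u, w} G} {g' : X' →[G] Y'} {f' : X' →[G] X}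
    {f : Y' →[G] Y} {g : X →[G] Y} (hP : IsPullback g' f' f g)
    (a : M.toAdditiveFunctor.IsoClass X) :
    resCls f (M.normFun g a) = M.normFun g' (resCls f' a) := by
  induction a using ind_cls with
  | h A p m =>
    obtain ⟨X₁, Y₁, lam, ρ, υ, h⟩ := exists_isExponential g p
    have hA := isPullback_pull p f'
    have hY := isPullback_pull υ f
    have hX := isPullback_pull ρ (pullFst υ f)
    obtain ⟨lam', hlam, h'⟩ := h.base_change hP hA hY hX
    have e : (pullFst p f').comp lam' = lam.comp (pullFst ρ (pullFst υ f)) :=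
      MulActionHom.ext hlam
    rw [normFun_cls h, resCls_cls hY, resCls_cls hA, normFun_cls h', M.mackey _ _ _ _ hX,
      ← M.map_comp, ← M.map_comp, e]

theorem normFun_one {X Y : FinGSet.{u, w} G} (η : X →[G] Y) :
    M.normFun η (1 : M.toAdditiveFunctor.IsoClass X) = 1 := by
  rw [one_eq_cls, normFun_cls (IsExponential.id_right η), map_one, map_one]
  rfl

/-- The diagram of a fibre product is the fibre product of the diagrams (`fiber_prod`). M_* is
multiplicative, and the Mackey formula treats each of the two factors. -/
theorem normFun_mul {X Y : FinGSet.{u, w} G} (η : X →[G] Y)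
    (a b : M.toAdditiveFunctor.IsoClass X) :
    M.normFun η (a * b) = M.normFun η a * M.normFun η b := by
  induction a using ind_cls with
  | h A p m =>
  induction b using ind_cls with
  | h B q n =>
    obtain ⟨X₁, Y₁, lam, ρ, υ, h⟩ := exists_isExponential η p
    obtain ⟨X₂, Y₂, lam₂, ρ₂, υ₂, h₂⟩ := exists_isExponential η q
    have hP := isPullback_pull p q
    have hQ := isPullback_pull υ υ₂
    have hR := isPullback_pull η (υ.comp (pullFst υ υ₂))
    obtain ⟨lam₃, c, c₂, hc, hc₂, e, e₂, h₃⟩ := h.fiber_prod h₂ hP hQ hR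
    have e' : (pullFst p q).comp lam₃ = lam.comp c := MulActionHom.ext e
    have e₂' : (pullSnd p q).comp lam₃ = lam₂.comp c₂ := MulActionHom.ext e₂
    rw [normFun_cls h, normFun_cls h₂, cls_mul_cls hP, cls_mul_cls hQ, normFun_cls h₃, map_mul,
      map_mul, ← M.map_comp, ← M.map_comp, e', e₂', M.map_comp, M.map_comp lam₂,
      M.mackey _ _ _ _ hc, M.mackey _ _ _ _ hc₂]

/-- An exponential diagram composed with one over η' is again exponential (`comp_right`). On the
elements only the functoriality of M^* is needed. -/
theorem normFun_tr {X Y Z X' Y' : FinGSet.{u, w} G} {η : X →[G] Y} {ξ : Z →[G] X}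
    {ζ : X' →[G] Z} {η' : X' →[G] Y'} {υ : Y' →[G] Y} (h : IsExponential η ξ ζ η' υ)
    (a : M.toAdditiveFunctor.IsoClass Z) :
    trCls υ (M.normFun η' (resCls ζ a)) = M.normFun η (trCls ξ a) := by
  induction a using ind_cls with
  | h A p m =>
    have hA := isPullback_pull p ζ
    obtain ⟨X₂, Y₂, lam, ρ, υ₂, h₂⟩ := exists_isExponential η' (pullSnd p ζ)
    rw [resCls_cls hA, normFun_cls h₂, trCls_cls, trCls_cls, normFun_cls (h.comp_right hA h₂),
      M.map_comp]

variable (M)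

/-- The semi-Tambara functor `S_M` of isomorphism classes of pairs `(A → X, m)`. -/
noncomputable def semiTambarization : SemiTambaraFunctor.{u, max u v (w + 1), w} G where
  obj := M.toAdditiveFunctor.IsoClass
  res := resHom
  tr := trCls
  nm := fun η =>
    { toFun := M.normFun η
      map_one' := normFun_one η
      map_mul' := normFun_mul η }
  res_id := fun _ => resCls_id
  res_comp := resCls_comp
  tr_id := fun _ => ind_cls fun _ _ _ => rfl
  tr_comp := fun _ _ => ind_cls fun _ _ _ => rfl
  nm_id := fun _ => normFun_id
  nm_comp := normFun_comp
  mackey_tr := res_trCls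
  mackey_nm := fun _ _ _ _ h => res_normFun h
  additive_empty := ⟨fun a b => (eq_zero_of_isEmpty a).trans (eq_zero_of_isEmpty b).symm⟩
  additive_sum := additive_isoClass
  exponential := fun _ _ _ _ _ h => normFun_tr h

theorem isSemiTambarization_semiTambarization : IsSemiTambarization M M.semiTambarization :=
  ⟨fun _ => Equiv.refl _, fun _ _ _ => rfl, fun _ _ _ p m q n =>
    cls_mul_cls (isPullback_pull p q) m n,
    fun _ _ _ f p m => resCls_cls (isPullback_pull p f) m, fun _ _ _ _ _ _ => rfl,
    fun _ _ _ _ _ _ _ _ _ _ h m => normFun_cls h m⟩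

end SemiMackeyFunctor

/-! ### The multiplicative transfer of a sum -/

namespace FinGSet

variable {G : Type u} [Group G]

/-- The sub-`G`-set given by an invariant predicate. -/
def sub (X : FinGSet.{u, w} G) (P : X → Prop) (hP : ∀ (g : G) x, P x → P (g • x)) :
    FinGSet.{u, w} G where
  carrier := {x : X // P x}
  act :=
    { smul := fun g x => ⟨g • x.1, hP g x.1 x.2⟩
      one_smul := fun x => Subtype.ext (one_smul G x.1)
      mul_smul := fun a b x => Subtype.ext (mul_smul a b x.1) }

/-- The inclusion of a sub-`G`-set. -/
def incl (X : FinGSet.{u, w} G) (P : X → Prop) (hP : ∀ (g : G) x, P x → P (g • x)) :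
    sub X P hP →[G] X where
  toFun := fun x => x.1
  map_smul' := fun _ _ => rfl

/-- The number of points of a fibre. -/
noncomputable def fibCard {X Y : FinGSet.{u, w} G} (f : X →[G] Y) (y : Y) : ℕ :=
  Nat.card {x : X // f x = y}

/-- The exponential diagram of `η` and the fold map of `X`, decomposed: the subsets of the fibres
of `η` are the proper subsets and the full ones. -/
theorem exists_fold_exponential {X Y : FinGSet.{u, w} G} (η : X →[G] Y) :
    ∃ (X₁ Y₁ V U U' : FinGSet.{u, w} G) (ζ : X₁ →[G] X.sum X) (ρ : X₁ →[G] Y₁)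
      (υ : Y₁ →[G] Y) (j : Y →[G] Y₁) (jX : X →[G] X₁) (iV : V →[G] Y₁) (iU : U →[G] X₁)
      (iU' : U' →[G] X₁) (s : U →[G] V) (s' : U' →[G] V) (r : U →[G] X) (r' : U' →[G] X),
      IsExponential η (copair (MulActionHom.id G) (MulActionHom.id G)) ζ ρ υ ∧
      Function.Bijective (copair j iV) ∧ (∀ y, υ (j y) = y) ∧ IsPullback η jX j ρ ∧
      IsPullback (copair s s') (copair iU iU') iV ρ ∧ (∀ x, ζ (jX x) = Sum.inl x) ∧
      (∀ c, ζ (iU c) = Sum.inl (r c)) ∧ (∀ c, ζ (iU' c) = Sum.inr (r' c)) ∧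
      (∀ b, fibCard s b < fibCard η (υ (iV b))) ∧
      ∀ b, fibCard s' b ≤ fibCard η (υ (iV b)) := by
  let fold : X.sum X →[G] X := copair (MulActionHom.id G) (MulActionHom.id G)
  obtain ⟨X₁, Y₁, ζ, ρ, υ, h⟩ := exists_isExponential η fold
  -- A section of the fold map is a labelling of the fibre by `inl` and `inr`, so the points of Y₁
  -- over y are the subsets of η⁻¹(y). The point j y is the labelling with constant value `inl`,
  -- that is, the full subset.
  choose j hj hj' using fun y => h.exists_point y (fun x _ => Sum.inl x) fun _ _ => rfl
  have hjl : ∀ y c, ρ c = j y → ζ c = Sum.inl (fold (ζ c)) := fun y c hc =>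
    hj' y c (fold (ζ c)) ((h.1.1 c).trans ((congrArg υ hc).trans (hj y))) rfl hc
  have hju : ∀ b, (∀ c, ρ c = b → ζ c = Sum.inl (fold (ζ c))) → b = j (υ b) := fun b hb =>
    h.point_ext (hj _).symm fun c c' hc hc' hcc =>
      (hb c hc).trans ((congrArg Sum.inl hcc).trans (hjl _ c' hc').symm)
  -- j was obtained by choice; it is equivariant because a labelling with all values `inl` is unique
  -- over its base point.
  let J : Y →[G] Y₁ :=
    { toFun := j
      map_smul' := fun g y => by
        have h1 : g • j y = j (υ (g • j y)) := by
          refine hju _ fun c hc => ?_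
          have h2 := hjl y (g⁻¹ • c) (by rw [map_smul, hc, inv_smul_smul])
          rw [map_smul, map_smul] at h2
          exact smul_left_cancel (g⁻¹) (y := (Sum.inl (fold (ζ c)) : X.sum X)) h2
        rw [map_smul, hj] at h1
        exact h1.symm }
  obtain ⟨jX, hjX, hjX'⟩ := h.1.exists_lift (MulActionHom.id G) (J.comp η)
    fun x => (hj (η x)).symm
  have hζj : ∀ x, ζ (jX x) = Sum.inl x := fun x =>
    (hjl _ _ (hjX' x)).trans (congrArg Sum.inl (hjX x))
  -- V consists of the proper subsets. U and U' are the points of X₁ over V labelled `inl` and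
  -- `inr`, so the fibre of U at b is the subset itself and that of U' is its complement.
  let PV : Y₁ → Prop := fun b => b ≠ J (υ b)
  have hPV : ∀ (g : G) b, PV b → PV (g • b) := fun g b hb hb' => hb <| by
    rw [map_smul, map_smul] at hb'
    exact smul_left_cancel g hb'
  let PU : X₁ → Prop := fun c => PV (ρ c) ∧ ∃ x, ζ c = Sum.inl x
  have hPU : ∀ (g : G) c, PU c → PU (g • c) := by
    rintro g c ⟨h1, x, hx⟩
    refine ⟨?_, g • x, ?_⟩
    · rw [map_smul]
      exact hPV g _ h1
    · rw [map_smul, hx]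
      rfl
  let PU' : X₁ → Prop := fun c => PV (ρ c) ∧ ∃ x, ζ c = Sum.inr x
  have hPU' : ∀ (g : G) c, PU' c → PU' (g • c) := by
    rintro g c ⟨h1, x, hx⟩
    refine ⟨?_, g • x, ?_⟩
    · rw [map_smul]
      exact hPV g _ h1
    · rw [map_smul, hx]
      rfl
  let s : sub X₁ PU hPU →[G] sub Y₁ PV hPV :=
    { toFun := fun c => ⟨ρ c.1, c.2.1⟩
      map_smul' := fun g c => Subtype.ext (map_smul ρ g c.1) }
  let s' : sub X₁ PU' hPU' →[G] sub Y₁ PV hPV :=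
    { toFun := fun c => ⟨ρ c.1, c.2.1⟩
      map_smul' := fun g c => Subtype.ext (map_smul ρ g c.1) }
  refine ⟨X₁, Y₁, sub Y₁ PV hPV, sub X₁ PU hPU, sub X₁ PU' hPU', ζ, ρ, υ, J, jX,
    incl Y₁ PV hPV, incl X₁ PU hPU, incl X₁ PU' hPU', s, s',
    (fold.comp ζ).comp (incl X₁ PU hPU), (fold.comp ζ).comp (incl X₁ PU' hPU'), h, ?_, hj,
    ?_, ?_, hζj, ?_, ?_, ?_, ?_⟩
  · refine ⟨?_, fun b => ?_⟩
    · rintro (y | b) (y' | b') e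
      · have e' : j y = j y' := e
        rw [← hj y, e', hj]
      · have e' : j y = b'.1 := e
        refine absurd ?_ b'.2
        rw [← e', hj]
        rfl
      · have e' : b.1 = j y' := e
        refine absurd ?_ b.2
        rw [e', hj]
        rfl
      · exact congrArg Sum.inr (Subtype.ext e)
    · by_cases hb : b = J (υ b)
      · exact ⟨Sum.inl (υ b), hb.symm⟩
      · exact ⟨Sum.inr ⟨b, hb⟩, rfl⟩
  · refine ⟨hjX', fun c y hc => ?_⟩
    have h1 : η (fold (ζ c)) = y := (h.1.1 c).trans ((congrArg υ hc).trans (hj y))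
    refine ⟨fold (ζ c), ⟨h.1.ext (hjX _) ?_, h1⟩, fun x hx => ?_⟩
    · rw [hjX', hc, ← h1]
      rfl
    · rw [← hx.1, hζj]
      rfl
  · refine ⟨?_, fun c b hcb => ?_⟩
    · rintro (c | c) <;> rfl
    · have hc : PV (ρ c) := by
        rw [hcb]
        exact b.2
      rcases hz : ζ c with x | x
      · refine ⟨Sum.inl ⟨c, hc, x, hz⟩, ⟨rfl, Subtype.ext hcb⟩, ?_⟩
        rintro (d | d) ⟨hd, -⟩
        · exact congrArg Sum.inl (Subtype.ext hd)
        · obtain ⟨x', hx'⟩ := d.2.2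
          have h1 : d.1 = c := hd
          rw [h1, hz] at hx'
          exact absurd hx' Sum.inl_ne_inr
      · refine ⟨Sum.inr ⟨c, hc, x, hz⟩, ⟨rfl, Subtype.ext hcb⟩, ?_⟩
        rintro (d | d) ⟨hd, -⟩
        · obtain ⟨x', hx'⟩ := d.2.2
          have h1 : d.1 = c := hd
          rw [h1, hz] at hx'
          exact absurd hx' Sum.inr_ne_inl
        · exact congrArg Sum.inr (Subtype.ext hd)
  · rintro ⟨c, hc, x, hx⟩
    change ζ c = Sum.inl (fold (ζ c))
    rw [hx]
    rfl
  · rintro ⟨c, hc, x, hx⟩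
    change ζ c = Sum.inr (fold (ζ c))
    rw [hx]
    rfl
  · intro b
    -- A proper subset misses some point of the fibre of η; the injection i of the subset into the
    -- fibre is then not surjective, so the cardinalities differ.
    obtain ⟨c, hc, hcl⟩ : ∃ c, ρ c = b.1 ∧ ζ c ≠ Sum.inl (fold (ζ c)) := by
      by_contra! hcon
      exact b.2 (hju b.1 hcon)
    let i : {c // s c = b} → {x // η x = υ b.1} := fun d =>
      ⟨fold (ζ d.1.1), (h.1.1 d.1.1).trans (congrArg υ (congrArg Subtype.val d.2))⟩
    have hi : Function.Injective i := fun d d' hd =>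
      Subtype.ext (Subtype.ext (h.1.ext (congrArg Subtype.val hd)
        ((congrArg Subtype.val d.2).trans (congrArg Subtype.val d'.2).symm)))
    refine lt_of_le_of_ne (Nat.card_le_card_of_injective i hi) fun hcard => ?_
    obtain ⟨d, hd⟩ := ((Nat.bijective_iff_injective_and_card i).2 ⟨hi, hcard⟩).2
      ⟨fold (ζ c), (h.1.1 c).trans (congrArg υ hc)⟩
    have h1 : d.1.1 = c := h.1.ext (congrArg Subtype.val hd)
      ((congrArg Subtype.val d.2).trans hc.symm)
    obtain ⟨x, hx⟩ := d.1.2.2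
    rw [h1] at hx
    refine hcl ?_
    rw [hx]
    rfl
  · intro b
    refine Nat.card_le_card_of_injective (fun d : {c // s' c = b} =>
      (⟨fold (ζ d.1.1), (h.1.1 d.1.1).trans (congrArg υ (congrArg Subtype.val d.2))⟩ :
        {x // η x = υ b.1})) fun d d' hd => ?_
    exact Subtype.ext (Subtype.ext (h.1.ext (congrArg Subtype.val hd)
        ((congrArg Subtype.val d.2).trans (congrArg Subtype.val d'.2).symm)))

end FinGSet

namespace SemiTambaraFunctor

variable {G : Type u} [Group G] (S : SemiTambaraFunctor.{u, v, w} G)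

/-! ### Values on empty sets and additive transfers along direct sums. -/

theorem subsingleton_of_isEmpty (X : FinGSet.{u, w} G) [IsEmpty X] : Subsingleton (S.obj X) := by
  have := S.additive_empty
  let i : X →[G] FinGSet.empty.{u, w} G :=
    { toFun := fun x => isEmptyElim x, map_smul' := fun _ x => isEmptyElim x }
  have e : (FinGSet.elim X).comp i = MulActionHom.id G := MulActionHom.ext fun x => isEmptyElim x
  refine ⟨fun a b => ?_⟩
  rw [← S.res_id X a, ← S.res_id X b, ← e, S.res_comp, S.res_comp,
    Subsingleton.elim (S.res (FinGSet.elim X) a)]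

theorem res_tr_inl (X Y : FinGSet.{u, w} G) (a : S.obj X) :
    S.res (inl X Y) (S.tr (inl X Y) a) = a := by
  rw [S.mackey_tr (MulActionHom.id G) (MulActionHom.id G) (inl X Y) (inl X Y), S.tr_id, S.res_id]
  exact ⟨fun _ => rfl, fun p q h => ⟨p, ⟨rfl, Sum.inl_injective h⟩, fun r hr => hr.1⟩⟩

theorem res_tr_inr (X Y : FinGSet.{u, w} G) (a : S.obj Y) :
    S.res (inr X Y) (S.tr (inr X Y) a) = a := by
  rw [S.mackey_tr (MulActionHom.id G) (MulActionHom.id G) (inr X Y) (inr X Y), S.tr_id, S.res_id]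
  exact ⟨fun _ => rfl, fun p q h => ⟨p, ⟨rfl, Sum.inr_injective h⟩, fun r hr => hr.1⟩⟩

theorem res_inr_tr_inl (X Y : FinGSet.{u, w} G) (a : S.obj X) :
    S.res (inr X Y) (S.tr (inl X Y) a) = 0 := by
  have := S.additive_empty
  rw [S.mackey_tr (FinGSet.elim Y) (FinGSet.elim X) (inr X Y) (inl X Y),
    Subsingleton.elim (S.res (FinGSet.elim X) a) 0, map_zero]
  exact ⟨fun p => PEmpty.elim p, fun p q h => absurd h Sum.inl_ne_inr⟩

theorem res_inl_tr_inr (X Y : FinGSet.{u, w} G) (a : S.obj Y) :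
    S.res (inl X Y) (S.tr (inr X Y) a) = 0 := by
  have := S.additive_empty
  rw [S.mackey_tr (FinGSet.elim X) (FinGSet.elim Y) (inl X Y) (inr X Y),
    Subsingleton.elim (S.res (FinGSet.elim Y) a) 0, map_zero]
  exact ⟨fun p => PEmpty.elim p, fun p q h => absurd h Sum.inr_ne_inl⟩

theorem tr_res_add_tr_res (X Y : FinGSet.{u, w} G) (c : S.obj (X.sum Y)) :
    S.tr (inl X Y) (S.res (inl X Y) c) + S.tr (inr X Y) (S.res (inr X Y) c) = c := by
  apply (S.additive_sum X Y).1
  simp only [map_add, res_tr_inl, res_tr_inr, res_inr_tr_inl, res_inl_tr_inr, add_zero, zero_add]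

theorem tr_copair (X Y Z : FinGSet.{u, w} G) (f : X →[G] Z) (g : Y →[G] Z)
    (c : S.obj (X.sum Y)) :
    S.tr (copair f g) c = S.tr f (S.res (inl X Y) c) + S.tr g (S.res (inr X Y) c) := by
  conv_lhs => rw [← S.tr_res_add_tr_res X Y c]
  rw [map_add, ← S.tr_comp, ← S.tr_comp]
  rfl

theorem tr_res_of_bijective {X Y : FinGSet.{u, w} G} (f : X →[G] Y) (hf : Function.Bijective f)
    (a : S.obj Y) : S.tr f (S.res f a) = a := by
  rw [← S.mackey_tr f f (MulActionHom.id G) (MulActionHom.id G), S.tr_id, S.res_id]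
  refine ⟨fun _ => rfl, fun b c h => ?_⟩
  obtain ⟨d, rfl⟩ := hf.2 b
  exact ⟨d, ⟨rfl, h⟩, fun e he => hf.1 he.1⟩

/-- The multiplicative transfer of a sum. -/
theorem exists_nm_add {X Y : FinGSet.{u, w} G} (η : X →[G] Y) :
    ∃ (V U U' : FinGSet.{u, w} G) (υ : V →[G] Y) (s : U →[G] V) (s' : U' →[G] V)
      (r : U →[G] X) (r' : U' →[G] X),
      (∀ b, fibCard s b < fibCard η (υ b)) ∧ (∀ b, fibCard s' b ≤ fibCard η (υ b)) ∧
      ∀ a b : S.obj X, S.nm η (a + b) =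
        S.nm η a + S.tr υ (S.nm s (S.res r a) * S.nm s' (S.res r' b)) := by
  obtain ⟨X₁, Y₁, V, U, U', ζ, ρ, υ, j, jX, iV, iU, iU', s, s', r, r', h, hb, hj, hP, hP', h1, h2,
    h3, h4, h5⟩ := exists_fold_exponential η
  refine ⟨V, U, U', υ.comp iV, s, s', r, r', h4, h5, fun a b => ?_⟩
  -- c is the pair (a, b) on X ⊔ X, and a + b is its additive transfer along the fold map, so the
  -- exponential formula applies to N_η(a + b).
  obtain ⟨c, hc⟩ := (S.additive_sum X X).2 (a, b)
  have hc1 : S.res (inl X X) c = a := congrArg Prod.fst hc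
  have hc2 : S.res (inr X X) c = b := congrArg Prod.snd hc
  have e0 : S.tr (copair (MulActionHom.id G) (MulActionHom.id G)) c = a + b := by
    rw [S.tr_copair, S.tr_id, S.tr_id, hc1, hc2]
  have e1 : υ.comp j = MulActionHom.id G := MulActionHom.ext hj
  have e2 : ζ.comp jX = inl X X := MulActionHom.ext h1
  have e3 : ζ.comp iU = (inl X X).comp r := MulActionHom.ext h2
  have e4 : ζ.comp iU' = (inr X X).comp r' := MulActionHom.ext h3
  have e5 : (copair j iV).comp (inl Y V) = j := rfl
  have e6 : (copair j iV).comp (inr Y V) = iV := rfl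
  have e7 : (copair iU iU').comp (inl U U') = iU := rfl
  have e8 : (copair iU iU').comp (inr U U') = iU' := rfl
  -- The outer transfer splits along Y₁ = Y ⊔ V. On Y all labels are `inl`, which gives N_η(a). On V
  -- the covering is U ⊔ U' with values res a and res b, and the norm from a direct sum is a
  -- product.
  rw [← e0, ← S.exponential _ _ _ _ _ h, ← S.tr_res_of_bijective _ hb (S.nm ρ (S.res ζ c)),
    S.tr_copair, ← S.res_comp, ← S.res_comp, e5, e6, map_add, ← S.tr_comp, e1, S.tr_id,
    ← S.tr_comp, S.mackey_nm _ _ _ _ hP, ← S.res_comp, e2, hc1, S.mackey_nm _ _ _ _ hP',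
    S.nm_copair, ← S.res_comp, ← S.res_comp, ← S.res_comp, e7, e3, S.res_comp, hc1,
    ← S.res_comp, e8, e4, S.res_comp, hc2]

end SemiTambaraFunctor

/-! ### Extension of polynomial maps -/

/-- A map is polynomial if it is polynomial of some finite degree. -/
def IsPolynomialMap {A B : Type*} [AddCommMonoid A] [AddCommGroup B] (φ : A → B) : Prop :=
  ∃ n, HasDegreeLT n φ

namespace IsPolynomialMap

variable {A A' B B' : Type*} [AddCommMonoid A] [AddCommMonoid A'] [AddCommGroup B]
  [AddCommGroup B'] {φ ψ : A → B}

theorem add (hφ : IsPolynomialMap φ) (hψ : IsPolynomialMap ψ) :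
    IsPolynomialMap fun a => φ a + ψ a := by
  obtain ⟨n, hn⟩ := hφ
  obtain ⟨m, hm⟩ := hψ
  exact ⟨max n m, (hn.mono (le_max_left _ _)).add (hm.mono (le_max_right _ _))⟩

theorem comp_hom (h : IsPolynomialMap φ) (f : A' →+ A) : IsPolynomialMap fun a => φ (f a) :=
  h.imp fun _ hn => hn.comp_hom f

theorem hom_comp (h : IsPolynomialMap φ) (f : B →+ B') : IsPolynomialMap fun a => f (φ a) :=
  h.imp fun _ hn => hn.hom_comp f

theorem shift (h : IsPolynomialMap φ) (d : A) : IsPolynomialMap fun a => φ (a + d) :=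
  h.imp fun _ hn => hn.shift d

theorem const (b : B) : IsPolynomialMap fun _ : A => b := ⟨1, HasDegreeLT.const b⟩

theorem congr (h : IsPolynomialMap φ) (e : ∀ a, φ a = ψ a) : IsPolynomialMap ψ :=
  h.imp fun _ hn => hn.congr e

end IsPolynomialMap

open Algebra

/-- The replacement for additivity: identities involving norms on the completion need only be
checked on the semiring, once both sides are known to be polynomial. -/
theorem completion_ext {R B : Type*} [CommSemiring R] [AddCommGroup B]
    {φ ψ : GrothendieckAddGroup R → B} (hφ : IsPolynomialMap φ) (hψ : IsPolynomialMap ψ)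
    (h : ∀ a, φ (toRingCompletion R a) = ψ (toRingCompletion R a)) (k : GrothendieckAddGroup R) :
    φ k = ψ k := by
  obtain ⟨n, hn⟩ := hφ
  obtain ⟨m, hm⟩ := hψ
  exact isGroupCompletion_toRingCompletion.ext_of_degreeLT hn hm h k

/-! ### Multiplicative transfers on the ring completions. -/

namespace SemiTambaraFunctor

variable {G : Type u} [Group G] (S : SemiTambaraFunctor.{u, v, w} G)

/-- The canonical map to the ring completion of a value of a semi-Tambara functor. -/
noncomputable abbrev toCompletion (X : FinGSet.{u, w} G) :
    S.obj X →+* GrothendieckAddGroup (S.obj X) :=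
  toRingCompletion (S.obj X)

theorem completion_eq_zero_of_isEmpty {X : FinGSet.{u, w} G} [IsEmpty X]
    (k : GrothendieckAddGroup (S.obj X)) : k = 0 := by
  have := S.subsingleton_of_isEmpty X
  refine completion_ind (P := fun k => k = 0) (fun a => ?_) (fun a b ha hb => ?_) k
  · rw [Subsingleton.elim a 0, map_zero]
  · rw [ha, hb, sub_zero]

theorem isEmpty_of_fibCard_lt_zero {X Y : FinGSet.{u, w} G} {η : X →[G] Y}
    (h : ∀ y, fibCard η y < 0) : IsEmpty Y :=
  ⟨fun y => Nat.not_lt_zero _ (h y)⟩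

/-- Multiplicative transfers are polynomial. -/
theorem hasDegreeLT_nm (n : ℕ) {X Y : FinGSet.{u, w} G} (η : X →[G] Y)
    (hη : ∀ y, fibCard η y < n) : HasDegreeLT n fun a => S.toCompletion Y (S.nm η a) := by
  induction n generalizing X Y with
  | zero =>
    have := isEmpty_of_fibCard_lt_zero hη
    exact fun a => S.completion_eq_zero_of_isEmpty _
  | succ n ih =>
    intro c
    -- The difference in direction c is a ↦ tr(N_s(res a) · N_s'(res c)): additive maps around N_s,
    -- which has degree less than n because the fibres of s are strictly smaller.
    obtain ⟨V, U, U', υ, s, s', r, r', hs, -, h⟩ := S.exists_nm_add η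
    have h1 := ih s fun v => lt_of_lt_of_le (hs v) (Nat.lt_succ_iff.1 (hη (υ v)))
    refine (((h1.comp_hom (S.res r).toAddMonoidHom).hom_comp
      (AddMonoidHom.mulRight (S.toCompletion V (S.nm s' (S.res r' c))))).hom_comp
        (completionMap (S.tr υ))).congr fun a => ?_
    change completionMap (S.tr υ) (S.toCompletion V (S.nm s (S.res r a)) *
      S.toCompletion V (S.nm s' (S.res r' c))) =
        S.toCompletion Y (S.nm η (a + c)) - S.toCompletion Y (S.nm η a)
    rw [h, map_add, add_sub_cancel_left, ← map_mul, completionMap_of]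

theorem exists_completionNorm {X Y : FinGSet.{u, w} G} (η : X →[G] Y) :
    ∃ N : GrothendieckAddGroup (S.obj X) → GrothendieckAddGroup (S.obj Y),
      IsPolynomialMap N ∧ ∀ a, N (S.toCompletion X a) = S.toCompletion Y (S.nm η a) := by
  -- Every fibre of η is a subset of X.
  have h := S.hasDegreeLT_nm (Nat.card X + 1) η fun y =>
    Nat.lt_succ_iff.2 (Nat.card_le_card_of_injective _ Subtype.val_injective)
  obtain ⟨N, hN, hN'⟩ := (isGroupCompletion_toRingCompletion (R := S.obj X)).exists_extension h
  exact ⟨N, ⟨_, hN⟩, hN'⟩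

/-- The multiplicative transfer on the ring completions: the polynomial extension of `nm`. -/
noncomputable def completionNorm {X Y : FinGSet.{u, w} G} (η : X →[G] Y) :
    GrothendieckAddGroup (S.obj X) → GrothendieckAddGroup (S.obj Y) :=
  (S.exists_completionNorm η).choose

theorem isPolynomialMap_completionNorm {X Y : FinGSet.{u, w} G} (η : X →[G] Y) :
    IsPolynomialMap (S.completionNorm η) :=
  (S.exists_completionNorm η).choose_spec.1

theorem completionNorm_of {X Y : FinGSet.{u, w} G} (η : X →[G] Y) (a : S.obj X) :
    S.completionNorm η (S.toCompletion X a) = S.toCompletion Y (S.nm η a) :=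
  (S.exists_completionNorm η).choose_spec.2 a

/-- The formula for the norm of a sum is polynomial in each variable separately, so it extends first
in k, with l in the semiring, and then in l. -/
theorem completionNorm_add {X Y : FinGSet.{u, w} G} (η : X →[G] Y) :
    ∃ (V U U' : FinGSet.{u, w} G) (υ : V →[G] Y) (s : U →[G] V) (s' : U' →[G] V)
      (r : U →[G] X) (r' : U' →[G] X),
      (∀ b, fibCard s b < fibCard η (υ b)) ∧ (∀ b, fibCard s' b ≤ fibCard η (υ b)) ∧
      ∀ k l, S.completionNorm η (k + l) = S.completionNorm η k +
        completionMap (S.tr υ) (S.completionNorm s (completionRingMap (S.res r) k) *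
          S.completionNorm s' (completionRingMap (S.res r') l)) := by
  obtain ⟨V, U, U', υ, s, s', r, r', hs, hs', h⟩ := S.exists_nm_add η
  refine ⟨V, U, U', υ, s, s', r, r', hs, hs', fun k l => ?_⟩
  have hη := S.isPolynomialMap_completionNorm η
  have hr := (S.isPolynomialMap_completionNorm s).comp_hom
    (completionRingMap (S.res r)).toAddMonoidHom
  have hr' := (S.isPolynomialMap_completionNorm s').comp_hom
    (completionRingMap (S.res r')).toAddMonoidHom
  have h1 : ∀ (b : S.obj X) k, S.completionNorm η (k + S.toCompletion X b) =
      S.completionNorm η k +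
        completionMap (S.tr υ) (S.completionNorm s (completionRingMap (S.res r) k) *
          S.completionNorm s' (completionRingMap (S.res r') (S.toCompletion X b))) := by
    intro b
    refine completion_ext (hη.shift _) (hη.add ((hr.hom_comp (AddMonoidHom.mulRight _)).hom_comp
      (completionMap (S.tr υ)))) fun a => ?_
    change _ = S.completionNorm η (S.toCompletion X a) +
      completionMap (S.tr υ)
        (S.completionNorm s (completionRingMap (S.res r) (S.toCompletion X a)) *
          S.completionNorm s' (completionRingMap (S.res r') (S.toCompletion X b)))
    rw [← map_add, completionNorm_of, completionNorm_of, completionRingMap_of,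
      completionRingMap_of, completionNorm_of, completionNorm_of, ← map_mul, completionMap_of,
      ← map_add, h]
  refine completion_ext (φ := fun l => S.completionNorm η (k + l))
    ((hη.shift k).congr fun l => by rw [add_comm]) ((IsPolynomialMap.const _).add
      ((hr'.hom_comp (AddMonoidHom.mulLeft _)).hom_comp (completionMap (S.tr υ))))
      (fun b => h1 b k) l

/-- The composite of a polynomial map with a multiplicative transfer is polynomial. -/
theorem exists_hasDegreeLT_completionNorm {B : Type*} [AddCommMonoid B] (n m : ℕ) :
    ∃ d, ∀ {X Y : FinGSet.{u, w} G} (η : X →[G] Y), (∀ y, fibCard η y < n) →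
      ∀ φ : B → GrothendieckAddGroup (S.obj X), HasDegreeLT m φ →
        HasDegreeLT d fun b => S.completionNorm η (φ b) := by
  -- Double induction on the bound n for the fibres and the degree bound m of φ. The bound d has to
  -- be uniform in η and φ, since the sum formula replaces both.
  induction n generalizing m with
  | zero =>
    refine ⟨0, fun η hη φ _ b => ?_⟩
    have := isEmpty_of_fibCard_lt_zero hη
    exact S.completion_eq_zero_of_isEmpty _
  | succ n ihn =>
    induction m with
    | zero =>
      -- Here φ = 0, so the composite is constant.
      refine ⟨1, fun η _ φ hφ => (HasDegreeLT.const (S.completionNorm η 0)).congr fun b => ?_⟩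
      rw [hφ b]
    | succ m ihm =>
      -- In N_η(φ b + (φ(b + c) − φ b)), the factor N_s has smaller fibres and the same φ, which is
      -- the outer induction. The factor N_s' may have fibres as large as those of η but is applied
      -- to a difference of φ, of lower degree, which is the inner induction.
      obtain ⟨d, hd⟩ := ihn (m + 1)
      obtain ⟨d', hd'⟩ := ihm
      refine ⟨d + d' + 1, fun {X Y} η hη φ hφ c => ?_⟩
      obtain ⟨V, U, U', υ, s, s', r, r', hs, hs', h⟩ := S.completionNorm_add η
      have h1 := hd s (fun v => lt_of_lt_of_le (hs v) (Nat.lt_succ_iff.1 (hη (υ v)))) _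
        (hφ.hom_comp (completionRingMap (S.res r)).toAddMonoidHom)
      have h2 := hd' s' (fun v => lt_of_le_of_lt (hs' v) (hη (υ v))) _
        ((hφ c).hom_comp (completionRingMap (S.res r')).toAddMonoidHom)
      refine ((h1.mul h2).hom_comp (completionMap (S.tr υ))).congr fun b => ?_
      have h3 := h (φ b) (φ (b + c) - φ b)
      rw [add_sub_cancel] at h3
      exact (sub_eq_of_eq_add' h3).symm

theorem isPolynomialMap_completionNorm_comp {B : Type*} [AddCommMonoid B]
    {X Y : FinGSet.{u, w} G} (η : X →[G] Y) {φ : B → GrothendieckAddGroup (S.obj X)}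
    (hφ : IsPolynomialMap φ) : IsPolynomialMap fun b => S.completionNorm η (φ b) := by
  obtain ⟨m, hm⟩ := hφ
  obtain ⟨d, hd⟩ := S.exists_hasDegreeLT_completionNorm (B := B) (Nat.card X + 1) m
  exact ⟨d, hd η (fun y => Nat.lt_succ_iff.2
    (Nat.card_le_card_of_injective _ Subtype.val_injective)) φ hm⟩

/-! ### The ring completion of a semi-Tambara functor -/

theorem completionNorm_id {X : FinGSet.{u, w} G} (k : GrothendieckAddGroup (S.obj X)) :
    S.completionNorm (MulActionHom.id G) k = k :=
  completion_ext (ψ := fun k => k) (S.isPolynomialMap_completionNorm _)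
    -- The first differences of the identity are constant.
    ⟨2, fun _ => (HasDegreeLT.const _).congr fun _ => (add_sub_cancel_left _ _).symm⟩
    (fun a => by rw [completionNorm_of, S.nm_id]) k

/-- The right-hand side is a composite of two non-additive maps; that it is polynomial is exactly
`isPolynomialMap_completionNorm_comp`. -/
theorem completionNorm_comp {X Y Z : FinGSet.{u, w} G} (g : Y →[G] Z) (f : X →[G] Y)
    (k : GrothendieckAddGroup (S.obj X)) :
    S.completionNorm (g.comp f) k = S.completionNorm g (S.completionNorm f k) :=
  completion_ext (S.isPolynomialMap_completionNorm _)
    (S.isPolynomialMap_completionNorm_comp g (S.isPolynomialMap_completionNorm f))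
    (fun a => by rw [completionNorm_of, completionNorm_of, completionNorm_of, S.nm_comp]) k

/-- Both sides are polynomial in each variable with the other fixed, so the identity extends from
the semiring one variable at a time. -/
theorem completionNorm_mul {X Y : FinGSet.{u, w} G} (η : X →[G] Y)
    (k l : GrothendieckAddGroup (S.obj X)) :
    S.completionNorm η (k * l) = S.completionNorm η k * S.completionNorm η l := by
  have hη := S.isPolynomialMap_completionNorm η
  have h1 : ∀ (b : S.obj X) k, S.completionNorm η (k * S.toCompletion X b) =
      S.completionNorm η k * S.completionNorm η (S.toCompletion X b) := fun b =>
    completion_ext (hη.comp_hom (AddMonoidHom.mulRight _))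
      (hη.hom_comp (AddMonoidHom.mulRight _)) fun a => by
        change S.completionNorm η (S.toCompletion X a * S.toCompletion X b) =
          S.completionNorm η (S.toCompletion X a) * S.completionNorm η (S.toCompletion X b)
        rw [← map_mul, completionNorm_of, completionNorm_of, completionNorm_of, ← map_mul, map_mul]
  exact completion_ext (φ := fun l => S.completionNorm η (k * l))
    (hη.comp_hom (AddMonoidHom.mulLeft k)) (hη.hom_comp (AddMonoidHom.mulLeft _))
    (fun b => h1 b k) l

/-- The inverse is the sum of the additive transfers along the two inclusions; the relations saying
so are additive and extend from S. -/
theorem additive_completion (X Y : FinGSet.{u, w} G) :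
    Function.Bijective fun k : GrothendieckAddGroup (S.obj (X.sum Y)) =>
      (completionRingMap (S.res (inl X Y)) k, completionRingMap (S.res (inr X Y)) k) := by
  have h1 : ∀ k, completionRingMap (S.res (inl X Y)) (completionMap (S.tr (inl X Y)) k) = k :=
    completion_ind (fun a => by rw [completionMap_of, completionRingMap_of, res_tr_inl])
      (fun a b ha hb => by rw [map_sub, map_sub, ha, hb])
  have h2 : ∀ k, completionRingMap (S.res (inr X Y)) (completionMap (S.tr (inr X Y)) k) = k :=
    completion_ind (fun a => by rw [completionMap_of, completionRingMap_of, res_tr_inr])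
      (fun a b ha hb => by rw [map_sub, map_sub, ha, hb])
  have h3 : ∀ k, completionRingMap (S.res (inr X Y)) (completionMap (S.tr (inl X Y)) k) = 0 :=
    completion_ind
      (fun a => by rw [completionMap_of, completionRingMap_of, res_inr_tr_inl, map_zero])
      (fun a b ha hb => by rw [map_sub, map_sub, ha, hb, sub_zero])
  have h4 : ∀ k, completionRingMap (S.res (inl X Y)) (completionMap (S.tr (inr X Y)) k) = 0 :=
    completion_ind
      (fun a => by rw [completionMap_of, completionRingMap_of, res_inl_tr_inr, map_zero])
      (fun a b ha hb => by rw [map_sub, map_sub, ha, hb, sub_zero])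
  have h5 : ∀ k, completionMap (S.tr (inl X Y)) (completionRingMap (S.res (inl X Y)) k) +
      completionMap (S.tr (inr X Y)) (completionRingMap (S.res (inr X Y)) k) = k :=
    completion_ind
      (fun a => by
        rw [completionRingMap_of, completionRingMap_of, completionMap_of, completionMap_of,
          ← map_add, tr_res_add_tr_res])
      (fun a b ha hb => by
        rw [map_sub, map_sub, map_sub, map_sub, sub_add_sub_comm, ha, hb])
  refine ⟨fun k l hkl => ?_, fun c =>
    ⟨completionMap (S.tr (inl X Y)) c.1 + completionMap (S.tr (inr X Y)) c.2, Prod.ext ?_ ?_⟩⟩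
  · have h6 : completionRingMap (S.res (inl X Y)) k = completionRingMap (S.res (inl X Y)) l :=
      congrArg Prod.fst hkl
    have h7 : completionRingMap (S.res (inr X Y)) k = completionRingMap (S.res (inr X Y)) l :=
      congrArg Prod.snd hkl
    rw [← h5 k, h6, h7, h5]
  · change completionRingMap (S.res (inl X Y)) _ = _
    rw [map_add, h1, h4, add_zero]
  · change completionRingMap (S.res (inr X Y)) _ = _
    rw [map_add, h3, h2, zero_add]

theorem completion_mackey_nm {X' Y' X Y : FinGSet.{u, w} G} (g' : X' →[G] Y') (f' : X' →[G] X)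
    (f : Y' →[G] Y) (g : X →[G] Y) (h : IsPullback g' f' f g)
    (k : GrothendieckAddGroup (S.obj X)) :
    completionRingMap (S.res f) (S.completionNorm g k) =
      S.completionNorm g' (completionRingMap (S.res f') k) :=
  completion_ext
    ((S.isPolynomialMap_completionNorm g).hom_comp (completionRingMap (S.res f)).toAddMonoidHom)
    ((S.isPolynomialMap_completionNorm g').comp_hom (completionRingMap (S.res f')).toAddMonoidHom)
    (fun a => by
      change completionRingMap (S.res f) (S.completionNorm g (S.toCompletion X a)) =
        S.completionNorm g' (completionRingMap (S.res f') (S.toCompletion X a))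
      rw [completionNorm_of, completionRingMap_of, completionRingMap_of, completionNorm_of,
        S.mackey_nm _ _ _ _ h]) k

theorem completion_exponential {X Y Z X' Y' : FinGSet.{u, w} G} (η : X →[G] Y) (ξ : Z →[G] X)
    (ζ : X' →[G] Z) (η' : X' →[G] Y') (υ : Y' →[G] Y) (h : IsExponential η ξ ζ η' υ)
    (k : GrothendieckAddGroup (S.obj Z)) :
    completionMap (S.tr υ) (S.completionNorm η' (completionRingMap (S.res ζ) k)) =
      S.completionNorm η (completionMap (S.tr ξ) k) :=
  completion_ext
    (((S.isPolynomialMap_completionNorm η').comp_hom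
      (completionRingMap (S.res ζ)).toAddMonoidHom).hom_comp (completionMap (S.tr υ)))
    ((S.isPolynomialMap_completionNorm η).comp_hom (completionMap (S.tr ξ)))
    (fun a => by
      change completionMap (S.tr υ) (S.completionNorm η' (completionRingMap (S.res ζ)
        (S.toCompletion Z a))) = S.completionNorm η (completionMap (S.tr ξ) (S.toCompletion Z a))
      rw [completionRingMap_of, completionNorm_of, completionMap_of, completionMap_of,
        completionNorm_of, S.exponential _ _ _ _ _ h]) k

/-- The Tambara functor obtained from a semi-Tambara functor by ring completion. -/
noncomputable def completion : TambaraFunctor.{u, v, w} G where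
  obj := fun X => GrothendieckAddGroup (S.obj X)
  commSemiring := fun _ => grothendieckCommRing.toCommSemiring
  res := fun f => completionRingMap (S.res f)
  tr := fun f => completionMap (S.tr f)
  nm := fun f =>
    { toFun := S.completionNorm f
      map_one' := by
        have h := S.completionNorm_of f 1
        rwa [map_one, map_one, map_one] at h
      map_mul' := S.completionNorm_mul f }
  res_id := fun X => completion_ind (fun a => by rw [completionRingMap_of, S.res_id])
    (fun a b ha hb => by rw [map_sub, ha, hb])
  res_comp := fun g f => completion_ind
    (fun a => by
      rw [completionRingMap_of, completionRingMap_of, completionRingMap_of, S.res_comp])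
    (fun a b ha hb => by rw [map_sub, map_sub, map_sub, ha, hb])
  tr_id := fun X => completion_ind (fun a => by rw [completionMap_of, S.tr_id])
    (fun a b ha hb => by rw [map_sub, ha, hb])
  tr_comp := fun g f => completion_ind
    (fun a => by rw [completionMap_of, completionMap_of, completionMap_of, S.tr_comp])
    (fun a b ha hb => by rw [map_sub, map_sub, map_sub, ha, hb])
  nm_id := fun _ => S.completionNorm_id
  nm_comp := S.completionNorm_comp
  mackey_tr := fun g' f' f g h => completion_ind
    (fun a => by
      rw [completionMap_of, completionRingMap_of, completionRingMap_of, completionMap_of,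
        S.mackey_tr _ _ _ _ h])
    (fun a b ha hb => by rw [map_sub, map_sub, map_sub, map_sub, ha, hb])
  mackey_nm := S.completion_mackey_nm
  additive_empty := ⟨fun a b => (S.completion_eq_zero_of_isEmpty a).trans
    (S.completion_eq_zero_of_isEmpty b).symm⟩
  additive_sum := S.additive_completion
  exponential := S.completion_exponential
  exists_add_eq_zero := fun _ a => ⟨-a, add_neg_cancel a⟩

/-- The canonical morphism from a semi-Tambara functor to its ring completion. -/
noncomputable def completionHom : SemiTambaraHom S S.completion.toSemiTambaraFunctor where
  app := S.toCompletion
  app_res := fun f a => (completionRingMap_of (S.res f) a).symm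
  app_tr := fun f a => (completionMap_of (S.tr f) a).symm
  app_nm := fun f a => (S.completionNorm_of f a).symm

theorem isRingCompletion_completionHom (X : FinGSet.{u, w} G) :
    IsRingCompletion (S.completionHom.app X) :=
  isRingCompletion_toRingCompletion

end SemiTambaraFunctor

/-! ### Comparison with the `F`-Burnside Green functor -/

/-- The isomorphism from the Grothendieck group to any group completion. -/
noncomputable def IsGroupCompletion.equiv {A K : Type*} [AddCommMonoid A] [AddCommGroup K]
    {ι : A →+ K} (hι : IsGroupCompletion ι) : Algebra.GrothendieckAddGroup A ≃+ K :=
  AddEquiv.ofBijective (Algebra.GrothendieckAddGroup.lift ι) <| by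
    refine ⟨(injective_iff_map_eq_zero _).2 fun k hk => ?_, fun k => ?_⟩
    -- If k = [a] − [b] is killed, then ι a = ι b. Both completions identify the same pairs, those
    -- equal after adding some c, so [a] = [b].
    · obtain ⟨a, b, hab⟩ := (isGroupCompletion_of A).exists_add_eq k
      have h1 := congrArg (Algebra.GrothendieckAddGroup.lift ι) hab
      rw [map_add, hk, zero_add, grothendieck_lift_of, grothendieck_lift_of] at h1
      rwa [((isGroupCompletion_of A).eq_iff a b).2 ((hι.eq_iff a b).1 h1.symm),
        add_eq_right] at hab
    · obtain ⟨a, b, hab⟩ := hι.exists_add_eq k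
      refine ⟨Algebra.GrothendieckAddGroup.of a - Algebra.GrothendieckAddGroup.of b, ?_⟩
      rw [map_sub, grothendieck_lift_of, grothendieck_lift_of, ← hab, add_sub_cancel_right]

theorem IsGroupCompletion.equiv_of {A K : Type*} [AddCommMonoid A] [AddCommGroup K]
    {ι : A →+ K} (hι : IsGroupCompletion ι) (a : A) :
    hι.equiv (Algebra.GrothendieckAddGroup.of a) = ι a :=
  grothendieck_lift_of ι a

variable {G : Type u} [Group G]

/-- The inverse of an isomorphism of Green functors. -/
def GreenIso.symm {A B : GreenFunctor.{u, v, w} G} (e : GreenIso A B) : GreenIso B A where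
  app := fun X => (e.app X).symm
  app_res := fun f b => by
    rw [AddEquiv.symm_apply_eq, e.app_res, AddEquiv.apply_symm_apply]
  app_tr := fun f b => by
    rw [AddEquiv.symm_apply_eq, e.app_tr, AddEquiv.apply_symm_apply]
  app_cross := fun X Y a b => by
    rw [AddEquiv.symm_apply_eq, e.app_cross, AddEquiv.apply_symm_apply,
      AddEquiv.apply_symm_apply]
  app_unit := by rw [AddEquiv.symm_apply_eq, e.app_unit]

/-- The isomorphism from the `F`-Burnside Green functor to a Green functor whose values are group
completions of the monoids of isomorphism classes. -/
noncomputable def burnsideIso {F : AdditiveFunctor.{u, v, w} G}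
    (A : GreenFunctor.{u, max u v (w + 1), w} G) (φ : ∀ X, F.IsoClass X →+ A.obj X)
    (hφ : ∀ X, IsGroupCompletion (φ X))
    (hres : ∀ {X Y : FinGSet.{u, w} G} (f : X →[G] Y) (a : F.IsoClass Y),
      φ X (resCls f a) = A.res f (φ Y a))
    (htr : ∀ {X Y : FinGSet.{u, w} G} (f : X →[G] Y) (a : F.IsoClass X),
      φ Y (trCls f a) = A.tr f (φ X a))
    (hcross : ∀ (X Y : FinGSet.{u, w} G) (a : F.IsoClass X) (b : F.IsoClass Y),
      φ (X.prod Y) (crossFun a b) = A.cross X Y (φ X a) (φ Y b))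
    (hunit : φ (FinGSet.pt G) (cls (MulActionHom.id G) 1) = A.unit) :
    GreenIso F.burnsideGreen A where
  app := fun X => (hφ X).equiv
  app_res := fun {X Y} f => by
    change ∀ a : F.Burnside Y, (hφ X).equiv (burnsideRes f a) = A.res f ((hφ Y).equiv a)
    refine burnside_ind (fun a => ?_) fun a b ha hb => ?_
    · rw [burnsideRes_of, IsGroupCompletion.equiv_of, IsGroupCompletion.equiv_of, hres]
    · rw [map_sub, map_sub, map_sub, map_sub, ha, hb]
  app_tr := fun {X Y} f => by
    change ∀ a : F.Burnside X, (hφ Y).equiv (burnsideTr f a) = A.tr f ((hφ X).equiv a)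
    refine burnside_ind (fun a => ?_) fun a b ha hb => ?_
    · rw [burnsideTr_of, IsGroupCompletion.equiv_of, IsGroupCompletion.equiv_of, htr]
    · rw [map_sub, map_sub, map_sub, map_sub, ha, hb]
  app_cross := fun X Y => by
    change ∀ (a : F.Burnside X) (b : F.Burnside Y), (hφ (X.prod Y)).equiv (burnsideCross X Y a b) =
      A.cross X Y ((hφ X).equiv a) ((hφ Y).equiv b)
    refine burnside_ind (fun a => burnside_ind (fun b => ?_) fun b b' h h' => ?_)
      fun a a' h h' b => ?_
    · rw [burnsideCross_of, IsGroupCompletion.equiv_of, IsGroupCompletion.equiv_of,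
        IsGroupCompletion.equiv_of, hcross]
    · simp only [map_sub, h, h']
    · simp only [map_sub, AddMonoidHom.sub_apply, h, h']
  app_unit := ((hφ _).equiv_of _).trans hunit

/-- Only the structure seen by the underlying Green functor is kept; the clause on multiplicative
transfers is not needed for the comparison. -/
theorem IsSemiTambarization.exists_ringEquiv {M : SemiMackeyFunctor.{u, v, w} G}
    {S : SemiTambaraFunctor.{u, max u v (w + 1), w} G} (h : IsSemiTambarization M S) :
    ∃ e : ∀ X : FinGSet.{u, w} G, M.toAdditiveFunctor.IsoClass X ≃+* S.obj X,
      (∀ {X Y : FinGSet.{u, w} G} (f : X →[G] Y) a, e X (resCls f a) = S.res f (e Y a)) ∧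
      ∀ {X Y : FinGSet.{u, w} G} (f : X →[G] Y) a, e Y (trCls f a) = S.tr f (e X a) := by
  obtain ⟨e, hadd, hmul, hres, htr, -⟩ := h
  refine ⟨fun X => { e X with map_add' := hadd X, map_mul' := fun a b => ?_ },
    fun {X Y} f a => ?_, fun {X Y} f a => ?_⟩
  · change e X (a * b) = e X a * e X b
    induction a using ind_cls with
    | h A p m =>
    induction b using ind_cls with
    | h B q n => rw [hmul, cls_mul_cls (isPullback_pull p q)]
  · change e X (resCls f a) = S.res f (e Y a)
    induction a using ind_cls with
    | h A p m => rw [hres, resCls_cls (isPullback_pull p f)]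
  · change e Y (trCls f a) = S.tr f (e X a)
    induction a using ind_cls with
    | h A p m => rw [htr, trCls_cls]

/-- A ring completion is in particular a group completion of the additive monoid, so the values of
any such T are Grothendieck groups of isomorphism classes. This is why the isomorphism holds for
every T characterised as T_M, not just for the one constructed. -/
theorem IsTambarization.nonempty_greenIso {M : SemiMackeyFunctor.{u, v, w} G}
    {T : TambaraFunctor.{u, max u v (w + 1), w} G} (h : IsTambarization M T) :
    Nonempty (GreenIso T.toGreen M.toAdditiveFunctor.burnsideGreen) := by
  obtain ⟨S, hS, ι, hι⟩ := h
  obtain ⟨e, hres, htr⟩ := hS.exists_ringEquiv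
  let ψ : ∀ X, M.toAdditiveFunctor.IsoClass X →+* T.obj X := fun X =>
    (ι.app X).comp (e X).toRingHom
  -- The same map as ψ, now into the abelian group T(X) of the Green functor. Its negation comes
  -- from a choice, but its addition is that of T by definition.
  let φ : ∀ X, M.toAdditiveFunctor.IsoClass X →+ T.toGreen.obj X := fun X =>
    { toFun := ψ X, map_zero' := map_zero (ψ X), map_add' := map_add (ψ X) }
  have hψres : ∀ {X Y : FinGSet.{u, w} G} (f : X →[G] Y) a,
      ψ X (resCls f a) = T.res f (ψ Y a) := fun {X Y} f a =>
    (congrArg (ι.app X) (hres f a)).trans (ι.app_res f _)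
  refine ⟨(burnsideIso T.toGreen φ (fun X => ⟨fun k => ?_, fun a b => ?_⟩) hψres
    (fun {X Y} f a => (congrArg (ι.app Y) (htr f a)).trans (ι.app_tr f _))
    (fun X Y a b => ?_) (map_one (ψ _))).symm⟩
  · obtain ⟨a, b, hab⟩ := (hι X).2.1 k
    obtain ⟨a, rfl⟩ := (e X).surjective a
    obtain ⟨b, rfl⟩ := (e X).surjective b
    exact ⟨a, b, hab⟩
  · refine ((hι X).2.2 (e X a) (e X b)).trans ⟨?_, ?_⟩
    · rintro ⟨c, hc⟩
      refine ⟨(e X).symm c, (e X).injective ?_⟩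
      rw [map_add, map_add, RingEquiv.apply_symm_apply, hc]
    · rintro ⟨c, hc⟩
      exact ⟨e X c, by rw [← map_add, ← map_add, hc]⟩
  · change ψ _ (crossFun a b) = T.res (fst X Y) (ψ X a) * T.res (snd X Y) (ψ Y b)
    rw [crossFun_eq_mul, map_mul, hψres, hψres]

theorem SemiMackeyFunctor.isTambarization_completion (M : SemiMackeyFunctor.{u, v, w} G) :
    IsTambarization M M.semiTambarization.completion :=
  ⟨M.semiTambarization, M.isSemiTambarization_semiTambarization,
    M.semiTambarization.completionHom, M.semiTambarization.isRingCompletion_completionHom⟩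

end MackeyTambara

theorem theorem1 {G : Type u} [Group G] [Finite G] (F : AdditiveFunctor.{u, v, w} G) :
    ((∃ M : SemiMackeyFunctor.{u, v, w} G, M.toAdditiveFunctor = F) →
      ∃ T : TambaraFunctor.{u, max u v (w + 1), w} G,
        Nonempty (GreenIso T.toGreen F.burnsideGreen)) ∧
    ∀ M : SemiMackeyFunctor.{u, v, w} G, M.toAdditiveFunctor = F →
      (∃ T : TambaraFunctor.{u, max u v (w + 1), w} G, IsTambarization M T) ∧
      ∀ T : TambaraFunctor.{u, max u v (w + 1), w} G, IsTambarization M T →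
        Nonempty (GreenIso T.toGreen F.burnsideGreen) := by
  refine ⟨?_, ?_⟩
  · rintro ⟨M, rfl⟩
    exact ⟨_, M.isTambarization_completion.nonempty_greenIso⟩
  · rintro M rfl
    exact ⟨⟨_, M.isTambarization_completion⟩, fun T hT => hT.nonempty_greenIso⟩
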